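/- **Setting.** Let $n\ge 2$. For $i=1,\dots,n$ let $A_i\subset\mathbb R^n$ be finite with $\#A_i\ge 2$ and $A_i-A_i\subset\mathbb Z^n$, and let $\rho_{i\mathbf a}>0$ for $\mathbf a\in A_i$. Put $V_{A_i}(\mathbf x)=(\rho_{i\mathbf a}e^{\mathbf a\mathbf x})_{\mathbf a\in A_i}$ for $\mathbf x\in\mathbb C^n$, $\mathscr F_{A_i}=\mathbb C^{A_i}$ with its canonical Hermitian norm, $\mathscr F=\prod_i\mathscr F_{A_i}$, and $\mathbf f\cdot\mathbf V(\mathbf x)=\big(\sum_{\mathbf a\in A_i}f_{i\mathbf a}\rho_{i\mathbf a}e^{\mathbf a\mathbf x}\big)_i\in\mathbb C^n$. Let $D[V_{A_i}](\mathbf x)=\|V_{A_i}(\mathbf x)\|^{-1}P_{V_{A_i}(\mathbf x)^\perp}DV_{A_i}(\mathbf x)$, $\|\mathbf u\|_{i,\mathbf x}=\|D[V_{A_i}](\mathbf x)\mathbf u\|$ and $\|\mathbf u\|_{\mathbf x}^2=\sum_i\|\mathbf u\|_{i,\mathbf x}^2$. Assume that the supports are shifted so that $\sum_{\mathbf a\in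 A_i}\rho_{i\mathbf a}^2\,\mathbf a=\mathbf 0$ for every $i$ (the momenta $\mathbf m_i(\mathbf 0)$ vanish). For $\mathbf f\in\mathscr F$ let $M(\mathbf f)$ be the operator with rows $\mathbf f_i\cdot D[V_{A_i}](\mathbf 0)$, and let $$\mu(\mathbf f)=\|M(\mathbf f)^{-1}\mathrm{diag}(\|\mathbf f_i\|)\|_{\mathbf 0},\qquad \beta(\mathbf f)=\Big\|M(\mathbf f)^{-1}\Big(\tfrac{\mathbf f_i\cdot V_{A_i}(\mathbf 0)}{\|V_{A_i}(\mathbf 0)\|}\Big)_i\Big\|_{\mathbf 0},\qquad \nu=\max_i\max_{\mathbf a\in A_i}\sup_{\|\mathbf u\|_{i,\mathbf 0}\le1}|\mathbf a\mathbf u|,$$ where $\mu$ is the operator norm from $\mathbb C^n$ with its canonical norm to $(\mathbb C^n,\|\cdot\|_{\mathbf 0})$, and $\mu=\beta=\beta\mu\nu=\infty$ if $M(\mathbf f)$ is singular. The renormalization operator is $\mathbf f\cdot R(\mathbf u)=(f_{i\mathbf a}e^{\mathbf a\mathbf u})_{i,\mathbf a}$. The renormalized Newton iterate of $\mathbf x$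 for $\mathbf f$ is $N(\mathbf f\cdot R(\mathbf x),\mathbf 0)+\mathbf x$ with $N(\mathbf g,\mathbf 0)=-(\mathbf g\cdot D\mathbf V(\mathbf 0))^{-1}(\mathbf g\cdot\mathbf V(\mathbf 0))$; it is defined when $M(\mathbf f\cdot R(\mathbf x))$ is invertible. Let $-\infty\le t_0<T\le\infty$. A $C^1$ path $(\mathbf q_t)_{t\in[t_0,T]}$ in $\mathscr F$ here is a path with $\mathbf q_{i,t}\ne 0$ for all $i$ and all $t\in[t_0,T]$ that is $C^1$ at the finite times of $[t_0,T]$, and, at an infinite end-point, converges to its end-point in $\prod_i\mathbb P(\mathscr F_{A_i})$. Given $\alpha_*>0$ and $\mathbf x_0\in\mathbb C^n$, the renormalized homotopy is the recurrence $$\mathbf x_{j+1}=N(\mathbf q_{t_j}\cdot R(\mathbf x_j),\mathbf 0)+\mathbf x_j,\qquad t_{j+1}=\min\Big(T,\ \inf\{t\in(t_j,T]:\tfrac12\beta(\mathbf q_t\cdot R(\mathbf x_{j+1}))\,\mu(\mathbf q_t\cdot R(\mathbf x_{j+1}))\,\nu\ge\alpha_*\}\Big).$$ For a path $\mathbf z_t$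 of zeros of $\mathbf q_t$ put $\mathbf p_t=\mathbf q_t\cdot R(\mathbf z_t)$ and $$\mathscr L(s,s')=\int_s^{s'}\big(\|\dot{\mathbf p}_\tau\|_{\mathbf p_\tau}+\nu\|\dot{\mathbf z}_\tau\|_{\mathbf 0}\big)\,\mu(\mathbf p_\tau)\,d\tau,\qquad \|\dot{\mathbf p}\|_{\mathbf p}^2=\sum_i\frac{\|P_{\mathbf p_i^\perp}\dot{\mathbf p}_i\|^2}{\|\mathbf p_i\|^2}.$$ **Theorem.** There are constants $\alpha_*=0.074609958\ldots<\frac{13-3\sqrt{17}}4$, $u_*=0.129283177\ldots$ and $\delta_*=0.085180825\ldots$, the same for all data above, with the following property. Let $(\mathbf q_t)_{t\in[t_0,T]}$ be a $C^1$ path in $\mathscr F$ and let $\mathbf x_0\in\mathbb C^n$ satisfy $$\tfrac12\beta(\mathbf q_{t_0}\cdot R(\mathbf x_0))\,\mu(\mathbf q_{t_0}\cdot R(\mathbf x_0))\,\nu\le\alpha_*.$$ Then there is a path $\mathbf z_t$ in $\mathbb C^n$ for which the following holds. 1. The recurrence is well defined, unless it lands exactly on a degenerate zero. That is, whenever $(t_j,\mathbf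 x_j)$ is defined, one of the following holds. Either the next Newton iterate is defined, $\frac12\beta\mu\nu\le\alpha_*$ at $\mathbf q_{t_j}\cdot R(\mathbf x_j)$, and $t_j<t_{j+1}$ if $t_j<T$; or $\mathbf q_{t_j}\cdot\mathbf V(\mathbf x_j)=\mathbf 0$, $M(\mathbf q_{t_j}\cdot R(\mathbf x_j))$ is singular, and $\mathscr L(t_0,t_j)=\infty$. 2. Let $\mathcal D$ be the union of all the intervals $[t_0,t_j]$ and $[t_j,t_{j+1})$ such that $\mathbf x_{j+1}$ is defined. Then $\mathbf z_t$ is continuous on $\mathcal D$ and $C^1$ at its finite times, and $\mathbf q_t\cdot\mathbf V(\mathbf z_t)=\mathbf 0$ and $\mu(\mathbf p_t)<\infty$ for $t\in\mathcal D$. 3. If $\mathbf x_{j+1}$ is defined, then $u_j(t)=\frac12\|\mathbf z_t-\mathbf x_{j+1}\|_{\mathbf 0}\,\mu(\mathbf q_t\cdot R(\mathbf z_t))\,\nu\le u_*$ for $t_j\le t<t_{j+1}$. 4. If $\mathbf x_{j+1}$ is defined and $t_{j+1}<T$, then $\mathscr L(t_j,t_{j+1})\ge\delta_*$. 5. If $\mathscr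 L(t_0,T)<\infty$ (with any values of $\mathbf z_t$ outside $\mathcal D$), then there is $N\in\mathbb N$ such that $\mathbf x_{N+1}$ is defined, $t_N=T$ and $N\le 1+\frac1{\delta_*}\mathscr L(t_0,T)$. 6. If $t_N=T$ and $\mathbf x_{N+1}=N(\mathbf q_T\cdot R(\mathbf x_N),\mathbf 0)+\mathbf x_N$ is defined, then $\frac12\beta(\mathbf q_T\cdot R(\mathbf x_{N+1}))\,\mu(\mathbf q_T\cdot R(\mathbf x_{N+1}))\,\nu\le\alpha_*$, so $\mathbf x_{N+1}$ is a certified approximate root of $\mathbf q_T$. -/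

import Mathlib

open Set Filter Topology MeasureTheory
open scoped ENNReal

noncomputable section

namespace Toric

/-- Points of `ℂⁿ` with the canonical Hermitian norm (logarithmic coordinates of roots). -/
abbrev Pt (n : ℕ) := EuclideanSpace ℂ (Fin n)

/-- The finite supports `A₁, …, Aₙ ⊆ ℝⁿ`, with `Aᵢ - Aᵢ ⊆ ℤⁿ` and `#Aᵢ ≥ 2`, and the positive
weights `ρ i a`. -/
structure Supports (n : ℕ) where
  A : Fin n → Finset (Fin n → ℝ)
  ρ : Fin n → (Fin n → ℝ) → ℝ
  two_le_card : ∀ i, 2 ≤ (A i).card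
  sub_integral : ∀ i, ∀ a ∈ A i, ∀ b ∈ A i, ∀ k, ∃ m : ℤ, a k - b k = (m : ℝ)
  ρ_pos : ∀ i, ∀ a ∈ A i, 0 < ρ i a

/-- The pairing `a x = a₁ x₁ + ⋯ + aₙ xₙ` of an exponent `a ∈ ℝⁿ` with `x ∈ ℂⁿ`. -/
def pairing {n : ℕ} (a : Fin n → ℝ) (x : Pt n) : ℂ := ∑ k, (a k : ℂ) * x k

namespace Supports

variable {n : ℕ} (S : Supports n)

/-- Coordinates of `𝓕_{Aᵢ}` (and of its dual) in the orthonormal basis `(V_{ia})_{a ∈ Aᵢ}`. -/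
abbrev Coord (i : Fin n) := EuclideanSpace ℂ (S.A i)

/-- The space of systems `𝓕 = 𝓕_{A₁} × ⋯ × 𝓕_{Aₙ}`. -/
abbrev Sys := (i : Fin n) → S.Coord i

/-- The sparse Veronese map `V_{Aᵢ}(x) = (ρ_{ia} e^{a x})_{a ∈ Aᵢ}`. -/
def V (i : Fin n) (x : Pt n) : S.Coord i :=
  WithLp.toLp 2 fun a : S.A i => (S.ρ i a : ℂ) * Complex.exp (pairing a x)

theorem hasFDerivAt_V (i : Fin n) (x : Pt n) :
    HasFDerivAt (S.V i)
      (((EuclideanSpace.equiv (S.A i) ℂ).symm : (S.A i → ℂ) →L[ℂ] S.Coord i) ∘L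
        ContinuousLinearMap.pi fun a : S.A i => ((S.ρ i a : ℂ) * Complex.exp (pairing a x)) •
          ∑ k, (((a : Fin n → ℝ) k : ℂ)) • (EuclideanSpace.proj k : Pt n →L[ℂ] ℂ)) x := by
  refine HasFDerivAt.comp (g := (EuclideanSpace.equiv (S.A i) ℂ).symm) x
    (f := fun (y : Pt n) (a : S.A i) => (S.ρ i a : ℂ) * Complex.exp (pairing a y))
    (ContinuousLinearEquiv.hasFDerivAt _) ?_
  rw [hasFDerivAt_pi]
  intro a
  have h : HasFDerivAt (fun y : Pt n => pairing (a : Fin n → ℝ) y)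
      (∑ k, (((a : Fin n → ℝ) k : ℂ)) • (EuclideanSpace.proj k : Pt n →L[ℂ] ℂ)) x := by
    unfold pairing
    refine HasFDerivAt.fun_sum fun k _ => ?_
    exact (EuclideanSpace.proj k : Pt n →L[ℂ] ℂ).hasFDerivAt.const_mul _
  have h2 := h.cexp.const_mul (S.ρ i a : ℂ)
  rwa [smul_smul] at h2

/-- The derivative `D V_{Aᵢ}(x)`. -/
def DV (i : Fin n) (x : Pt n) : Pt n →L[ℂ] S.Coord i := fderiv ℂ (S.V i) x

theorem DV_apply (i : Fin n) (x u : Pt n) (a : S.A i) :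
    S.DV i x u a = (S.ρ i a : ℂ) * Complex.exp (pairing a x) * pairing a u := by
  rw [DV, (S.hasFDerivAt_V i x).fderiv]
  simp [pairing]

/-- The bilinear coupling `fᵢ · v = ∑ₐ f_{ia} v_a` of `𝓕_{Aᵢ}` with its dual. -/
def coupling (i : Fin n) (f : S.Coord i) : S.Coord i →L[ℂ] ℂ :=
  ∑ a : S.A i, f a • (EuclideanSpace.proj a : S.Coord i →L[ℂ] ℂ)

/-- The evaluation `f · V(x) ∈ ℂⁿ`. -/
def eval (f : S.Sys) (x : Pt n) : Pt n :=
  WithLp.toLp 2 fun i => S.coupling i (f i) (S.V i x)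

/-- The operator of `ℂⁿ` with rows `fᵢ · Bᵢ`. -/
def couple (f : S.Sys) (B : (i : Fin n) → Pt n →L[ℂ] S.Coord i) : Pt n →L[ℂ] Pt n :=
  ((EuclideanSpace.equiv (Fin n) ℂ).symm : (Fin n → ℂ) →L[ℂ] Pt n) ∘L
    ContinuousLinearMap.pi fun i => S.coupling i (f i) ∘L B i

/-- The momentum map `mᵢ(x) = ∑ₐ |V_{ia}(x)|² / ‖V_{Aᵢ}(x)‖² a`. -/
def momentum (i : Fin n) (x : Pt n) : Fin n → ℝ :=
  ∑ a : S.A i, (‖S.V i x a‖ ^ 2 / ‖S.V i x‖ ^ 2) • (a : Fin n → ℝ)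

/-- The projected derivative `P_{V_{Aᵢ}(x)^⊥} D V_{Aᵢ}(x)`. -/
def projDV (i : Fin n) (x : Pt n) : Pt n →L[ℂ] S.Coord i :=
  (Submodule.span ℂ {S.V i x})ᗮ.starProjection ∘L S.DV i x

/-- The derivative `D [V_{Aᵢ}](x) = ‖V_{Aᵢ}(x)‖⁻¹ P_{V_{Aᵢ}(x)^⊥} D V_{Aᵢ}(x)` of the map into
projective space. -/
def dProjV (i : Fin n) (x : Pt n) : Pt n →L[ℂ] S.Coord i :=
  ((‖S.V i x‖ : ℂ)⁻¹) • S.projDV i x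

/-- The norm `‖u‖_{i,x} = ‖D [V_{Aᵢ}](x) u‖`. -/
def normI (i : Fin n) (x u : Pt n) : ℝ := ‖S.dProjV i x u‖

/-- The norm `‖u‖_x`, with `‖u‖_x² = ∑ᵢ ‖u‖_{i,x}²`. -/
def toricNorm (x u : Pt n) : ℝ := √(∑ i, S.normI i x u ^ 2)

/-- The operator `M(f, x)` with rows `fᵢ · D [V_{Aᵢ}](x)`. -/
def condMat (f : S.Sys) (x : Pt n) : Pt n →L[ℂ] Pt n := S.couple f fun i => S.dProjV i x

open Classical in
/-- The toric condition number `μ(f, x) = ‖M(f, x)⁻¹ diag(‖fᵢ‖)‖_x`, the operator norm from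
`ℂⁿ` with its canonical norm to `(ℂⁿ, ‖·‖_x)`; it is `∞` when `M(f, x)` is singular. -/
def mu (f : S.Sys) (x : Pt n) : ℝ≥0∞ :=
  if IsUnit (S.condMat f x) then
    ⨆ (w : Pt n) (_ : ‖w‖ ≤ 1), ENNReal.ofReal
      (S.toricNorm x (Ring.inverse (S.condMat f x)
        (WithLp.toLp 2 fun i => ((‖f i‖ : ℝ) : ℂ) * w i)))
  else ⊤

/-- The distortion invariant
`ν(x) = maxᵢ sup_{a ∈ Aᵢ} sup_{‖u‖_{i,x} ≤ 1} |(a - mᵢ(x)) u|`. -/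
def nu (x : Pt n) : ℝ≥0∞ :=
  ⨆ (i : Fin n) (a : S.A i) (u : Pt n) (_ : S.normI i x u ≤ 1),
    ENNReal.ofReal ‖pairing ((a : Fin n → ℝ) - S.momentum i x) u‖

/-- The local function at a point `x` where all the momenta `mᵢ(x)` vanish:
`S_{f,x}(w) = (fᵢ · V_{Aᵢ}(x + w) / ‖V_{Aᵢ}(x)‖)ᵢ`. -/
def localFun (f : S.Sys) (x w : Pt n) : Pt n :=
  WithLp.toLp 2 fun i => S.coupling i (f i) (((‖S.V i x‖ : ℂ)⁻¹) • S.V i (x + w))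

open Classical in
/-- Smale's invariant `β(f, x) = ‖DS_{f,x}(0)⁻¹ S_{f,x}(0)‖_x` at a point `x` where all the
momenta vanish; it is `∞` when `DS_{f,x}(0)` is singular. -/
def beta (f : S.Sys) (x : Pt n) : ℝ≥0∞ :=
  if IsUnit (fderiv ℂ (S.localFun f x) 0) then
    ENNReal.ofReal
      (S.toricNorm x (Ring.inverse (fderiv ℂ (S.localFun f x) 0) (S.localFun f x 0)))
  else ⊤

/-- The renormalization operator `f ↦ f · R(u)`, `f_{ia} ↦ f_{ia} e^{a u}`. -/
def renorm (f : S.Sys) (u : Pt n) : S.Sys := fun i =>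
  WithLp.toLp 2 fun a : S.A i => f i a * Complex.exp (pairing a u)

/-- The operator inverted by the toric Newton iteration, with rows
`fᵢ · P_{V_{Aᵢ}(x)^⊥} D V_{Aᵢ}(x)`. -/
def newtonMat (f : S.Sys) (x : Pt n) : Pt n →L[ℂ] Pt n := S.couple f fun i => S.projDV i x

/-- The toric Newton operator `N(f, x)`; meaningful only if `newtonMat f x` is invertible. -/
def newton (f : S.Sys) (x : Pt n) : Pt n := x - Ring.inverse (S.newtonMat f x) (S.eval f x)

/-- The renormalized Newton iterate `N(f · R(x), 0) + x` of `x`. -/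
def newtonStep (f : S.Sys) (x : Pt n) : Pt n := S.newton (S.renorm f x) 0 + x

/-- The renormalized Newton iterate of `x` is defined. -/
def NewtonDefined (f : S.Sys) (x : Pt n) : Prop := IsUnit (S.newtonMat (S.renorm f x) 0)

/-- The quantity `½ β(f · R(x)) μ(f · R(x)) ν`, all invariants being taken at the origin.
The point `x` is a certified approximate root of `f` when it is small enough. -/
def certificate (f : S.Sys) (x : Pt n) : ℝ≥0∞ :=
  1 / 2 * S.beta (S.renorm f x) 0 * S.mu (S.renorm f x) 0 * S.nu 0

/-- The renormalized homotopy recurrence `(t_j, x_j)` with threshold `α`: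
`x_{j+1} = N(q_{t_j} · R(x_j), 0) + x_j` and `t_{j+1}` is the minimum of `T` and of the infimum
of the `t > t_j` in the domain of the path with `½ β μ ν ≥ α` at `(q_t, x_{j+1})`
(`sInf ∅ = ∞` in `EReal`). -/
def homotopy (α : ℝ) (q : EReal → S.Sys) (t₀ T : EReal) (x₀ : Pt n) : ℕ → EReal × Pt n
  | 0 => (t₀, x₀)
  | j + 1 =>
    let p := homotopy α q t₀ T x₀ j
    let y := S.newtonStep (q p.1) p.2
    (min T (sInf {t : EReal | p.1 < t ∧ t ≤ T ∧ ENNReal.ofReal α ≤ S.certificate (q t) y}), y)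

/-- The time `t_j`. -/
def time (α : ℝ) (q : EReal → S.Sys) (t₀ T : EReal) (x₀ : Pt n) (j : ℕ) : EReal :=
  (S.homotopy α q t₀ T x₀ j).1

/-- The point `x_j`. -/
def point (α : ℝ) (q : EReal → S.Sys) (t₀ T : EReal) (x₀ : Pt n) (j : ℕ) : Pt n :=
  (S.homotopy α q t₀ T x₀ j).2

/-- All the Newton steps `0, …, j - 1` can be performed, so that `t_0, …, t_j` and
`x_0, …, x_j` are defined. -/
def Reached (α : ℝ) (q : EReal → S.Sys) (t₀ T : EReal) (x₀ : Pt n) (j : ℕ) : Prop :=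
  ∀ k < j, S.NewtonDefined (q (S.time α q t₀ T x₀ k)) (S.point α q t₀ T x₀ k)

/-- The times covered by the recurrence: those in `[t₀, t_j]` for some `j` such that the Newton
step at `(t_j, x_j)` can be performed, and those in `[t_j, t_{j+1})`. -/
def domain (α : ℝ) (q : EReal → S.Sys) (t₀ T : EReal) (x₀ : Pt n) : Set EReal :=
  {t | t₀ ≤ t ∧ ∃ j, S.Reached α q t₀ T x₀ (j + 1) ∧
    (t ≤ S.time α q t₀ T x₀ j ∨ t < S.time α q t₀ T x₀ (j + 1))}

/-- The projective distance `inf_{c ∈ ℂ} ‖f - c g‖ / ‖f‖` in `𝓕_{Aᵢ}`. -/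
def projDist (i : Fin n) (f g : S.Coord i) : ℝ := ⨅ c : ℂ, ‖f - c • g‖ / ‖f‖

/-- A path `(q_t)_{t ∈ [t₀, T]}` of class `C¹` in `𝓕`, `-∞ ≤ t₀ ≤ T ≤ ∞`, no component of which
vanishes (so that it induces a path in the product of the projective spaces). The last clause is a
consequence of the second at finite times; at an infinite end-point it says that the path
converges to its end-point in the product of the projective spaces. -/
structure IsC1Path (q : EReal → S.Sys) (t₀ T : EReal) : Prop where
  ne_zero : ∀ t ∈ Icc t₀ T, ∀ i, q t i ≠ 0
  contDiffOn : ContDiffOn ℝ 1 (fun τ : ℝ => q τ) {τ : ℝ | (τ : EReal) ∈ Icc t₀ T}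
  tendsto : ∀ t ∈ Icc t₀ T, ∀ i,
    Tendsto (fun s => S.projDist i (q t i) (q s i)) (𝓝[Icc t₀ T] t) (𝓝 0)

/-- The multi-projective Fubini-Study norm
`‖p'‖_p = (∑ᵢ ‖P_{pᵢ^⊥} p'ᵢ‖² / ‖pᵢ‖²)^{1/2}`. -/
def fsNorm (p p' : S.Sys) : ℝ :=
  √(∑ i, ‖(Submodule.span ℂ {p i})ᗮ.starProjection (p' i)‖ ^ 2 / ‖p i‖ ^ 2)

/-- The renormalized path `p_τ = q_τ · R(z_τ)`, at finite times. -/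
def renPath (q : EReal → S.Sys) (z : EReal → Pt n) (τ : ℝ) : S.Sys := S.renorm (q τ) (z τ)

/-- The renormalized condition length
`∫_s^{s'} (‖∂p_τ/∂τ‖_{p_τ} + ν ‖∂z_τ/∂τ‖₀) μ(p_τ) dτ`. -/
def condLength (q : EReal → S.Sys) (z : EReal → Pt n) (s s' : EReal) : ℝ≥0∞ :=
  ∫⁻ τ in {τ : ℝ | s < (τ : EReal) ∧ (τ : EReal) < s'},
    (ENNReal.ofReal (S.fsNorm (S.renPath q z τ) (deriv (S.renPath q z) τ))
      + S.nu 0 * ENNReal.ofReal (S.toricNorm 0 (deriv (fun σ : ℝ => z σ) τ)))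
      * S.mu (S.renPath q z τ) 0

/-- The tracking quantity `½ ‖z - x‖₀ μ(f · R(z)) ν`. -/
def tracking (f : S.Sys) (z x : Pt n) : ℝ≥0∞ :=
  1 / 2 * ENNReal.ofReal (S.toricNorm 0 (z - x)) * S.mu (S.renorm f z) 0 * S.nu 0

end Supports

end Toric

end

/-! ### Pairings, renormalization, and the invariants at a point where the momenta vanish. -/

noncomputable section

namespace Toric

variable {n : ℕ}

/-! The proof works with `σ = 1/μ`, the least singular value of `M(f)` after normalizing its rows
(`sigma`, `mu_eq`). Unlike `μ`, it stays bounded and continuous at singular systems with nonzero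
rows; it is at most `1` and does not change when rows are rescaled. For unit rows it is 1-Lipschitz.
Lifting each row horizontally to the unit sphere shows that `σ` drops along a path by at most its
multi-projective length (`sigma_sub_le_integral`), hence by at most `ν‖w‖₀` under renormalization by
`w` (`sig_sub_le`).

Since the momenta vanish, `|a w| ≤ ν‖w‖₀` for every exponent `a`, so the Taylor remainders of the
system are controlled by those of the scalar exponential. This gives a quantitative Newton theory
with explicit constants. If `½βμν ≤ 0.0747`, there is a nearby zero (`exists_zero`), unique in a
suitable ball (`zero_unique`), and one Newton step brings the certificate below `0.0085`
(`newton_certificate`). Conversely, if `½‖x - z‖₀μν ≤ 0.0514` for a zero `z`, with `μ` taken at `z`,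
the certificate at `x` is at most `0.069` (`certificate_of_zero`). These bounds have enough slack to
cover the decimal constants of the theorem, so no sharp constants are needed.

The path `z_t` is the zero attached to `x_{j+1}` while that point is certified. Consecutive choices
agree at the switching times because a certified point and its Newton iterate have the same attached
zero. Stability of zeros makes `z` continuous, and the implicit function theorem makes it `C¹`.

For the step count, `U = ν‖z_t - x_{j+1}‖₀/σ` increases by at most the condition length
(`tracking_sub_le`). It starts below `0.01755`. If a step had length below `0.0852`, then `U ≤
0.1028` throughout, the certificate would be at most `0.069 < α` at its end, and the step would have
continued, unless it ended at `T`. Finally `log σ` decreases by at most the condition length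
(`log_sig_sub_le`), so reaching a degenerate zero costs infinite length. -/

theorem pairing_add (a : Fin n → ℝ) (x y : Pt n) :
    pairing a (x + y) = pairing a x + pairing a y := by
  simp [pairing, mul_add, Finset.sum_add_distrib]

theorem pairing_smul (a : Fin n → ℝ) (c : ℂ) (x : Pt n) :
    pairing a (c • x) = c * pairing a x := by
  simp only [pairing, PiLp.smul_apply, smul_eq_mul, Finset.mul_sum]
  exact Finset.sum_congr rfl fun k _ => by ring

theorem pairing_zero (a : Fin n → ℝ) : pairing a (0 : Pt n) = 0 := by simp [pairing]

theorem pairing_neg (a : Fin n → ℝ) (x : Pt n) : pairing a (-x) = -pairing a x := by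
  simp [pairing]

theorem pairing_sub (a : Fin n → ℝ) (x y : Pt n) :
    pairing a (x - y) = pairing a x - pairing a y := by
  rw [sub_eq_add_neg, pairing_add, pairing_neg, sub_eq_add_neg]

theorem continuous_pairing (a : Fin n → ℝ) : Continuous fun x : Pt n => pairing a x := by
  unfold pairing; fun_prop

theorem contDiff_pairing (a : Fin n → ℝ) {m : WithTop ℕ∞} :
    ContDiff ℂ m fun x : Pt n => pairing a x := by
  unfold pairing
  refine ContDiff.sum fun k _ => contDiff_const.mul ?_
  exact (EuclideanSpace.proj k : Pt n →L[ℂ] ℂ).contDiff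

namespace Supports

variable (S : Supports n)

theorem V_apply (i : Fin n) (x : Pt n) (a : S.A i) :
    S.V i x a = S.ρ i a * Complex.exp (pairing a x) := rfl

theorem V_zero_apply (i : Fin n) (a : S.A i) : S.V i 0 a = S.ρ i a := by
  simp [V, pairing_zero]

theorem V_zero_ne (i : Fin n) : S.V i 0 ≠ 0 := by
  have h := S.two_le_card i
  obtain ⟨a, ha⟩ : (S.A i).Nonempty := Finset.card_pos.mp (by omega)
  intro h0
  have h1 : (0 : ℂ) = S.ρ i a := by
    rw [← S.V_zero_apply i ⟨a, ha⟩, h0]; rfl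
  exact (S.ρ_pos i a ha).ne (by exact_mod_cast h1)

theorem norm_V_zero_pos (i : Fin n) : 0 < ‖S.V i 0‖ := norm_pos_iff.mpr (S.V_zero_ne i)

theorem coupling_apply (i : Fin n) (f v : S.Coord i) :
    S.coupling i f v = ∑ a, f a * v a := by
  simp [coupling]

theorem norm_coupling_le (i : Fin n) (f v : S.Coord i) :
    ‖S.coupling i f v‖ ≤ ‖f‖ * ‖v‖ := by
  rw [coupling_apply]
  refine (norm_sum_le _ _).trans ?_
  simp only [norm_mul]
  rw [EuclideanSpace.norm_eq, EuclideanSpace.norm_eq]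
  exact Real.sum_mul_le_sqrt_mul_sqrt _ _ _

theorem coupling_smul (i : Fin n) (c : ℂ) (f v : S.Coord i) :
    S.coupling i (c • f) v = c * S.coupling i f v := by
  simp only [coupling_apply, PiLp.smul_apply, smul_eq_mul, Finset.mul_sum, mul_assoc]

theorem coupling_sub (i : Fin n) (f g v : S.Coord i) :
    S.coupling i (f - g) v = S.coupling i f v - S.coupling i g v := by
  simp only [coupling_apply, PiLp.sub_apply, sub_mul, Finset.sum_sub_distrib]

theorem renorm_apply (f : S.Sys) (x : Pt n) (i : Fin n) (a : S.A i) :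
    S.renorm f x i a = f i a * Complex.exp (pairing a x) := rfl

theorem renorm_ne_zero {f : S.Sys} (x : Pt n) {i : Fin n} (h : f i ≠ 0) : S.renorm f x i ≠ 0 := by
  contrapose! h
  ext a
  have := congrArg (fun v : S.Coord i => v a) h
  simpa [renorm_apply, Complex.exp_ne_zero] using this

theorem renorm_renorm (f : S.Sys) (x y : Pt n) :
    S.renorm (S.renorm f x) y = S.renorm f (x + y) := by
  funext i
  ext a
  simp only [renorm_apply, pairing_add, Complex.exp_add]
  ring

/-- Rescaling of the components of a system. -/
def scale (c : Fin n → ℂ) (f : S.Sys) : S.Sys := fun i => c i • f i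

theorem renorm_scale (c : Fin n → ℂ) (f : S.Sys) (x : Pt n) :
    S.renorm (S.scale c f) x = S.scale c (S.renorm f x) := by
  funext i
  ext a
  simp [renorm_apply, scale, mul_assoc]

/-- The product of the maps `D [V_{Aᵢ}](0)`. -/
def J : Pt n →L[ℂ] PiLp 2 (fun i => S.Coord i) :=
  ((PiLp.continuousLinearEquiv 2 ℂ (fun i => S.Coord i)).symm :
    ((i : Fin n) → S.Coord i) →L[ℂ] PiLp 2 (fun i => S.Coord i)) ∘L
      ContinuousLinearMap.pi fun i => S.dProjV i 0

theorem J_apply (u : Pt n) (i : Fin n) : S.J u i = S.dProjV i 0 u := rfl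

theorem toricNorm_eq (u : Pt n) : S.toricNorm 0 u = ‖S.J u‖ := by
  rw [PiLp.norm_eq_of_L2]; rfl

theorem normI_le (i : Fin n) (u : Pt n) : S.normI i 0 u ≤ ‖S.J u‖ :=
  PiLp.norm_apply_le (S.J u) i

/-- The function `x ↦ (fᵢ · V_{Aᵢ}(x) / ‖V_{Aᵢ}(0)‖)ᵢ`. -/
def F (f : S.Sys) (x : Pt n) : Pt n := S.localFun f 0 x

theorem F_apply (f : S.Sys) (x : Pt n) (i : Fin n) :
    S.F f x i = ∑ a : S.A i, f i a * ((‖S.V i 0‖ : ℂ)⁻¹ * (S.ρ i a * Complex.exp (pairing a x))) := by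
  simp only [F, localFun, coupling_apply, zero_add, PiLp.smul_apply, smul_eq_mul, V_apply]

theorem localFun_renorm (f : S.Sys) (x w : Pt n) :
    S.localFun (S.renorm f x) 0 w = S.F f (x + w) := by
  change S.F _ _ = _
  ext i
  simp only [F_apply, renorm_apply, pairing_add, Complex.exp_add]
  exact Finset.sum_congr rfl fun a _ => by ring

theorem F_scale (c : Fin n → ℂ) (f : S.Sys) (x : Pt n) (i : Fin n) :
    S.F (S.scale c f) x i = c i * S.F f x i := by
  simp only [F_apply, scale, PiLp.smul_apply, smul_eq_mul, Finset.mul_sum, mul_assoc]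

theorem eval_apply (f : S.Sys) (x : Pt n) (i : Fin n) :
    S.eval f x i = (‖S.V i 0‖ : ℂ) * S.F f x i := by
  have : (‖S.V i 0‖ : ℂ) ≠ 0 := by exact_mod_cast (S.norm_V_zero_pos i).ne'
  simp only [eval, F_apply, coupling_apply, V_apply, Finset.mul_sum]
  exact Finset.sum_congr rfl fun a _ => by field_simp

theorem eval_eq_zero_iff (f : S.Sys) (x : Pt n) : S.eval f x = 0 ↔ S.F f x = 0 := by
  have : ∀ i, (‖S.V i 0‖ : ℂ) ≠ 0 := fun i => by exact_mod_cast (S.norm_V_zero_pos i).ne'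
  constructor <;> intro h <;> ext i
  · have := S.eval_apply f x i
    rw [h] at this
    simpa [S.V_zero_ne i] using this.symm
  · rw [eval_apply, h]; simp

theorem eval_renorm (f : S.Sys) (x : Pt n) (i : Fin n) :
    S.eval (S.renorm f x) 0 i = (‖S.V i 0‖ : ℂ) * S.F f x i := by
  rw [eval_apply]
  have := S.localFun_renorm f x 0
  rw [add_zero] at this
  rw [← this]; rfl

theorem condMat_apply (f : S.Sys) (u : Pt n) (i : Fin n) :
    S.condMat f 0 u i = S.coupling i (f i) (S.dProjV i 0 u) := rfl

theorem condMat_scale (c : Fin n → ℂ) (f : S.Sys) (u : Pt n) (i : Fin n) :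
    S.condMat (S.scale c f) 0 u i = c i * S.condMat f 0 u i := by
  simp only [condMat_apply, scale, coupling_smul]

theorem newtonMat_apply (f : S.Sys) (u : Pt n) (i : Fin n) :
    S.newtonMat f 0 u i = (‖S.V i 0‖ : ℂ) * S.condMat f 0 u i := by
  have : (‖S.V i 0‖ : ℂ) ≠ 0 := by exact_mod_cast (S.norm_V_zero_pos i).ne'
  change S.coupling i (f i) (S.projDV i 0 u) = _ * S.coupling i (f i) (S.dProjV i 0 u)
  simp [dProjV, S.V_zero_ne i]

/-- A configuration of supports with vanishing momenta at the origin, for which `‖·‖₀` is a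
norm on a nontrivial space. -/
structure Centered : Prop where
  momentum_zero : ∀ i, S.momentum i 0 = 0
  injective : Function.Injective S.J
  pos : 0 < n

variable {S}

/-- The inner product of `V(0)` with `DV(0) u` is `∑ ρ² (a u)`, a multiple of the momentum paired
with `u`. Hence `DV(0) u` is already orthogonal to `V(0)`. -/
theorem projDV_zero_apply (hm : ∀ i, S.momentum i 0 = 0) (i : Fin n) (u : Pt n) :
    S.projDV i 0 u = S.DV i 0 u := by
  change (Submodule.span ℂ {S.V i 0})ᗮ.starProjection (S.DV i 0 u) = _
  rw [Submodule.starProjection_eq_self_iff, Submodule.mem_orthogonal_singleton_iff_inner_right]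
  have hV : (‖S.V i 0‖ ^ 2 : ℝ) ≠ 0 := pow_ne_zero _ (S.norm_V_zero_pos i).ne'
  have h : ∀ k, ∑ a : S.A i, (S.ρ i a) ^ 2 * (a : Fin n → ℝ) k = 0 := by
    intro k
    have := congrFun (hm i) k
    simp only [momentum, Finset.sum_apply, Pi.smul_apply, smul_eq_mul, V_zero_apply,
      Complex.norm_real, Real.norm_eq_abs, sq_abs, Pi.zero_apply] at this
    simp only [div_mul_eq_mul_div] at this
    rw [← Finset.sum_div, div_eq_zero_iff] at this
    exact this.resolve_right hV
  rw [PiLp.inner_apply]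
  simp only [RCLike.inner_apply, V_zero_apply, DV_apply, pairing_zero, Complex.exp_zero, mul_one,
    Complex.conj_ofReal]
  simp only [pairing, Finset.mul_sum, Finset.sum_mul]
  rw [Finset.sum_comm]
  refine Finset.sum_eq_zero fun k _ => ?_
  have h2 : (((∑ a : S.A i, (S.ρ i a) ^ 2 * (a : Fin n → ℝ) k : ℝ)) : ℂ) * u k = 0 := by
    rw [h k]; simp
  rw [← h2]
  push_cast
  rw [Finset.sum_mul]
  exact Finset.sum_congr rfl fun a _ => by ring

theorem dProjV_zero_apply (hm : ∀ i, S.momentum i 0 = 0) (i : Fin n) (u : Pt n) (a : S.A i) :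
    S.dProjV i 0 u a = (‖S.V i 0‖ : ℂ)⁻¹ * (S.ρ i a * pairing a u) := by
  change ((‖S.V i 0‖ : ℂ)⁻¹ • S.projDV i 0 u) a = _
  rw [projDV_zero_apply hm]
  simp [DV_apply, pairing_zero]

theorem condMat_apply_sum (hm : ∀ i, S.momentum i 0 = 0) (f : S.Sys) (u : Pt n) (i : Fin n) :
    S.condMat f 0 u i = ∑ a : S.A i, f i a * ((‖S.V i 0‖ : ℂ)⁻¹ * (S.ρ i a * pairing a u)) := by
  simp only [condMat_apply, coupling_apply, dProjV_zero_apply hm]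

/-- Cauchy-Schwarz estimate for a row whose coefficients are dominated by those of
`D [V_{Aᵢ}](0) v`. -/
theorem norm_row_le (hm : ∀ i, S.momentum i 0 = 0) (p : S.Sys) (i : Fin n) (φ : S.A i → ℂ)
    {k : ℝ} (hk : 0 ≤ k) (v : Pt n) (h : ∀ a, ‖φ a‖ ≤ k * ‖pairing a v‖) :
    ‖∑ a, p i a * ((‖S.V i 0‖ : ℂ)⁻¹ * (S.ρ i a * φ a))‖ ≤ ‖p i‖ * (k * ‖S.J v i‖) := by
  let w : S.Coord i := WithLp.toLp 2 fun a => (‖S.V i 0‖ : ℂ)⁻¹ * (S.ρ i a * φ a)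
  have h1 := S.norm_coupling_le i (p i) w
  rw [coupling_apply] at h1
  refine h1.trans (mul_le_mul_of_nonneg_left ?_ (norm_nonneg _))
  rw [← Real.norm_of_nonneg hk, ← Complex.norm_real, ← norm_smul, EuclideanSpace.norm_eq,
    EuclideanSpace.norm_eq]
  refine Real.sqrt_le_sqrt (Finset.sum_le_sum fun a _ => ?_)
  refine pow_le_pow_left₀ (norm_nonneg _) ?_ 2
  rw [PiLp.smul_apply, J_apply, dProjV_zero_apply hm]
  simp only [w, norm_mul, smul_eq_mul, Complex.norm_real, Real.norm_of_nonneg hk]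
  have := mul_le_mul_of_nonneg_left (h a) (norm_nonneg (S.ρ i a))
  have := mul_le_mul_of_nonneg_left this (norm_nonneg ((‖S.V i 0‖ : ℂ)⁻¹))
  linarith

/-- A single coordinate of `D[V](0) u` is bounded by its norm. This crude constant serves only to
show that `ν` is finite and to handle vectors of zero seminorm. -/
theorem norm_pairing_le_of_mem (hm : ∀ i, S.momentum i 0 = 0) (i : Fin n) (a : S.A i) (u : Pt n) :
    ‖pairing a u‖ ≤ ‖S.V i 0‖ / S.ρ i a * S.normI i 0 u := by
  have hρ := S.ρ_pos i a a.2
  have hV := S.norm_V_zero_pos i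
  have h1 : ‖S.dProjV i 0 u a‖ ≤ S.normI i 0 u := PiLp.norm_apply_le (S.dProjV i 0 u) a
  rw [dProjV_zero_apply hm, norm_mul, norm_mul, norm_inv, Complex.norm_real, Complex.norm_real,
    Real.norm_of_nonneg hρ.le, norm_norm] at h1
  rw [div_mul_eq_mul_div, le_div_iff₀ hρ]
  rw [inv_mul_le_iff₀ hV] at h1
  linarith

variable (S) in
/-- The distortion invariant at the origin, as a real number. -/
def nuR : ℝ := (S.nu 0).toReal

theorem nu_ne_top (hm : ∀ i, S.momentum i 0 = 0) : S.nu 0 ≠ ⊤ := by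
  have : S.nu 0 ≤ ENNReal.ofReal (∑ i, ∑ a : S.A i, ‖S.V i 0‖ / S.ρ i a) := by
    refine iSup_le fun i => iSup_le fun a => iSup_le fun u => iSup_le fun hu =>
      ENNReal.ofReal_le_ofReal ?_
    rw [hm i, sub_zero]
    have h0 : ∀ j, ∀ b : S.A j, 0 ≤ ‖S.V j 0‖ / S.ρ j b := fun j b =>
      div_nonneg (norm_nonneg _) (S.ρ_pos j b b.2).le
    calc ‖pairing a u‖ ≤ ‖S.V i 0‖ / S.ρ i a * S.normI i 0 u := norm_pairing_le_of_mem hm i a u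
      _ ≤ ‖S.V i 0‖ / S.ρ i a := mul_le_of_le_one_right (h0 i a) hu
      _ ≤ ∑ a : S.A i, ‖S.V i 0‖ / S.ρ i a :=
          Finset.single_le_sum (f := fun a : S.A i => ‖S.V i 0‖ / S.ρ i a)
            (fun b _ => h0 i b) (Finset.mem_univ a)
      _ ≤ _ := Finset.single_le_sum (f := fun i => ∑ a : S.A i, ‖S.V i 0‖ / S.ρ i a)
            (fun j _ => Finset.sum_nonneg fun b _ => h0 j b) (Finset.mem_univ i)
  exact ne_top_of_le_ne_top ENNReal.ofReal_ne_top this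

theorem nu_eq (hm : ∀ i, S.momentum i 0 = 0) : S.nu 0 = ENNReal.ofReal S.nuR :=
  (ENNReal.ofReal_toReal (nu_ne_top hm)).symm

theorem nuR_nonneg : 0 ≤ S.nuR := ENNReal.toReal_nonneg

theorem norm_pairing_le (hm : ∀ i, S.momentum i 0 = 0) (i : Fin n) (a : S.A i) (u : Pt n) :
    ‖pairing a u‖ ≤ S.nuR * S.normI i 0 u := by
  have h0 : 0 ≤ S.normI i 0 u := norm_nonneg _
  have key : ∀ w : Pt n, S.normI i 0 w ≤ 1 → ‖pairing a w‖ ≤ S.nuR := by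
    intro w hw
    have h2 : ENNReal.ofReal ‖pairing ((a : Fin n → ℝ) - S.momentum i 0) w‖ ≤ S.nu 0 :=
      le_iSup_of_le i (le_iSup_of_le a (le_iSup₂_of_le w hw le_rfl))
    rw [hm i, sub_zero, nu_eq hm] at h2
    exact (ENNReal.ofReal_le_ofReal_iff nuR_nonneg).mp h2
  -- A vector with `‖u‖_i = 0` cannot be normalized, so the coordinate bound treats it separately.
  rcases h0.eq_or_lt with h | h
  · have := norm_pairing_le_of_mem hm i a u
    rw [← h] at this ⊢
    simpa using this
  · have h3 := key (((S.normI i 0 u : ℝ) : ℂ)⁻¹ • u) (by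
      rw [normI, map_smul, norm_smul, norm_inv, Complex.norm_real, Real.norm_of_nonneg h0]
      exact inv_mul_le_one)
    rw [pairing_smul, norm_mul, norm_inv, Complex.norm_real, Real.norm_of_nonneg h0,
      inv_mul_le_iff₀ h] at h3
    linarith

theorem norm_pairing_le_J (hm : ∀ i, S.momentum i 0 = 0) (i : Fin n) (a : S.A i) (u : Pt n) :
    ‖pairing a u‖ ≤ S.nuR * ‖S.J u‖ :=
  (norm_pairing_le hm i a u).trans (mul_le_mul_of_nonneg_left (S.normI_le i u) nuR_nonneg)

theorem exists_norm_J_eq_one (hS : S.Centered) : ∃ v : Pt n, ‖S.J v‖ = 1 := by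
  let v : Pt n := EuclideanSpace.single ⟨0, hS.pos⟩ 1
  have hv : v ≠ 0 := by simp [v]
  have hJ : S.J v ≠ 0 := fun h => hv (hS.injective (by rw [h, map_zero]))
  refine ⟨((‖S.J v‖ : ℝ) : ℂ)⁻¹ • v, ?_⟩
  rw [map_smul, norm_smul, norm_inv, Complex.norm_real, norm_norm,
    inv_mul_cancel₀ (norm_ne_zero_iff.mpr hJ)]

theorem nuR_pos (hS : S.Centered) : 0 < S.nuR := by
  obtain ⟨v, hv⟩ := exists_norm_J_eq_one hS
  rcases (nuR_nonneg (S := S)).eq_or_lt with h | h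
  · have : S.J v = 0 := by
      ext i a
      rw [J_apply, dProjV_zero_apply hS.momentum_zero]
      have := norm_pairing_le_J hS.momentum_zero i a v
      rw [← h, zero_mul] at this
      rw [norm_le_zero_iff.mp this]; simp
    rw [this, norm_zero] at hv
    exact absurd hv zero_ne_one
  · exact h

/-- With zero momenta no projection is needed, so `β` and `μ` invert the same operator. -/
theorem fderiv_localFun (hm : ∀ i, S.momentum i 0 = 0) (f : S.Sys) :
    fderiv ℂ (S.localFun f 0) 0 = S.condMat f 0 := by
  have h : HasFDerivAt (S.localFun f 0)
      (((EuclideanSpace.equiv (Fin n) ℂ).symm : (Fin n → ℂ) →L[ℂ] Pt n) ∘L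
        ContinuousLinearMap.pi fun i => S.coupling i (f i) ∘L
          ((‖S.V i 0‖ : ℂ)⁻¹ • S.DV i 0)) 0 := by
    refine HasFDerivAt.comp (g := (EuclideanSpace.equiv (Fin n) ℂ).symm) (0 : Pt n)
      (f := fun (w : Pt n) (i : Fin n) =>
        S.coupling i (f i) (((‖S.V i 0‖ : ℂ)⁻¹) • S.V i (0 + w)))
      (ContinuousLinearEquiv.hasFDerivAt _) ?_
    rw [hasFDerivAt_pi]
    intro i
    refine HasFDerivAt.comp (g := S.coupling i (f i)) (0 : Pt n)
      (ContinuousLinearMap.hasFDerivAt _) ?_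
    have h1 : HasFDerivAt (S.V i) (S.DV i 0) 0 :=
      (S.hasFDerivAt_V i 0).differentiableAt.hasFDerivAt
    simp only [zero_add]
    exact h1.const_smul ((‖S.V i 0‖ : ℂ)⁻¹)
  rw [h.fderiv]
  ext u i
  change S.coupling i (f i) ((‖S.V i 0‖ : ℂ)⁻¹ • S.DV i 0 u) =
    S.coupling i (f i) ((‖S.V i 0‖ : ℂ)⁻¹ • S.projDV i 0 u)
  rw [projDV_zero_apply hm]

end Supports

end Toric

end

/-! ### Condition number, Newton step and certificate in terms of `σ`. -/

noncomputable section

namespace Toric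

variable {n : ℕ}

theorem isUnit_iff_injective (A : Pt n →L[ℂ] Pt n) : IsUnit A ↔ ∀ v, A v = 0 → v = 0 := by
  rw [ContinuousLinearMap.isUnit_iff_bijective]
  constructor
  · intro h v hv
    exact h.1 (by rw [hv, map_zero])
  · intro h
    have hi : Function.Injective (A : Pt n →ₗ[ℂ] Pt n) :=
      (injective_iff_map_eq_zero (A : Pt n →ₗ[ℂ] Pt n)).mpr h
    exact ⟨hi, LinearMap.injective_iff_surjective.mp hi⟩

theorem inverse_apply_eq {A : Pt n →L[ℂ] Pt n} (hA : IsUnit A) {v w : Pt n} (h : A v = w) :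
    Ring.inverse A w = v := by
  rw [← h]
  exact congrArg (fun B : Pt n →L[ℂ] Pt n => B v) (Ring.inverse_mul_cancel _ hA)

theorem apply_inverse {A : Pt n →L[ℂ] Pt n} (hA : IsUnit A) (w : Pt n) :
    A (Ring.inverse A w) = w :=
  congrArg (fun B : Pt n →L[ℂ] Pt n => B w) (Ring.mul_inverse_cancel _ hA)

namespace Supports

variable (S : Supports n)

/-- The vector `(cᵢ / ‖pᵢ‖)ᵢ`. -/
def wvec (p : S.Sys) (c : Pt n) : Pt n := WithLp.toLp 2 fun i => (‖p i‖ : ℂ)⁻¹ * c i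

/-- The norm of the vector `(cᵢ / ‖pᵢ‖)ᵢ`. -/
def wnorm (p : S.Sys) (c : Pt n) : ℝ := ‖S.wvec p c‖

variable {S}

theorem wvec_add (p : S.Sys) (c d : Pt n) : S.wvec p (c + d) = S.wvec p c + S.wvec p d := by
  ext i; simp [wvec, mul_add]

theorem wvec_smul (p : S.Sys) (a : ℂ) (c : Pt n) : S.wvec p (a • c) = a • S.wvec p c := by
  ext i; simp only [wvec, PiLp.smul_apply, smul_eq_mul]; ring

theorem wnorm_add_le (p : S.Sys) (c d : Pt n) : S.wnorm p (c + d) ≤ S.wnorm p c + S.wnorm p d := by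
  rw [wnorm, wvec_add]; exact norm_add_le _ _

theorem wnorm_smul (p : S.Sys) (a : ℂ) (c : Pt n) : S.wnorm p (a • c) = ‖a‖ * S.wnorm p c := by
  rw [wnorm, wvec_smul, norm_smul, wnorm]

theorem wnorm_neg (p : S.Sys) (c : Pt n) : S.wnorm p (-c) = S.wnorm p c := by
  rw [← neg_one_smul ℂ, wnorm_smul]; simp

theorem wnorm_nonneg (p : S.Sys) (c : Pt n) : 0 ≤ S.wnorm p c := norm_nonneg _

theorem wnorm_zero (p : S.Sys) : S.wnorm p 0 = 0 := by
  rw [← zero_smul ℂ (0 : Pt n), wnorm_smul]; simp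

theorem wnorm_eq_zero_iff {p : S.Sys} (hp : ∀ i, p i ≠ 0) {c : Pt n} :
    S.wnorm p c = 0 ↔ c = 0 := by
  constructor
  · intro h
    ext i
    have := congrArg (fun v : Pt n => v i) (norm_eq_zero.mp h)
    simpa [wvec, hp i] using this
  · rintro rfl; exact wnorm_zero p

theorem wnorm_le_of_row {p : S.Sys} {c v : Pt n} {k : ℝ} (hk : 0 ≤ k)
    (h : ∀ i, ‖c i‖ ≤ ‖p i‖ * (k * ‖S.J v i‖)) : S.wnorm p c ≤ k * ‖S.J v‖ := by
  rw [← Real.norm_of_nonneg hk, ← Complex.norm_real, ← norm_smul, PiLp.norm_eq_of_L2, wnorm,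
    EuclideanSpace.norm_eq]
  refine Real.sqrt_le_sqrt (Finset.sum_le_sum fun i _ => pow_le_pow_left₀ (norm_nonneg _) ?_ 2)
  rw [PiLp.smul_apply, norm_smul, Complex.norm_real, Real.norm_of_nonneg hk]
  simp only [wvec, norm_mul, norm_inv, Complex.norm_real, norm_norm]
  rcases (norm_nonneg (p i)).eq_or_lt with h0 | h0
  · rw [← h0]; simp; positivity
  · rw [inv_mul_le_iff₀ h0]; exact h i

theorem wnorm_scale {γ : Fin n → ℂ} (hγ : ∀ i, γ i ≠ 0) (p : S.Sys) {c c' : Pt n}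
    (h : ∀ i, c' i = γ i * c i) : S.wnorm (S.scale γ p) c' = S.wnorm p c := by
  rw [wnorm, wnorm, EuclideanSpace.norm_eq, EuclideanSpace.norm_eq]
  congr 1
  refine Finset.sum_congr rfl fun i _ => ?_
  have : ‖γ i‖ ≠ 0 := norm_ne_zero_iff.mpr (hγ i)
  simp only [wvec, scale, h, norm_mul, norm_inv, Complex.norm_real, norm_norm, norm_smul]
  congr 1
  field_simp

variable (S) in
/-- The least value of `‖diag(‖fᵢ‖)⁻¹ M(f) v‖` for `‖v‖₀ = 1`; it is the inverse of `μ`. -/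
def sigma (f : S.Sys) : ℝ :=
  ⨅ v : {v : Pt n // ‖S.J v‖ = 1}, S.wnorm f (S.condMat f 0 v)

theorem sigma_nonneg (f : S.Sys) : 0 ≤ S.sigma f := Real.iInf_nonneg fun _ => wnorm_nonneg _ _

theorem sigma_mul_le (f : S.Sys) (v : Pt n) :
    S.sigma f * ‖S.J v‖ ≤ S.wnorm f (S.condMat f 0 v) := by
  rcases (norm_nonneg (S.J v)).eq_or_lt with h | h
  · rw [← h, mul_zero]; exact wnorm_nonneg _ _
  · have h1 : ‖S.J (((‖S.J v‖ : ℝ) : ℂ)⁻¹ • v)‖ = 1 := by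
      rw [map_smul, norm_smul, norm_inv, Complex.norm_real, norm_norm, inv_mul_cancel₀ h.ne']
    have h2 : S.sigma f ≤ S.wnorm f (S.condMat f 0 (((‖S.J v‖ : ℝ) : ℂ)⁻¹ • v)) :=
      ciInf_le (f := fun v : {v : Pt n // ‖S.J v‖ = 1} => S.wnorm f (S.condMat f 0 v))
        ⟨0, by rintro _ ⟨w, rfl⟩; exact wnorm_nonneg _ _⟩ ⟨_, h1⟩
    rw [map_smul, wnorm_smul, norm_inv, Complex.norm_real, norm_norm] at h2
    rwa [← le_div_iff₀ h, div_eq_inv_mul]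

/-- `Centered` supplies a unit vector; a real infimum over an empty index type would be `0`. -/
theorem le_sigma (hS : S.Centered) {f : S.Sys} {s : ℝ}
    (h : ∀ v, s * ‖S.J v‖ ≤ S.wnorm f (S.condMat f 0 v)) : s ≤ S.sigma f := by
  obtain ⟨v, hv⟩ := exists_norm_J_eq_one hS
  have : Nonempty {v : Pt n // ‖S.J v‖ = 1} := ⟨⟨v, hv⟩⟩
  refine le_ciInf fun w => ?_
  have := h w
  rwa [w.2, mul_one] at this

theorem wnorm_condMat_le (f : S.Sys) (v : Pt n) : S.wnorm f (S.condMat f 0 v) ≤ ‖S.J v‖ := by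
  have := wnorm_le_of_row (p := f) (c := S.condMat f 0 v) (v := v) zero_le_one fun i => by
    rw [one_mul]; exact S.norm_coupling_le i (f i) _
  rwa [one_mul] at this

/-- Equivalently `μ ≥ 1`. This keeps balls of radius `kσ/ν` inside the region where the exponential
estimates, valid for arguments of modulus at most `1`, apply. -/
theorem sigma_le_one (hS : S.Centered) (f : S.Sys) : S.sigma f ≤ 1 := by
  obtain ⟨v, hv⟩ := exists_norm_J_eq_one hS
  have := (sigma_mul_le f v).trans (wnorm_condMat_le f v)
  rwa [hv, mul_one] at this

/-- Row `i` and the weight `‖f_i‖` are multiplied by the same modulus. So `σ` lives on the product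
of projective spaces and representatives may be chosen freely. -/
theorem sigma_scale {γ : Fin n → ℂ} (hγ : ∀ i, γ i ≠ 0) (f : S.Sys) :
    S.sigma (S.scale γ f) = S.sigma f := by
  unfold sigma
  congr 1
  funext v
  exact wnorm_scale hγ f fun i => S.condMat_scale γ f v i

/-- `‖J v‖` dominates the canonical norm. -/
theorem exists_norm_le_J (hS : S.Centered) : ∃ C : ℝ, 0 < C ∧ ∀ v : Pt n, ‖v‖ ≤ C * ‖S.J v‖ := by
  obtain ⟨K, hK, h⟩ := (S.J : Pt n →ₗ[ℂ] PiLp 2 fun i => S.Coord i).exists_antilipschitzWith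
    (LinearMap.ker_eq_bot.mpr hS.injective)
  exact ⟨K, by exact_mod_cast hK, fun v => h.le_mul_norm (map_zero _) v⟩

theorem sigma_pos_iff (hS : S.Centered) {f : S.Sys} (hf : ∀ i, f i ≠ 0) :
    0 < S.sigma f ↔ IsUnit (S.condMat f 0) := by
  constructor
  · intro h
    rw [isUnit_iff_injective]
    intro v hv
    have h1 := sigma_mul_le f v
    rw [hv, wnorm_zero] at h1
    have h2 : ‖S.J v‖ ≤ 0 := nonpos_of_mul_nonpos_right h1 h
    exact hS.injective (by rw [norm_le_zero_iff.mp h2, map_zero])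
  · intro h
    have hd : ∀ i, (‖f i‖ : ℝ) ≠ 0 := fun i => norm_ne_zero_iff.mpr (hf i)
    let D : Pt n →L[ℂ] Pt n := LinearMap.toContinuousLinearMap
      { toFun := fun w => WithLp.toLp 2 fun i => (‖f i‖ : ℂ) * w i
        map_add' := fun x y => by ext i; simp [mul_add]
        map_smul' := fun c x => by ext i; simp; ring }
    have hD : ∀ c : Pt n, D (S.wvec f c) = c := by
      intro c
      ext i
      change (‖f i‖ : ℂ) * ((‖f i‖ : ℂ)⁻¹ * c i) = c i
      rw [mul_inv_cancel_left₀ (by exact_mod_cast hd i)]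
    let A := S.J ∘L (Ring.inverse (S.condMat f 0) ∘L D)
    have hA : ∀ v, S.J v = A (S.wvec f (S.condMat f 0 v)) := by
      intro v
      change _ = S.J (Ring.inverse (S.condMat f 0) (D (S.wvec f (S.condMat f 0 v))))
      rw [hD, inverse_apply_eq h rfl]
    have hpos : 0 < ‖A‖ + 1 := by positivity
    refine lt_of_lt_of_le (inv_pos.mpr hpos) (le_sigma hS fun v => ?_)
    rw [inv_mul_le_iff₀ hpos, hA v]
    refine (A.le_opNorm _).trans ?_
    exact mul_le_mul_of_nonneg_right (by linarith) (norm_nonneg _)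

/-- The norm of an inverse is the reciprocal of the least singular value. A finite supremum `m`
gives `‖v‖₀ ≤ m · wnorm (M v)`, hence `1/m ≤ σ`; for singular `M`, `σ = 0` and both sides are `∞`.
-/
theorem mu_eq (hS : S.Centered) {f : S.Sys} (hf : ∀ i, f i ≠ 0) :
    S.mu f 0 = (ENNReal.ofReal (S.sigma f))⁻¹ := by
  have hd : ∀ i, (‖f i‖ : ℂ) ≠ 0 := fun i => by exact_mod_cast norm_ne_zero_iff.mpr (hf i)
  unfold mu
  split_ifs with h
  · have hpos := (sigma_pos_iff hS hf).mpr h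
    rw [← ENNReal.ofReal_inv_of_pos hpos]
    apply le_antisymm
    · refine iSup₂_le fun w hw => ENNReal.ofReal_le_ofReal ?_
      rw [toricNorm_eq]
      have h1 := sigma_mul_le f (Ring.inverse (S.condMat f 0)
        (WithLp.toLp 2 fun i => ((‖f i‖ : ℝ) : ℂ) * w i))
      rw [apply_inverse h] at h1
      have h2 : S.wvec f (WithLp.toLp 2 fun i => ((‖f i‖ : ℝ) : ℂ) * w i) = w := by
        ext i
        change (‖f i‖ : ℂ)⁻¹ * ((‖f i‖ : ℂ) * w i) = w i
        rw [inv_mul_cancel_left₀ (hd i)]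
      rw [wnorm, h2] at h1
      rw [← one_div, le_div_iff₀ hpos, mul_comm]
      exact h1.trans hw
    · set m := ⨆ (w : Pt n) (_ : ‖w‖ ≤ 1), ENNReal.ofReal
        (S.toricNorm 0 (Ring.inverse (S.condMat f 0)
          (WithLp.toLp 2 fun i => ((‖f i‖ : ℝ) : ℂ) * w i))) with hm
      by_cases htop : m = ⊤
      · rw [htop]; exact le_top
      rw [← ENNReal.ofReal_toReal htop]
      refine ENNReal.ofReal_le_ofReal ?_
      have key : ∀ v, ‖S.J v‖ ≤ m.toReal * S.wnorm f (S.condMat f 0 v) := by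
        intro v
        set c := S.condMat f 0 v with hc
        rcases (wnorm_nonneg f c).eq_or_lt with h0 | h0
        · have : S.condMat f 0 v = 0 := (wnorm_eq_zero_iff hf).mp h0.symm
          rw [(isUnit_iff_injective _).mp h v this]; simp
          exact mul_nonneg ENNReal.toReal_nonneg (wnorm_nonneg _ _)
        · let w : Pt n := ((S.wnorm f c : ℝ) : ℂ)⁻¹ • S.wvec f c
          have hw : ‖w‖ ≤ 1 := by
            rw [norm_smul, norm_inv, Complex.norm_real, Real.norm_of_nonneg h0.le]
            exact inv_mul_le_one
          have h3 : ENNReal.ofReal (S.toricNorm 0 (Ring.inverse (S.condMat f 0)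
              (WithLp.toLp 2 fun i => ((‖f i‖ : ℝ) : ℂ) * w i))) ≤ m := le_iSup₂_of_le w hw le_rfl
          have h4 : Ring.inverse (S.condMat f 0)
              (WithLp.toLp 2 fun i => ((‖f i‖ : ℝ) : ℂ) * w i) =
                ((S.wnorm f c : ℝ) : ℂ)⁻¹ • v := by
            refine inverse_apply_eq h ?_
            rw [map_smul]
            ext i
            change ((S.wnorm f c : ℝ) : ℂ)⁻¹ * c i =
              (‖f i‖ : ℂ) * (((S.wnorm f c : ℝ) : ℂ)⁻¹ * ((‖f i‖ : ℂ)⁻¹ * c i))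
            have := hd i
            field_simp
          rw [h4, toricNorm_eq, map_smul, norm_smul, norm_inv, Complex.norm_real,
            Real.norm_of_nonneg h0.le, ← ENNReal.ofReal_toReal htop,
            ENNReal.ofReal_le_ofReal_iff ENNReal.toReal_nonneg, inv_mul_le_iff₀ h0] at h3
          linarith
      have hmpos : 0 < m.toReal := by
        obtain ⟨v, hv⟩ := exists_norm_J_eq_one hS
        have h1 := key v
        rw [hv] at h1
        by_contra hcon
        have : m.toReal = 0 := le_antisymm (not_lt.mp hcon) ENNReal.toReal_nonneg
        rw [this, zero_mul] at h1
        linarith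
      have : m.toReal⁻¹ ≤ S.sigma f := le_sigma hS fun v => by
        rw [inv_mul_le_iff₀ hmpos]; exact key v
      exact inv_le_of_inv_le₀ hmpos this
  · have : S.sigma f = 0 := by
      have h1 := mt (sigma_pos_iff hS hf).mp h
      exact le_antisymm (not_lt.mp h1) (sigma_nonneg f)
    simp [this]

variable (S) in
/-- The Newton increment: the solution `d` of `M(f · R(x)) d = F(x)`. -/
def step (f : S.Sys) (x : Pt n) : Pt n :=
  Ring.inverse (S.condMat (S.renorm f x) 0) (S.F f x)

variable (S) in
/-- The inverse of the condition number at the system renormalized at `x`. -/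
def sig (f : S.Sys) (x : Pt n) : ℝ := S.sigma (S.renorm f x)

theorem sig_nonneg (f : S.Sys) (x : Pt n) : 0 ≤ S.sig f x := sigma_nonneg _

theorem sig_pos_iff (hS : S.Centered) {f : S.Sys} (hf : ∀ i, f i ≠ 0) (x : Pt n) :
    0 < S.sig f x ↔ IsUnit (S.condMat (S.renorm f x) 0) :=
  sigma_pos_iff hS fun i => S.renorm_ne_zero x (hf i)

theorem mu_renorm_eq (hS : S.Centered) {f : S.Sys} (hf : ∀ i, f i ≠ 0) (x : Pt n) :
    S.mu (S.renorm f x) 0 = (ENNReal.ofReal (S.sig f x))⁻¹ :=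
  mu_eq hS fun i => S.renorm_ne_zero x (hf i)

theorem sig_scale {γ : Fin n → ℂ} (hγ : ∀ i, γ i ≠ 0) (f : S.Sys) (x : Pt n) :
    S.sig (S.scale γ f) x = S.sig f x := by
  rw [sig, renorm_scale, sigma_scale hγ, sig]

theorem condMat_step (hS : S.Centered) {f : S.Sys} (hf : ∀ i, f i ≠ 0) {x : Pt n}
    (h : 0 < S.sig f x) : S.condMat (S.renorm f x) 0 (S.step f x) = S.F f x :=
  apply_inverse ((sig_pos_iff hS hf x).mp h) _

theorem beta_renorm_eq (hS : S.Centered) {f : S.Sys} (hf : ∀ i, f i ≠ 0) {x : Pt n}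
    (h : 0 < S.sig f x) : S.beta (S.renorm f x) 0 = ENNReal.ofReal ‖S.J (S.step f x)‖ := by
  rw [beta, fderiv_localFun hS.momentum_zero, if_pos ((sig_pos_iff hS hf x).mp h), toricNorm_eq,
    localFun_renorm, add_zero, step]

theorem certificate_eq (hS : S.Centered) {f : S.Sys} (hf : ∀ i, f i ≠ 0) {x : Pt n}
    (h : 0 < S.sig f x) :
    S.certificate f x = ENNReal.ofReal (S.nuR * ‖S.J (S.step f x)‖ / (2 * S.sig f x)) := by
  rw [certificate, beta_renorm_eq hS hf h, mu_renorm_eq hS hf, nu_eq hS.momentum_zero,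
    ← ENNReal.ofReal_inv_of_pos h]
  have : (1 / 2 : ℝ≥0∞) = ENNReal.ofReal (1 / 2) := by
    rw [ENNReal.ofReal_div_of_pos (by norm_num)]; simp
  rw [this, ← ENNReal.ofReal_mul (by norm_num), ← ENNReal.ofReal_mul (by positivity),
    ← ENNReal.ofReal_mul (by positivity)]
  congr 1
  field_simp

/-- Here `β = μ = ∞`; positivity of `ν` prevents the product from collapsing to `0` by the
convention `∞ · 0 = 0`. -/
theorem certificate_eq_top (hS : S.Centered) {f : S.Sys} (hf : ∀ i, f i ≠ 0) {x : Pt n}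
    (h : S.sig f x = 0) : S.certificate f x = ⊤ := by
  have h1 : ¬ IsUnit (S.condMat (S.renorm f x) 0) := by
    rw [← sig_pos_iff hS hf, h]; exact lt_irrefl _
  have hν : ENNReal.ofReal S.nuR ≠ 0 := by simpa using nuR_pos hS
  rw [certificate, beta, fderiv_localFun hS.momentum_zero, if_neg h1, mu, if_neg h1,
    nu_eq hS.momentum_zero]
  simp [hν]

/-- The division-free form is the one that can be integrated, rescaled and passed to the limit `σ →
0`. -/
theorem certificate_le_iff (hS : S.Centered) {f : S.Sys} (hf : ∀ i, f i ≠ 0) {x : Pt n} {α : ℝ}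
    (hα : 0 ≤ α) : S.certificate f x ≤ ENNReal.ofReal α ↔
      0 < S.sig f x ∧ S.nuR * ‖S.J (S.step f x)‖ ≤ 2 * α * S.sig f x := by
  rcases (sig_nonneg f x).eq_or_lt with h | h
  · rw [certificate_eq_top hS hf h.symm, ← h]; simp
  · rw [certificate_eq hS hf h, ENNReal.ofReal_le_ofReal_iff hα, div_le_iff₀ (by positivity)]
    constructor
    · intro h1; exact ⟨h, by linarith⟩
    · rintro ⟨-, h1⟩; linarith

theorem newtonMat_injective_iff (f : S.Sys) :
    IsUnit (S.newtonMat f 0) ↔ IsUnit (S.condMat f 0) := by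
  have hV : ∀ i, (‖S.V i 0‖ : ℂ) ≠ 0 := fun i => by exact_mod_cast (S.norm_V_zero_pos i).ne'
  have : ∀ v, S.newtonMat f 0 v = 0 ↔ S.condMat f 0 v = 0 := by
    intro v
    constructor <;> intro h <;> ext i
    · have h1 := S.newtonMat_apply f v i
      rw [h] at h1
      have h2 := mul_eq_zero.mp h1.symm
      exact h2.resolve_left (hV i)
    · rw [newtonMat_apply, h]; simp
  simp only [isUnit_iff_injective, this]

theorem newtonDefined_iff (hS : S.Centered) {f : S.Sys} (hf : ∀ i, f i ≠ 0) (x : Pt n) :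
    S.NewtonDefined f x ↔ 0 < S.sig f x := by
  rw [NewtonDefined, newtonMat_injective_iff, sig_pos_iff hS hf]

/-- The factors `‖V_i(0)‖` in the rows of the Newton matrix and in the evaluation cancel. -/
theorem newtonStep_eq (hS : S.Centered) {f : S.Sys} (hf : ∀ i, f i ≠ 0) {x : Pt n}
    (h : 0 < S.sig f x) : S.newtonStep f x = x - S.step f x := by
  have h1 : Ring.inverse (S.newtonMat (S.renorm f x) 0) (S.eval (S.renorm f x) 0) = S.step f x := by
    refine inverse_apply_eq ((newtonDefined_iff hS hf x).mpr h) ?_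
    ext i
    rw [newtonMat_apply, condMat_step hS hf h, eval_renorm]
  rw [newtonStep, newton, h1]
  abel

end Supports

end Toric

end

/-! ### Lipschitz estimates for `σ` along paths. -/

noncomputable section

namespace Toric

variable {n : ℕ}

theorem norm_sub_le_integral {E : Type*} [NormedAddCommGroup E] [NormedSpace ℝ E]
    {f f' : ℝ → E} {g : ℝ → ℝ} {a b : ℝ} (hab : a ≤ b)
    (hf : ∀ τ ∈ Icc a b, HasDerivAt f (f' τ) τ) (hg : ContinuousOn g (Icc a b))
    (hfg : ∀ τ ∈ Icc a b, ‖f' τ‖ ≤ g τ) : ‖f b - f a‖ ≤ ∫ τ in a..b, g τ := by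
  refine norm_sub_le_integral_of_norm_deriv_le_of_le hab
    (fun τ hτ => (hf τ hτ).continuousAt.continuousWithinAt)
    (fun τ hτ => (hf τ (Ioo_subset_Icc_self hτ)).differentiableAt.differentiableWithinAt)
    (Eventually.of_forall fun τ hτ => ?_) (hg.intervalIntegrable_of_Icc hab)
  rw [(hf τ (Ioo_subset_Icc_self hτ)).deriv]
  exact hfg τ (Ioo_subset_Icc_self hτ)

theorem starProjection_orthogonal_singleton {E : Type*} [NormedAddCommGroup E]
    [InnerProductSpace ℂ E] (v w : E) :
    (Submodule.span ℂ {v})ᗮ.starProjection w =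
      w - (inner ℂ v w / ((‖v‖ : ℂ) ^ 2)) • v := by
  rw [Submodule.starProjection_orthogonal_val, Submodule.starProjection_singleton]
  push_cast
  rfl

/-- A path in a punctured Hermitian space can be rescaled to a path on the unit sphere whose
velocity is orthogonal to the path. -/
theorem exists_horizontal_unit_lift {ι : Type*} [Fintype ι] {p p' : ℝ → EuclideanSpace ℂ ι}
    {a b : ℝ} (hab : a ≤ b) (hp : ∀ τ ∈ Icc a b, HasDerivAt p (p' τ) τ)
    (hp' : ContinuousOn p' (Icc a b)) (h0 : ∀ τ ∈ Icc a b, p τ ≠ 0) :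
    ∃ γ : ℝ → ℂ, ∀ τ ∈ Icc a b, γ τ ≠ 0 ∧ ‖γ τ‖ = ‖p τ‖⁻¹ ∧
      HasDerivAt (fun s => γ s • p s)
        (γ τ • (Submodule.span ℂ {p τ})ᗮ.starProjection (p' τ)) τ := by
  let k : ℝ → ℂ := fun τ => inner ℂ (p τ) (p' τ) / ((‖p τ‖ : ℂ) ^ 2)
  have hpc : ContinuousOn p (Icc a b) := fun τ hτ => (hp τ hτ).continuousAt.continuousWithinAt
  have hk : ContinuousOn k (Icc a b) := by
    refine (hpc.inner hp').div ?_ fun τ hτ => ?_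
    · exact (Complex.continuous_ofReal.comp_continuousOn hpc.norm).pow 2
    · exact pow_ne_zero 2 (by exact_mod_cast norm_ne_zero_iff.mpr (h0 τ hτ))
  -- Extending `k` continuously to the line gives its primitive two-sided derivatives at the
  -- end-points too.
  let k2 : ℝ → ℂ := IccExtend hab ((Icc a b).domRestrict k)
  have hk2 : Continuous k2 := hk.domRestrict.Icc_extend'
  have hkk : ∀ τ ∈ Icc a b, k2 τ = k τ := fun τ hτ => by
    simp only [k2, IccExtend_of_mem hab _ hτ, domRestrict_apply]
  have hpa : ‖p a‖ ≠ 0 := norm_ne_zero_iff.mpr (h0 a (left_mem_Icc.mpr hab))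
  -- This solves `γ' = -kγ`, which removes from the velocity of `γp` its component along `p`.
  let γ : ℝ → ℂ := fun τ => (‖p a‖ : ℂ)⁻¹ * Complex.exp (-∫ s in a..τ, k2 s)
  have hγ0 : ∀ τ, γ τ ≠ 0 := fun τ =>
    mul_ne_zero (inv_ne_zero (by exact_mod_cast hpa)) (Complex.exp_ne_zero _)
  have hγ : ∀ τ ∈ Icc a b, HasDerivAt γ (-(k τ) * γ τ) τ := by
    intro τ hτ
    have h1 := (hk2.integral_hasStrictDerivAt a τ).hasDerivAt
    rw [hkk τ hτ] at h1
    have h2 := (h1.neg.cexp).const_mul ((‖p a‖ : ℂ)⁻¹)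
    refine h2.congr_deriv ?_
    simp only [γ, Pi.neg_apply]
    ring
  have he : ∀ τ ∈ Icc a b, HasDerivAt (fun s => γ s • p s)
      (γ τ • (Submodule.span ℂ {p τ})ᗮ.starProjection (p' τ)) τ := by
    intro τ hτ
    refine ((hγ τ hτ).smul (hp τ hτ)).congr_deriv ?_
    rw [starProjection_orthogonal_singleton, smul_sub, smul_smul, sub_eq_add_neg, ← neg_smul]
    simp only [k]
    congr 2
    ring
  refine ⟨γ, fun τ hτ => ⟨hγ0 τ, ?_, he τ hτ⟩⟩
  -- Orthogonality of velocity and position makes the squared norm constant; its value at `a` is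
  -- `1`.
  let N : ℝ → ℂ := fun s => inner ℂ (γ s • p s) (γ s • p s)
  have hN : ∀ s ∈ Icc a b, HasDerivAt N 0 s := by
    intro s hs
    have h := (he s hs).inner ℂ (he s hs)
    refine h.congr_deriv ?_
    have h1 : inner ℂ (p s) ((Submodule.span ℂ {p s})ᗮ.starProjection (p' s)) = 0 :=
      Submodule.mem_orthogonal_singleton_iff_inner_right.mp
        (Submodule.starProjection_apply_mem _ _)
    have h2 : inner ℂ ((Submodule.span ℂ {p s})ᗮ.starProjection (p' s)) (p s) = 0 :=
      inner_eq_zero_symm.mp h1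
    simp only [inner_smul_left, inner_smul_right, h1, h2, mul_zero, add_zero]
  have hconst := constant_of_has_deriv_right_zero
    (fun s hs => (hN s hs).continuousAt.continuousWithinAt)
    (fun s hs => (hN s (Ico_subset_Icc_self hs)).hasDerivWithinAt) τ hτ
  have ha : N a = 1 := by
    simp only [N, γ, intervalIntegral.integral_same, neg_zero, Complex.exp_zero, mul_one,
      inner_self_eq_norm_sq_to_K, norm_smul, norm_inv, Complex.norm_real, norm_norm]
    rw [inv_mul_cancel₀ hpa]
    simp
  rw [ha] at hconst
  simp only [N, inner_self_eq_norm_sq_to_K] at hconst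
  have h3 : ‖γ τ • p τ‖ ^ 2 = 1 := Complex.ofReal_injective (by push_cast; exact hconst)
  have h4 : ‖γ τ • p τ‖ = 1 := (pow_eq_one_iff_of_nonneg (norm_nonneg _) two_ne_zero).mp h3
  rw [norm_smul] at h4
  exact eq_inv_of_mul_eq_one_left h4

namespace Supports

variable {S : Supports n}

theorem wnorm_of_unit {e : S.Sys} (he : ∀ i, ‖e i‖ = 1) (c : Pt n) : S.wnorm e c = ‖c‖ := by
  rw [wnorm]
  congr 1
  ext i
  simp [wvec, he]

theorem norm_condMat_le (f : S.Sys) (v : Pt n) :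
    ‖S.condMat f 0 v‖ ≤ ‖(WithLp.toLp 2 f : PiLp 2 fun i => S.Coord i)‖ * ‖S.J v‖ := by
  rw [EuclideanSpace.norm_eq, PiLp.norm_eq_of_L2 (WithLp.toLp 2 f : PiLp 2 fun i => S.Coord i),
    ← Real.sqrt_sq (norm_nonneg (S.J v)), ← Real.sqrt_mul (by positivity), Finset.sum_mul]
  refine Real.sqrt_le_sqrt (Finset.sum_le_sum fun i _ => ?_)
  rw [← mul_pow]
  refine pow_le_pow_left₀ (norm_nonneg _) ((S.norm_coupling_le i (f i) _).trans ?_) 2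
  exact mul_le_mul_of_nonneg_left (S.normI_le i v) (norm_nonneg _)

theorem condMat_sub (f g : S.Sys) (v : Pt n) :
    S.condMat (f - g) 0 v = S.condMat f 0 v - S.condMat g 0 v := by
  ext i
  simp [condMat_apply, coupling_sub]

/-- For unit rows the weighted norm is Euclidean, and by Cauchy-Schwarz `M(e') - M(e)` has norm at
most `‖e' - e‖`. A least singular value is 1-Lipschitz in the operator. -/
theorem sigma_sub_le_of_unit (hS : S.Centered) {e e' : S.Sys} (he : ∀ i, ‖e i‖ = 1)
    (he' : ∀ i, ‖e' i‖ = 1) :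
    S.sigma e - ‖(WithLp.toLp 2 (e' - e) : PiLp 2 fun i => S.Coord i)‖ ≤ S.sigma e' := by
  refine le_sigma hS fun v => ?_
  have h1 := sigma_mul_le e v
  rw [wnorm_of_unit he] at h1
  rw [wnorm_of_unit he', sub_mul]
  have h2 := norm_condMat_le (e' - e) v
  rw [condMat_sub] at h2
  have h3 := norm_sub_norm_le (S.condMat e 0 v) (S.condMat e' 0 v)
  rw [norm_sub_rev] at h3
  linarith

variable (S) in
/-- The system with components scaled to unit norm. -/
def normalize (f : S.Sys) : S.Sys := S.scale (fun i => (‖f i‖ : ℂ)⁻¹) f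

theorem norm_normalize {f : S.Sys} (hf : ∀ i, f i ≠ 0) (i : Fin n) : ‖S.normalize f i‖ = 1 := by
  rw [normalize, scale, norm_smul, norm_inv, Complex.norm_real, norm_norm,
    inv_mul_cancel₀ (norm_ne_zero_iff.mpr (hf i))]

theorem sigma_normalize {f : S.Sys} (hf : ∀ i, f i ≠ 0) : S.sigma (S.normalize f) = S.sigma f :=
  sigma_scale (fun i => inv_ne_zero (by exact_mod_cast norm_ne_zero_iff.mpr (hf i))) f

theorem continuousAt_sigma (hS : S.Centered) {f : S.Sys} (hf : ∀ i, f i ≠ 0) :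
    ContinuousAt S.sigma f := by
  have hN : ContinuousAt S.normalize f := by
    refine continuousAt_pi.mpr fun i => ?_
    have h1 : ContinuousAt (fun g : S.Sys => (‖g i‖ : ℂ)) f :=
      Complex.continuous_ofReal.continuousAt.comp (continuous_apply i).continuousAt.norm
    exact (h1.inv₀ (by exact_mod_cast norm_ne_zero_iff.mpr (hf i))).smul
      (continuous_apply i).continuousAt
  have hne : ∀ᶠ g : S.Sys in 𝓝 f, ∀ i, g i ≠ 0 :=
    eventually_all.mpr fun i => (continuous_apply i).continuousAt.eventually_ne (hf i)
  have hd : Tendsto (fun g : S.Sys =>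
      ‖(WithLp.toLp 2 (S.normalize g - S.normalize f) : PiLp 2 fun i => S.Coord i)‖)
      (𝓝 f) (𝓝 0) := by
    have h1 : ContinuousAt (fun g : S.Sys =>
        ‖(WithLp.toLp 2 (S.normalize g - S.normalize f) : PiLp 2 fun i => S.Coord i)‖) f :=
      ((PiLp.continuous_toLp 2 _).continuousAt.comp (hN.sub continuousAt_const)).norm
    have h2 := h1.tendsto
    simpa using h2
  refine tendsto_iff_norm_sub_tendsto_zero.mpr
    (squeeze_zero' (Eventually.of_forall fun _ => norm_nonneg _) (hne.mono fun g hg => ?_) hd)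
  have h1 := sigma_sub_le_of_unit hS (norm_normalize hf) (norm_normalize hg)
  have h2 := sigma_sub_le_of_unit hS (norm_normalize hg) (norm_normalize hf)
  rw [sigma_normalize hf, sigma_normalize hg] at h1 h2
  rw [← neg_sub (S.normalize g), WithLp.toLp_neg, norm_neg] at h2
  rw [Real.norm_eq_abs, abs_le]
  constructor <;> linarith

theorem continuousOn_fsNorm {p p' : ℝ → S.Sys} {s : Set ℝ} (hp : ContinuousOn p s)
    (hp' : ContinuousOn p' s) (h0 : ∀ τ ∈ s, ∀ i, p τ i ≠ 0) :
    ContinuousOn (fun τ => S.fsNorm (p τ) (p' τ)) s := by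
  unfold fsNorm
  refine ContinuousOn.sqrt (continuousOn_finsetSum _ fun i _ => ?_)
  have hpi : ContinuousOn (fun τ => p τ i) s := (continuous_apply i).comp_continuousOn hp
  have hpi' : ContinuousOn (fun τ => p' τ i) s := (continuous_apply i).comp_continuousOn hp'
  have hn : ContinuousOn (fun τ => (‖p τ i‖ : ℂ) ^ 2) s :=
    (Complex.continuous_ofReal.comp_continuousOn hpi.norm).pow 2
  refine ContinuousOn.div ?_ (hpi.norm.pow 2)
    fun τ hτ => pow_ne_zero 2 (norm_ne_zero_iff.mpr (h0 τ hτ i))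
  refine (ContinuousOn.norm ?_).pow 2
  simp only [starProjection_orthogonal_singleton]
  refine hpi'.sub (((hpi.inner hpi').div hn fun τ hτ => ?_).smul hpi)
  exact pow_ne_zero 2 (by exact_mod_cast norm_ne_zero_iff.mpr (h0 τ hτ i))

theorem fsNorm_nonneg (p p' : S.Sys) : 0 ≤ S.fsNorm p p' := Real.sqrt_nonneg _

/-- Along a path, the inverse of the condition number decreases at most by the length of the path
in the product of the projective spaces. -/
theorem sigma_sub_le_integral (hS : S.Centered) {p p' : ℝ → S.Sys} {a b : ℝ} (hab : a ≤ b)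
    (hp : ∀ τ ∈ Icc a b, HasDerivAt p (p' τ) τ) (hp' : ContinuousOn p' (Icc a b))
    (h0 : ∀ τ ∈ Icc a b, ∀ i, p τ i ≠ 0) :
    S.sigma (p a) - S.sigma (p b) ≤ ∫ τ in a..b, S.fsNorm (p τ) (p' τ) := by
  -- Horizontal unit lifts keep `σ` and have Euclidean speed equal to the Fubini-Study speed. The
  -- chord is then at most the length.
  have hlift := fun i => exists_horizontal_unit_lift hab
    (fun τ hτ => hasDerivAt_pi.mp (hp τ hτ) i) ((continuous_apply i).comp_continuousOn hp')
    fun τ hτ => h0 τ hτ i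
  choose γ hγ using hlift
  let e : ℝ → S.Sys := fun τ => S.scale (fun i => γ i τ) (p τ)
  have hunit : ∀ τ ∈ Icc a b, ∀ i, ‖e τ i‖ = 1 := fun τ hτ i => by
    simp only [e, scale, norm_smul]
    rw [(hγ i τ hτ).2.1, inv_mul_cancel₀ (norm_ne_zero_iff.mpr (h0 τ hτ i))]
  have hsig : ∀ τ ∈ Icc a b, S.sigma (e τ) = S.sigma (p τ) := fun τ hτ =>
    sigma_scale (fun i => (hγ i τ hτ).1) (p τ)
  let e' : ℝ → S.Sys := fun τ i =>
    γ i τ • (Submodule.span ℂ {p τ i})ᗮ.starProjection (p' τ i)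
  have hE : ∀ τ ∈ Icc a b, HasDerivAt
      (fun s => (WithLp.toLp 2 (e s) : PiLp 2 fun i => S.Coord i)) (WithLp.toLp 2 (e' τ)) τ := by
    intro τ hτ
    have h1 : HasDerivAt e (e' τ) τ := hasDerivAt_pi.mpr fun i => (hγ i τ hτ).2.2
    exact (PiLp.continuousLinearEquiv 2 ℝ (fun i => S.Coord i)).symm.hasFDerivAt.comp_hasDerivAt τ h1
  have hnorm : ∀ τ ∈ Icc a b,
      ‖(WithLp.toLp 2 (e' τ) : PiLp 2 fun i => S.Coord i)‖ ≤ S.fsNorm (p τ) (p' τ) := by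
    intro τ hτ
    rw [PiLp.norm_eq_of_L2, fsNorm]
    refine Real.sqrt_le_sqrt (Finset.sum_le_sum fun i _ => le_of_eq ?_)
    simp only [e', norm_smul, (hγ i τ hτ).2.1]
    rw [mul_pow, inv_pow, div_eq_inv_mul]
  have hpc : ContinuousOn p (Icc a b) := fun τ hτ => (hp τ hτ).continuousAt.continuousWithinAt
  have h1 := norm_sub_le_integral hab hE (continuousOn_fsNorm hpc hp' h0) hnorm
  have ha := left_mem_Icc.mpr hab
  have hb := right_mem_Icc.mpr hab
  have h2 := sigma_sub_le_of_unit hS (hunit a ha) (hunit b hb)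
  rw [hsig a ha, hsig b hb, WithLp.toLp_sub] at h2
  linarith

theorem hasDerivAt_renorm_line (f : S.Sys) (x w : Pt n) (τ : ℝ) :
    HasDerivAt (fun s : ℝ => S.renorm f (x + (s : ℂ) • w))
      (fun i => WithLp.toLp 2 fun a : S.A i =>
        S.renorm f (x + (τ : ℂ) • w) i a * pairing a w) τ := by
  refine hasDerivAt_pi.mpr fun i => ?_
  have h1 : HasDerivAt (fun (s : ℝ) (a : S.A i) => S.renorm f (x + (s : ℂ) • w) i a)
      (fun a : S.A i => S.renorm f (x + (τ : ℂ) • w) i a * pairing a w) τ := by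
    refine hasDerivAt_pi.mpr fun a => ?_
    simp only [renorm_apply, pairing_add, pairing_smul]
    have h2 : HasDerivAt (fun s : ℝ => pairing a x + (s : ℂ) * pairing (a : Fin n → ℝ) w)
        (pairing a w) τ := by
      have := ((hasDerivAt_id τ).ofReal_comp.mul_const (pairing (a : Fin n → ℝ) w)).const_add
        (pairing (a : Fin n → ℝ) x)
      simpa using this
    refine (h2.cexp.const_mul (f i a)).congr_deriv ?_
    ring
  exact (PiLp.continuousLinearEquiv 2 ℝ (fun _ : S.A i => ℂ)).symm.hasFDerivAt.comp_hasDerivAt τ h1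

/-- The inverse of the condition number is `ν`-Lipschitz under renormalization. -/
theorem sig_sub_le (hS : S.Centered) {f : S.Sys} (hf : ∀ i, f i ≠ 0) (x w : Pt n) :
    S.sig f x - S.nuR * ‖S.J w‖ ≤ S.sig f (x + w) := by
  let p : ℝ → S.Sys := fun s => S.renorm f (x + (s : ℂ) • w)
  let p' : ℝ → S.Sys := fun τ i => WithLp.toLp 2 fun a : S.A i => p τ i a * pairing a w
  have hp : ∀ τ, HasDerivAt p (p' τ) τ := hasDerivAt_renorm_line f x w
  have hpc : Continuous p := continuous_iff_continuousAt.mpr fun τ => (hp τ).continuousAt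
  have hp' : Continuous p' := by
    refine continuous_pi fun i => (PiLp.continuous_toLp 2 _).comp (continuous_pi fun a => ?_)
    have : Continuous fun τ => p τ i a :=
      (EuclideanSpace.proj a : S.Coord i →L[ℂ] ℂ).continuous.comp
        ((continuous_apply i).comp hpc)
    exact this.mul continuous_const
  have h0 : ∀ τ i, p τ i ≠ 0 := fun τ i => S.renorm_ne_zero _ (hf i)
  have h1 := sigma_sub_le_integral hS zero_le_one (fun τ _ => hp τ) hp'.continuousOn
    fun τ _ => h0 τ
  -- The velocity of the renormalized row is the coordinatewise product of the row with `a w`, and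
  -- `|a w| ≤ ν‖w‖_i`. Projecting only shortens it.
  have hbound : ∀ τ, S.fsNorm (p τ) (p' τ) ≤ S.nuR * ‖S.J w‖ := by
    intro τ
    rw [fsNorm, Real.sqrt_le_left (by have := nuR_nonneg (S := S); positivity), mul_pow,
      PiLp.norm_sq_eq_of_L2, Finset.mul_sum]
    refine Finset.sum_le_sum fun i _ => ?_
    have hpos : 0 < ‖p τ i‖ := norm_pos_iff.mpr (h0 τ i)
    rw [div_le_iff₀ (by positivity), ← mul_pow, ← mul_pow]
    refine pow_le_pow_left₀ (norm_nonneg _) ?_ 2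
    refine (Submodule.norm_starProjection_apply_le _ _).trans ?_
    have hk : 0 ≤ S.nuR * ‖S.J w i‖ := mul_nonneg nuR_nonneg (norm_nonneg _)
    rw [← Real.norm_of_nonneg hk, ← Complex.norm_real, ← norm_smul, EuclideanSpace.norm_eq,
      EuclideanSpace.norm_eq]
    refine Real.sqrt_le_sqrt (Finset.sum_le_sum fun a _ =>
      pow_le_pow_left₀ (norm_nonneg _) ?_ 2)
    rw [PiLp.smul_apply, norm_smul, Complex.norm_real, Real.norm_of_nonneg hk]
    simp only [p', norm_mul]
    rw [mul_comm]
    exact mul_le_mul_of_nonneg_right (norm_pairing_le hS.momentum_zero i a w) (norm_nonneg _)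
  have hcont : ContinuousOn (fun τ => S.fsNorm (p τ) (p' τ)) (Icc 0 1) :=
    continuousOn_fsNorm hpc.continuousOn hp'.continuousOn fun τ _ => h0 τ
  have h2 : ∫ τ in (0:ℝ)..1, S.fsNorm (p τ) (p' τ) ≤ ∫ _τ in (0:ℝ)..1, S.nuR * ‖S.J w‖ :=
    intervalIntegral.integral_mono_on zero_le_one (hcont.intervalIntegrable_of_Icc zero_le_one)
      intervalIntegrable_const fun τ _ => hbound τ
  simp only [intervalIntegral.integral_const, sub_zero, one_smul] at h2
  have e0 : S.sigma (p 0) = S.sig f x := by simp [p, sig]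
  have e1 : S.sigma (p 1) = S.sig f (x + w) := by simp [p, sig]
  rw [e0, e1] at h1
  linarith

theorem sig_sub_le' (hS : S.Centered) {f : S.Sys} (hf : ∀ i, f i ≠ 0) (x y : Pt n) :
    S.sig f x - S.nuR * ‖S.J (y - x)‖ ≤ S.sig f y := by
  simpa using sig_sub_le hS hf x (y - x)

end Supports

end Toric

end

/-! ### Newton estimates: existence and uniqueness of zeros, contraction of the certificate. -/

noncomputable section

namespace Toric

variable {n : ℕ}

/-- A majorant of `e ^ h - 1` for `h ≤ 1`. -/
def expMajorant (h : ℝ) : ℝ := h * (1 + h * (1 / 2 + 2 * h / 9))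

theorem norm_exp_sub_one_sub_id_le {s : ℂ} {h : ℝ} (hs : ‖s‖ ≤ h) (h1 : h ≤ 1) :
    ‖Complex.exp s - 1 - s‖ ≤ h * (1 / 2 + 2 * h / 9) * ‖s‖ := by
  -- Keeping three terms leaves the remainder constant `4 / (3! · 3) = 2/9`.
  have hb := Complex.exp_bound (hs.trans h1) (n := 3) (by norm_num)
  norm_num [Finset.sum_range_succ, Nat.factorial] at hb
  have e : Complex.exp s - 1 - s = (Complex.exp s - (1 + s + s ^ 2 / 2)) + s ^ 2 / 2 := by ring
  rw [e]
  refine (norm_add_le _ _).trans ?_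
  have h2 : ‖s ^ 2 / 2‖ = ‖s‖ ^ 2 / 2 := by simp
  rw [h2]
  have h0 := norm_nonneg s
  have h3 : ‖s‖ ^ 2 ≤ h * ‖s‖ := by nlinarith
  have h4 : ‖s‖ ^ 3 ≤ h * h * ‖s‖ := by
    calc ‖s‖ ^ 3 = ‖s‖ * ‖s‖ ^ 2 := by ring
      _ ≤ ‖s‖ * (h * ‖s‖) := mul_le_mul_of_nonneg_left h3 h0
      _ = h * ‖s‖ ^ 2 := by ring
      _ ≤ h * (h * ‖s‖) := mul_le_mul_of_nonneg_left h3 (h0.trans hs)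
      _ = h * h * ‖s‖ := by ring
  linarith

theorem norm_exp_sub_one_le {s : ℂ} {h : ℝ} (hs : ‖s‖ ≤ h) (h1 : h ≤ 1) :
    ‖Complex.exp s - 1‖ ≤ expMajorant h := by
  have h2 := norm_exp_sub_one_sub_id_le hs h1
  have h3 := norm_add_le (Complex.exp s - 1 - s) s
  rw [sub_add_cancel] at h3
  have h0 := (norm_nonneg s).trans hs
  have h4 : h * (1 / 2 + 2 * h / 9) * ‖s‖ ≤ h * (1 / 2 + 2 * h / 9) * h :=
    mul_le_mul_of_nonneg_left hs (by positivity)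
  unfold expMajorant
  linarith

/-- Mean value inequality for `e^y - y`, whose derivative is `e^y - 1`. -/
theorem norm_exp_sub_exp_sub_le {s t : ℂ} {h : ℝ} (hs : ‖s‖ ≤ h) (ht : ‖t‖ ≤ h) (h1 : h ≤ 1) :
    ‖Complex.exp s - Complex.exp t - (s - t)‖ ≤ expMajorant h * ‖s - t‖ := by
  have hd : ∀ x ∈ Metric.closedBall (0 : ℂ) h,
      HasDerivWithinAt (fun y => Complex.exp y - y) (Complex.exp x - 1)
        (Metric.closedBall (0 : ℂ) h) x := fun x _ =>
    ((Complex.hasDerivAt_exp x).sub (hasDerivAt_id x)).hasDerivWithinAt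
  have := (convex_closedBall (0 : ℂ) h).norm_image_sub_le_of_norm_hasDerivWithin_le hd
    (fun x hx => norm_exp_sub_one_le (mem_closedBall_zero_iff.mp hx) h1)
    (mem_closedBall_zero_iff.mpr ht) (mem_closedBall_zero_iff.mpr hs)
  rw [sub_sub_sub_comm]
  exact this

theorem expMajorant_nonneg {h : ℝ} (h0 : 0 ≤ h) : 0 ≤ expMajorant h := by
  unfold expMajorant; positivity

/-- Extracting the factor `s = σ ≤ 1` lets the remainder be compared with the lower bound `σ‖v‖₀`
for the linear part. -/
theorem expMajorant_mul_le {k s : ℝ} (hk : 0 ≤ k) (hs : 0 ≤ s) (hs1 : s ≤ 1) :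
    expMajorant (k * s) ≤ expMajorant k * s := by
  have h1 : k * s ≤ k := mul_le_of_le_one_right hk hs1
  have h2 : 0 ≤ k * s := mul_nonneg hk hs
  have h3 : 1 + k * s * (1 / 2 + 2 * (k * s) / 9) ≤ 1 + k * (1 / 2 + 2 * k / 9) := by gcongr
  calc expMajorant (k * s) = k * s * (1 + k * s * (1 / 2 + 2 * (k * s) / 9)) := rfl
    _ ≤ k * s * (1 + k * (1 / 2 + 2 * k / 9)) := mul_le_mul_of_nonneg_left h3 h2
    _ = expMajorant k * s := by unfold expMajorant; ring

theorem half_majorant_mul_le {k s : ℝ} (hk : 0 ≤ k) (hs : 0 ≤ s) (hs1 : s ≤ 1) :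
    k * s * (1 / 2 + 2 * (k * s) / 9) ≤ k * (1 / 2 + 2 * k / 9) * s := by
  have h1 : k * s ≤ k := mul_le_of_le_one_right hk hs1
  have h2 : 0 ≤ k * s := mul_nonneg hk hs
  have h3 : 1 / 2 + 2 * (k * s) / 9 ≤ 1 / 2 + 2 * k / 9 := by gcongr
  calc _ ≤ k * s * (1 / 2 + 2 * k / 9) := mul_le_mul_of_nonneg_left h3 h2
    _ = _ := by ring

namespace Supports

variable {S : Supports n}

theorem F_eq_F_renorm (f : S.Sys) (x y : Pt n) : S.F f y = S.F (S.renorm f x) (y - x) := by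
  have := S.localFun_renorm f x (y - x)
  rw [add_sub_cancel] at this
  exact this.symm

theorem renorm_eq_renorm_renorm (f : S.Sys) (x y : Pt n) :
    S.renorm f y = S.renorm (S.renorm f x) (y - x) := by
  rw [renorm_renorm, add_sub_cancel]

theorem norm_J_pairing (hS : S.Centered) {h : ℝ} {w : Pt n} (hw : S.nuR * ‖S.J w‖ ≤ h) (i : Fin n)
    (a : S.A i) : ‖pairing a w‖ ≤ h :=
  (norm_pairing_le_J hS.momentum_zero i a w).trans hw

/-- First order estimate for the remainder of `F`. -/
theorem wnorm_F_sub_F_sub_le (hS : S.Centered) (f : S.Sys) {x y z : Pt n} {h : ℝ} (h1 : h ≤ 1)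
    (hy : S.nuR * ‖S.J (y - x)‖ ≤ h) (hz : S.nuR * ‖S.J (z - x)‖ ≤ h) :
    S.wnorm (S.renorm f x) (S.F f y - S.F f z - S.condMat (S.renorm f x) 0 (y - z))
      ≤ expMajorant h * ‖S.J (y - z)‖ := by
  have h0 : 0 ≤ h := (mul_nonneg nuR_nonneg (norm_nonneg _)).trans hy
  refine wnorm_le_of_row (expMajorant_nonneg h0) fun i => ?_
  rw [F_eq_F_renorm f x y, F_eq_F_renorm f x z]
  have e : (S.F (S.renorm f x) (y - x) - S.F (S.renorm f x) (z - x) -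
      S.condMat (S.renorm f x) 0 (y - z)) i =
      ∑ a : S.A i, S.renorm f x i a * ((‖S.V i 0‖ : ℂ)⁻¹ * (S.ρ i a *
        (Complex.exp (pairing a (y - x)) - Complex.exp (pairing a (z - x)) -
          (pairing a (y - x) - pairing a (z - x))))) := by
    simp only [PiLp.sub_apply, F_apply, condMat_apply_sum hS.momentum_zero,
      ← Finset.sum_sub_distrib]
    refine Finset.sum_congr rfl fun a _ => ?_
    rw [← pairing_sub, sub_sub_sub_cancel_right]
    ring
  rw [e]
  refine norm_row_le hS.momentum_zero _ i _ (expMajorant_nonneg h0) (y - z) fun a => ?_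
  have := norm_exp_sub_exp_sub_le (norm_J_pairing hS hy i a) (norm_J_pairing hS hz i a) h1
  have e2 : pairing a (y - x) - pairing a (z - x) = pairing (a : Fin n → ℝ) (y - z) := by
    rw [← pairing_sub, sub_sub_sub_cancel_right]
  rw [e2] at this ⊢
  exact this

/-- Second order estimate for the remainder of `F`. -/
theorem wnorm_F_sub_le (hS : S.Centered) (f : S.Sys) {x y : Pt n} {h : ℝ} (h1 : h ≤ 1)
    (hy : S.nuR * ‖S.J (y - x)‖ ≤ h) :
    S.wnorm (S.renorm f x) (S.F f y - S.F f x - S.condMat (S.renorm f x) 0 (y - x))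
      ≤ h * (1 / 2 + 2 * h / 9) * ‖S.J (y - x)‖ := by
  have h0 : 0 ≤ h := (mul_nonneg nuR_nonneg (norm_nonneg _)).trans hy
  refine wnorm_le_of_row (by positivity) fun i => ?_
  rw [F_eq_F_renorm f x y, F_eq_F_renorm f x x]
  have e : (S.F (S.renorm f x) (y - x) - S.F (S.renorm f x) (x - x) -
      S.condMat (S.renorm f x) 0 (y - x)) i =
      ∑ a : S.A i, S.renorm f x i a * ((‖S.V i 0‖ : ℂ)⁻¹ * (S.ρ i a *
        (Complex.exp (pairing a (y - x)) - 1 - pairing a (y - x)))) := by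
    simp only [PiLp.sub_apply, F_apply, condMat_apply_sum hS.momentum_zero,
      ← Finset.sum_sub_distrib, sub_self, pairing_zero, Complex.exp_zero]
    exact Finset.sum_congr rfl fun a _ => by ring
  rw [e]
  exact norm_row_le hS.momentum_zero _ i _ (by positivity) (y - x) fun a =>
    norm_exp_sub_one_sub_id_le (norm_J_pairing hS hy i a) h1

/-- Variation of the derivative of `F`. -/
theorem wnorm_condMat_sub_le (hS : S.Centered) (f : S.Sys) {x y : Pt n} {h : ℝ} (h1 : h ≤ 1)
    (hy : S.nuR * ‖S.J (y - x)‖ ≤ h) (v : Pt n) :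
    S.wnorm (S.renorm f x) (S.condMat (S.renorm f y) 0 v - S.condMat (S.renorm f x) 0 v)
      ≤ expMajorant h * ‖S.J v‖ := by
  have h0 : 0 ≤ h := (mul_nonneg nuR_nonneg (norm_nonneg _)).trans hy
  refine wnorm_le_of_row (expMajorant_nonneg h0) fun i => ?_
  rw [renorm_eq_renorm_renorm f x y]
  have e : (S.condMat (S.renorm (S.renorm f x) (y - x)) 0 v - S.condMat (S.renorm f x) 0 v) i =
      ∑ a : S.A i, S.renorm f x i a * ((‖S.V i 0‖ : ℂ)⁻¹ * (S.ρ i a *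
        ((Complex.exp (pairing a (y - x)) - 1) * pairing a v))) := by
    simp only [PiLp.sub_apply, condMat_apply_sum hS.momentum_zero, ← Finset.sum_sub_distrib]
    refine Finset.sum_congr rfl fun a _ => ?_
    rw [S.renorm_apply (S.renorm f x)]
    ring
  rw [e]
  refine norm_row_le hS.momentum_zero _ i _ (expMajorant_nonneg h0) v fun a => ?_
  rw [norm_mul]
  exact mul_le_mul_of_nonneg_right
    (norm_exp_sub_one_le (norm_J_pairing hS hy i a) h1) (norm_nonneg _)

theorem sig_le_one (hS : S.Centered) (f : S.Sys) (x : Pt n) : S.sig f x ≤ 1 := sigma_le_one hS _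

theorem sig_mul_le (f : S.Sys) (x v : Pt n) :
    S.sig f x * ‖S.J v‖ ≤ S.wnorm (S.renorm f x) (S.condMat (S.renorm f x) 0 v) :=
  sigma_mul_le _ v

/-- Stability of the zeros that are close to a well conditioned point. -/
theorem sig_mul_dist_zero_le (hS : S.Centered) {f : S.Sys} {x y z : Pt n}
    (hy : S.nuR * ‖S.J (y - x)‖ ≤ 0.6 * S.sig f x) (hz : S.nuR * ‖S.J (z - x)‖ ≤ 0.6 * S.sig f x)
    (hFz : S.F f z = 0) :
    0.17 * (S.sig f x * ‖S.J (y - z)‖) ≤ S.wnorm (S.renorm f x) (S.F f y) := by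
  have hs0 := sig_nonneg f x
  have hs1 := sig_le_one hS f x
  have h1 := wnorm_F_sub_F_sub_le hS f (by linarith) hy hz
  have h2 := sig_mul_le f x (y - z)
  have h3 := wnorm_add_le (S.renorm f x) (S.F f y)
    (-(S.F f y - S.F f z - S.condMat (S.renorm f x) 0 (y - z)))
  rw [wnorm_neg, hFz] at h3
  rw [hFz] at h1
  have e : S.F f y + -(S.F f y - 0 - S.condMat (S.renorm f x) 0 (y - z)) =
      S.condMat (S.renorm f x) 0 (y - z) := by abel
  rw [e] at h3
  have h4 := expMajorant_mul_le (k := 0.6) (by norm_num) hs0 hs1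
  -- The remainder thus takes at most `0.83` of the linear lower bound, leaving `0.17 = 1 - 0.83`.
  have h5 : expMajorant 0.6 ≤ 0.83 := by norm_num [expMajorant]
  have h6 : expMajorant (0.6 * S.sig f x) ≤ 0.83 * S.sig f x :=
    h4.trans (mul_le_mul_of_nonneg_right h5 hs0)
  have h7 := mul_le_mul_of_nonneg_right h6 (norm_nonneg (S.J (y - z)))
  linarith

theorem zero_unique (hS : S.Centered) {f : S.Sys} {x y z : Pt n} (hs : 0 < S.sig f x)
    (hy : S.nuR * ‖S.J (y - x)‖ ≤ 0.6 * S.sig f x) (hz : S.nuR * ‖S.J (z - x)‖ ≤ 0.6 * S.sig f x)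
    (hFy : S.F f y = 0) (hFz : S.F f z = 0) : y = z := by
  have h := sig_mul_dist_zero_le hS hy hz hFz
  rw [hFy, wnorm_zero] at h
  have h1 : ‖S.J (y - z)‖ ≤ 0 := by
    by_contra hcon
    have := mul_pos hs (not_le.mp hcon)
    linarith
  exact sub_eq_zero.mp (hS.injective (by rw [norm_le_zero_iff.mp h1, map_zero]))

theorem continuous_F (f : S.Sys) : Continuous (S.F f) := by
  have : S.F f = fun x => WithLp.toLp 2 fun i => S.F f x i := rfl
  rw [this]
  refine (PiLp.continuous_toLp 2 _).comp (continuous_pi fun i => ?_)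
  simp only [F_apply]
  refine continuous_finsetSum _ fun a _ => continuous_const.mul (continuous_const.mul
    (continuous_const.mul (Complex.continuous_exp.comp (continuous_pairing (a : Fin n → ℝ)))))

/-- Existence of a zero near a point with a small certificate. -/
theorem exists_zero (hS : S.Centered) {f : S.Sys} (hf : ∀ i, f i ≠ 0) {x : Pt n} {a u : ℝ}
    (hs : 0 < S.sig f x) (hd : S.nuR * ‖S.J (S.step f x)‖ ≤ 2 * a * S.sig f x) (hu0 : 0 ≤ u)
    (hu : u ≤ 0.3) (hau : a + u ^ 2 * (1 + 8 * u / 9) ≤ u) :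
    ∃ z, S.F f z = 0 ∧ S.nuR * ‖S.J (z - x)‖ ≤ 2 * u * S.sig f x := by
  have hs1 := sig_le_one hS f x
  have hν := nuR_pos hS
  set σ := S.sig f x with hσ
  have hM := (sig_pos_iff hS hf x).mp hs
  set M := S.condMat (S.renorm f x) 0 with hMdef
  let K : Set (Pt n) := {y | S.nuR * ‖S.J (y - x)‖ ≤ 2 * u * σ}
  have hK : IsCompact K := by
    obtain ⟨C, hC, hCJ⟩ := exists_norm_le_J hS
    refine Metric.isCompact_of_isClosed_isBounded ?_ ?_
    · exact isClosed_le (by fun_prop) continuous_const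
    · refine (Metric.isBounded_closedBall (x := x) (r := C * (2 * u * σ / S.nuR))).subset
        fun y hy => ?_
      rw [Metric.mem_closedBall, dist_eq_norm]
      refine (hCJ _).trans (mul_le_mul_of_nonneg_left ?_ hC.le)
      rw [le_div_iff₀ hν, mul_comm]
      exact hy
  have hxK : x ∈ K := by
    simp only [K, mem_ofPred_eq, sub_self, map_zero, norm_zero, mul_zero]
    positivity
  -- The simplified Newton correction with the derivative frozen at `x`. Its norm is minimized over
  -- the compact ball `K`; the next simplified iterate lies in `K` and has a correction at most
  -- `0.83` times as large, so the minimum is `0`.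
  let g : Pt n → Pt n := fun y => Ring.inverse M (S.F f y)
  have hMg : ∀ y, M (g y) = S.F f y := fun y => apply_inverse hM _
  have hg : Continuous fun y => ‖S.J (g y)‖ :=
    (S.J.continuous.comp ((Ring.inverse M).continuous.comp (continuous_F f))).norm
  obtain ⟨y, hyK, hy⟩ := hK.exists_isMinOn ⟨x, hxK⟩ hg.continuousOn
  have hyK' : S.nuR * ‖S.J (y - x)‖ ≤ 2 * u * σ := hyK
  have hle1 : 2 * u * σ ≤ 0.6 * σ := mul_le_mul_of_nonneg_right (by linarith) hs.le
  have hle2 : 2 * u * σ ≤ 1 := by linarith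
  let y' := y - g y
  have hy'K : y' ∈ K := by
    -- This is `M⁻¹` of minus the Taylor remainder of `F` at `x`. So `y' - x` is a quadratic error
    -- minus the Newton increment, and `hau` says exactly that their bounds add up to at most `2uσ`.
    let e := y - x - g y + S.step f x
    have hMe : M e = -(S.F f y - S.F f x - M (y - x)) := by
      simp only [e, map_add, map_sub, hMg]
      rw [hMdef, condMat_step hS hf hs]
      abel
    have h1 := wnorm_F_sub_le hS f hle2 hyK'
    rw [← wnorm_neg, ← hMe] at h1
    have h2 := (sig_mul_le f x e).trans h1
    rw [← hσ] at h2
    have h3 := half_majorant_mul_le (k := 2 * u) (by positivity) hs.le hs1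
    have h4 : σ * ‖S.J e‖ ≤ σ * (2 * u * (1 / 2 + 2 * (2 * u) / 9) * ‖S.J (y - x)‖) := by
      refine h2.trans ((mul_le_mul_of_nonneg_right h3 (norm_nonneg _)).trans (le_of_eq ?_))
      ring
    have h5 := le_of_mul_le_mul_left h4 hs
    have h6 : S.nuR * ‖S.J e‖ ≤ 2 * u * (1 / 2 + 2 * (2 * u) / 9) * (2 * u * σ) := by
      calc S.nuR * ‖S.J e‖
          ≤ S.nuR * (2 * u * (1 / 2 + 2 * (2 * u) / 9) * ‖S.J (y - x)‖) :=
            mul_le_mul_of_nonneg_left h5 hν.le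
        _ = 2 * u * (1 / 2 + 2 * (2 * u) / 9) * (S.nuR * ‖S.J (y - x)‖) := by ring
        _ ≤ _ := mul_le_mul_of_nonneg_left hyK' (by positivity)
    have h7 : S.J (y' - x) = S.J e - S.J (S.step f x) := by
      rw [← map_sub]; congr 1; simp only [y', e]; abel
    have h8 : ‖S.J (y' - x)‖ ≤ ‖S.J e‖ + ‖S.J (S.step f x)‖ := by
      rw [h7]; exact norm_sub_le _ _
    have h9 := mul_le_mul_of_nonneg_left h8 hν.le
    have h10 := mul_le_mul_of_nonneg_right hau (by positivity : 0 ≤ 2 * σ)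
    change S.nuR * ‖S.J (y' - x)‖ ≤ 2 * u * σ
    nlinarith [h9, h10, h6, hd]
  have hmin : ‖S.J (g y)‖ ≤ ‖S.J (g y')‖ := hy hy'K
  have hcontr : ‖S.J (g y')‖ ≤ 0.83 * ‖S.J (g y)‖ := by
    have h1 := wnorm_F_sub_F_sub_le hS f (by linarith : 0.6 * σ ≤ 1) (le_trans hy'K hle1)
      (hyK'.trans hle1)
    have h2 : y' - y = -g y := by simp only [y']; abel
    rw [h2, map_neg, map_neg, norm_neg, ← hMdef, hMg] at h1
    have h3 : S.F f y' - S.F f y - -S.F f y = M (g y') := by rw [hMg]; abel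
    rw [h3] at h1
    have h4 := (sig_mul_le f x (g y')).trans h1
    have h5 := expMajorant_mul_le (k := 0.6) (by norm_num) hs.le hs1
    have h6 : expMajorant 0.6 ≤ 0.83 := by norm_num [expMajorant]
    have h7 : expMajorant (0.6 * σ) ≤ 0.83 * σ :=
      h5.trans (mul_le_mul_of_nonneg_right h6 hs.le)
    have h8 := mul_le_mul_of_nonneg_right h7 (norm_nonneg (S.J (g y)))
    refine le_of_mul_le_mul_left (a := σ) ?_ hs
    rw [← hσ] at h4
    linarith
  have h0 : ‖S.J (g y)‖ ≤ 0 := by linarith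
  have hgy : g y = 0 := hS.injective (by rw [norm_le_zero_iff.mp h0, map_zero])
  refine ⟨y, ?_, hyK'⟩
  rw [← hMg y, hgy, map_zero]

theorem sig_le_sig_add (hS : S.Centered) {f : S.Sys} (hf : ∀ i, f i ≠ 0) (x y : Pt n) :
    S.sig f y ≤ S.sig f x + S.nuR * ‖S.J (y - x)‖ := by
  have := sig_sub_le' hS hf y x
  rw [← neg_sub y x, map_neg, norm_neg] at this
  linarith

/-- The certificate decreases under Newton iteration. -/
theorem newton_certificate (hS : S.Centered) {f : S.Sys} (hf : ∀ i, f i ≠ 0) {x : Pt n}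
    (hs : 0 < S.sig f x) (hd : S.nuR * ‖S.J (S.step f x)‖ ≤ 2 * 0.0747 * S.sig f x) :
    0 < S.sig f (x - S.step f x) ∧ S.nuR * ‖S.J (S.step f (x - S.step f x))‖ ≤
      2 * 0.0085 * S.sig f (x - S.step f x) := by
  have hs1 := sig_le_one hS f x
  have hν := nuR_pos hS
  set σ := S.sig f x with hσ
  set d := S.step f x with hdd
  have hx : x - d - x = -d := by abel
  have hσ1 := sig_sub_le' hS hf x (x - d)
  rw [hx, map_neg, norm_neg] at hσ1
  set σ1 := S.sig f (x - d) with hσ1d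
  have hσ1' : 0.8506 * σ ≤ σ1 := by linarith
  have hpos : 0 < σ1 := by linarith
  refine ⟨hpos, ?_⟩
  set d1 := S.step f (x - d) with hd1
  have hM1 := condMat_step hS hf hpos
  have hM0 := condMat_step hS hf hs
  have hy : S.nuR * ‖S.J (x - d - x)‖ ≤ 0.1494 * σ := by
    rw [hx, map_neg, norm_neg]; linarith
  have h1 := wnorm_F_sub_le hS f (by linarith) hy
  have h2 := wnorm_condMat_sub_le hS f (by linarith) hy d1
  rw [hx, map_neg, map_neg, norm_neg, hM0] at h1
  -- The Newton equation `M d = F(x)` cancels the terms of order zero and one, so `F` at the iterate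
  -- is the quadratic remainder.
  have e1 : S.F f (x - d) - S.F f x - -S.F f x = S.F f (x - d) := by abel
  rw [e1] at h1
  rw [hM1] at h2
  have h3 := sig_mul_le f x d1
  have h4 := wnorm_add_le (S.renorm f x) (S.F f (x - d))
    (-(S.F f (x - d) - S.condMat (S.renorm f x) 0 d1))
  have e2 : S.F f (x - d) + -(S.F f (x - d) - S.condMat (S.renorm f x) 0 d1) =
    S.condMat (S.renorm f x) 0 d1 := by abel
  rw [wnorm_neg, e2] at h4
  have h5 := half_majorant_mul_le (k := 0.1494) (by norm_num) hs.le hs1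
  have h6 := expMajorant_mul_le (k := 0.1494) (by norm_num) hs.le hs1
  have h7 : expMajorant 0.1494 ≤ 0.162 := by norm_num [expMajorant]
  have h8 : expMajorant (0.1494 * σ) ≤ 0.162 * σ := h6.trans (mul_le_mul_of_nonneg_right h7 hs.le)
  have h9 := mul_le_mul_of_nonneg_right h5 (norm_nonneg (S.J d))
  have h10 := mul_le_mul_of_nonneg_right h8 (norm_nonneg (S.J d1))
  have hJd := norm_nonneg (S.J d)
  -- Here `0.838 = 1 - 0.162` accounts for the change of derivative, and `0.0797` bounds the
  -- quadratic coefficient at radius `0.1494 = 2 · 0.0747`.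
  have h11 : σ * (0.838 * ‖S.J d1‖) ≤ σ * (0.0797 * ‖S.J d‖) := by
    have : 0.1494 * (1 / 2 + 2 * 0.1494 / 9) * σ * ‖S.J d‖ ≤ 0.0797 * (σ * ‖S.J d‖) := by
      have := mul_nonneg hs.le hJd
      nlinarith
    rw [← hσ] at h3
    linarith
  have h12 := le_of_mul_le_mul_left h11 hs
  have h13 := mul_le_mul_of_nonneg_left h12 hν.le
  linarith

/-- The certificate at a point close to a well conditioned zero. -/
theorem certificate_of_zero (hS : S.Centered) {f : S.Sys} (hf : ∀ i, f i ≠ 0) {x z : Pt n}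
    (hs : 0 < S.sig f z) (hz : S.F f z = 0)
    (hd : S.nuR * ‖S.J (x - z)‖ ≤ 2 * 0.0514 * S.sig f z) :
    0 < S.sig f x ∧ S.nuR * ‖S.J (S.step f x)‖ ≤ 2 * 0.069 * S.sig f x := by
  have hs1 := sig_le_one hS f z
  have hν := nuR_pos hS
  have hσx := sig_sub_le' hS hf z x
  have hpos : 0 < S.sig f x := by linarith
  refine ⟨hpos, ?_⟩
  set σ := S.sig f z with hσ
  set d := S.step f x with hdd
  have hMx := condMat_step hS hf hpos
  have hd' : S.nuR * ‖S.J (x - z)‖ ≤ 0.1028 * σ := by linarith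
  have h1 := wnorm_F_sub_le hS f (by linarith) hd'
  have h2 := wnorm_condMat_sub_le hS f (by linarith) hd' d
  rw [hMx] at h2
  rw [hz] at h1
  have h3 := sig_mul_le f z (d - (x - z))
  have h4 := wnorm_add_le (S.renorm f z) (S.F f x - 0 - S.condMat (S.renorm f z) 0 (x - z))
    (-(S.F f x - S.condMat (S.renorm f z) 0 d))
  have e2 : S.F f x - 0 - S.condMat (S.renorm f z) 0 (x - z) +
      -(S.F f x - S.condMat (S.renorm f z) 0 d) =
      S.condMat (S.renorm f z) 0 (d - (x - z)) := by
    rw [map_sub _ d]; abel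
  rw [wnorm_neg, e2] at h4
  have h5 := half_majorant_mul_le (k := 0.1028) (by norm_num) hs.le hs1
  have h6 := expMajorant_mul_le (k := 0.1028) (by norm_num) hs.le hs1
  have h7 : expMajorant 0.1028 ≤ 0.1084 := by norm_num [expMajorant]
  have h8 : expMajorant (0.1028 * σ) ≤ 0.1084 * σ := h6.trans (mul_le_mul_of_nonneg_right h7 hs.le)
  have h9 := mul_le_mul_of_nonneg_right h5 (norm_nonneg (S.J (x - z)))
  have h10 := mul_le_mul_of_nonneg_right h8 (norm_nonneg (S.J d))
  have hJw := norm_nonneg (S.J (x - z))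
  have h11 : ‖S.J d‖ - ‖S.J (x - z)‖ ≤ ‖S.J (d - (x - z))‖ := by
    rw [map_sub S.J d]; exact norm_sub_norm_le _ _
  have h12 := mul_le_mul_of_nonneg_left h11 hs.le
  -- The left factor is `1 - 0.1084`, from the change of derivative; the right one is `1 + 0.0538`,
  -- from the Taylor remainder at `z`.
  have h13 : σ * (0.8916 * ‖S.J d‖) ≤ σ * (1.0538 * ‖S.J (x - z)‖) := by
    have : 0.1028 * (1 / 2 + 2 * 0.1028 / 9) * σ * ‖S.J (x - z)‖ ≤
        0.0538 * (σ * ‖S.J (x - z)‖) := by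
      have := mul_nonneg hs.le hJw
      nlinarith
    linarith
  have h14 := le_of_mul_le_mul_left h13 hs
  have h15 := mul_le_mul_of_nonneg_left h14 hν.le
  linarith

end Supports

end Toric

end

/-! ### Differential inequalities along the path of zeros and the condition length. -/

noncomputable section

namespace Toric

variable {n : ℕ}

/-- Integration of a differential inequality in which one factor is evaluated at the right
end-point. -/
theorem sub_le_integral_div {f s g : ℝ → ℝ} {a b : ℝ} (hab : a ≤ b)
    (hf : ContinuousOn f (Icc a b)) (hs : ContinuousOn s (Icc a b)) (hs0 : ∀ x ∈ Icc a b, 0 < s x)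
    (hg : ContinuousOn g (Icc a b))
    (h : ∀ x ∈ Icc a b, ∀ y ∈ Icc a b, x ≤ y → f y - f x ≤ (s y)⁻¹ * ∫ τ in x..y, g τ) :
    f b - f a ≤ ∫ τ in a..b, g τ / s τ := by
  have hk : ContinuousOn (fun τ => g τ / s τ) (Icc a b) := hg.div hs fun x hx => (hs0 x hx).ne'
  -- Continuous extension to the line makes the fundamental theorem of calculus available at the
  -- end-points.
  have ext : ∀ k : ℝ → ℝ, ContinuousOn k (Icc a b) → ∃ k2 : ℝ → ℝ, Continuous k2 ∧
      (∀ x ∈ Icc a b, k2 x = k x) ∧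
      ∀ x ∈ Icc a b, ∀ y ∈ Icc a b, x ≤ y → ∫ τ in x..y, k τ = ∫ τ in x..y, k2 τ := by
    intro k hk
    have he : ∀ x ∈ Icc a b, IccExtend hab ((Icc a b).domRestrict k) x = k x := fun x hx => by
      simp only [IccExtend_of_mem hab _ hx, domRestrict_apply]
    refine ⟨_, hk.domRestrict.Icc_extend' (h := hab), he, fun x hx y hy hxy => ?_⟩
    refine intervalIntegral.integral_congr fun τ hτ => (he τ ?_).symm
    rw [uIcc_of_le hxy] at hτ
    exact ⟨hx.1.trans hτ.1, hτ.2.trans hy.2⟩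
  obtain ⟨k2, hk2, hkk, hki⟩ := ext _ hk
  obtain ⟨g2, hg2, hgg, hgi⟩ := ext g hg
  have ha := left_mem_Icc.mpr hab
  have hb := right_mem_Icc.mpr hab
  rw [hki a ha b hb hab, sub_le_iff_le_add']
  -- As `y` decreases to `x`, the hypothesis bounds the right slopes of `f` by `s(y)⁻¹` times an
  -- average of `g`, which tends to `g(x)/s(x)`. It remains to compare with the primitive of `g/s`.
  refine image_le_of_liminf_slope_right_le_deriv_boundary (f := f)
    (B := fun t => f a + ∫ τ in a..t, k2 τ) (B' := k2) hf (by simp) ?_ ?_ ?_ hb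
  · exact fun x _ => ((hk2.integral_hasStrictDerivAt a x).hasDerivAt.const_add
      (f a)).continuousAt.continuousWithinAt
  · exact fun x _ => ((hk2.integral_hasStrictDerivAt a x).hasDerivAt.const_add
      (f a)).hasDerivWithinAt
  · intro x hx r hr
    have hxI : x ∈ Icc a b := Ico_subset_Icc_self hx
    have hI : Icc a b ∈ 𝓝[>] x := by
      filter_upwards [Ioo_mem_nhdsGT hx.2] with y hy
      exact ⟨hx.1.trans hy.1.le, hy.2.le⟩
    have h1 : Tendsto (fun y => slope (fun t => ∫ τ in x..t, g2 τ) x y) (𝓝[>] x) (𝓝 (g2 x)) :=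
      ((hasDerivAt_iff_tendsto_slope).mp (hg2.integral_hasStrictDerivAt x x).hasDerivAt).mono_left
        (nhdsWithin_mono x fun y hy => ne_of_gt hy)
    have h2 : Tendsto (fun y => (s y)⁻¹) (𝓝[>] x) (𝓝 (s x)⁻¹) :=
      ((hs x hxI).mono_left (nhdsWithin_le_of_mem hI)).inv₀ (hs0 x hxI).ne'
    have h3 := h2.mul h1
    have h4 : (s x)⁻¹ * g2 x = k2 x := by
      rw [hkk x hxI, hgg x hxI]; ring
    rw [h4] at h3
    refine Eventually.frequently ?_
    filter_upwards [h3.eventually (gt_mem_nhds hr), hI, self_mem_nhdsWithin] with y hy hyI hxy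
    refine lt_of_le_of_lt ?_ hy
    have hxy' : 0 < y - x := sub_pos.mpr hxy
    have h5 := h x hxI y hyI (le_of_lt hxy)
    rw [hgi x hxI y hyI (le_of_lt hxy)] at h5
    simp only [slope_def_field, intervalIntegral.integral_same, sub_zero]
    rw [mul_div_assoc', div_le_div_iff_of_pos_right hxy']
    exact h5

namespace Supports

variable {S : Supports n}

theorem contDiff_renorm {m : WithTop ℕ∞} :
    ContDiff ℂ m fun P : S.Sys × Pt n => S.renorm P.1 P.2 := by
  refine contDiff_pi.mpr fun i => contDiff_euclidean.mpr fun a => ?_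
  simp only [renorm_apply]
  have h1 : ContDiff ℂ m fun P : S.Sys × Pt n => P.1 i a :=
    ((EuclideanSpace.proj a : S.Coord i →L[ℂ] ℂ) ∘L
      (ContinuousLinearMap.proj i : S.Sys →L[ℂ] S.Coord i) ∘L
        ContinuousLinearMap.fst ℂ S.Sys (Pt n)).contDiff
  exact h1.mul ((contDiff_pairing (a : Fin n → ℝ)).comp contDiff_snd).cexp

theorem contDiff_F {m : WithTop ℕ∞} : ContDiff ℂ m fun P : S.Sys × Pt n => S.F P.1 P.2 := by
  refine contDiff_euclidean.mpr fun i => ?_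
  simp only [F_apply]
  refine ContDiff.sum fun a _ => ?_
  have h1 : ContDiff ℂ m fun P : S.Sys × Pt n => P.1 i a :=
    ((EuclideanSpace.proj a : S.Coord i →L[ℂ] ℂ) ∘L
      (ContinuousLinearMap.proj i : S.Sys →L[ℂ] S.Coord i) ∘L
        ContinuousLinearMap.fst ℂ S.Sys (Pt n)).contDiff
  exact h1.mul (contDiff_const.mul (contDiff_const.mul
    ((contDiff_pairing (a : Fin n → ℝ)).comp contDiff_snd).cexp))

theorem continuous_renorm : Continuous fun P : S.Sys × Pt n => S.renorm P.1 P.2 :=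
  (contDiff_renorm (m := 0)).continuous

/-- The paths `q` and `z` are of class `C¹` on an open set of times, and the zeros `z` are well
conditioned. -/
structure IsSmoothOn (q : EReal → S.Sys) (z : EReal → Pt n) (I : Set ℝ) : Prop where
  isOpen : IsOpen I
  path : ContDiffOn ℝ 1 (fun τ : ℝ => q τ) I
  zero : ContDiffOn ℝ 1 (fun τ : ℝ => z τ) I
  ne_zero : ∀ τ ∈ I, ∀ i, q (τ : EReal) i ≠ 0
  sig_pos : ∀ τ ∈ I, 0 < S.sig (q (τ : EReal)) (z (τ : EReal))

variable (S) in
/-- The speed of the renormalized path together with the speed of the path of zeros. -/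
def speed (q : EReal → S.Sys) (z : EReal → Pt n) (τ : ℝ) : ℝ :=
  S.fsNorm (S.renPath q z τ) (deriv (S.renPath q z) τ) +
    S.nuR * ‖S.J (deriv (fun σ : ℝ => z σ) τ)‖

namespace IsSmoothOn

variable {q : EReal → S.Sys} {z : EReal → Pt n} {I : Set ℝ}

theorem contDiffOn_renPath (h : S.IsSmoothOn q z I) : ContDiffOn ℝ 1 (S.renPath q z) I :=
  (contDiff_renorm.restrict_scalars ℝ).comp_contDiffOn (h.path.prodMk h.zero)

theorem renPath_ne_zero (h : S.IsSmoothOn q z I) : ∀ τ ∈ I, ∀ i, S.renPath q z τ i ≠ 0 :=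
  fun τ hτ i => S.renorm_ne_zero _ (h.ne_zero τ hτ i)

theorem hasDerivAt_renPath (h : S.IsSmoothOn q z I) {τ : ℝ} (hτ : τ ∈ I) :
    HasDerivAt (S.renPath q z) (deriv (S.renPath q z) τ) τ :=
  ((h.contDiffOn_renPath.differentiableOn one_ne_zero).differentiableAt
    (h.isOpen.mem_nhds hτ)).hasDerivAt

theorem hasDerivAt_zero (h : S.IsSmoothOn q z I) {τ : ℝ} (hτ : τ ∈ I) :
    HasDerivAt (fun σ : ℝ => z σ) (deriv (fun σ : ℝ => z σ) τ) τ :=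
  ((h.zero.differentiableOn one_ne_zero).differentiableAt (h.isOpen.mem_nhds hτ)).hasDerivAt

theorem continuousOn_deriv_renPath (h : S.IsSmoothOn q z I) :
    ContinuousOn (deriv (S.renPath q z)) I :=
  h.contDiffOn_renPath.continuousOn_deriv_of_isOpen h.isOpen le_rfl

theorem continuousOn_deriv_zero (h : S.IsSmoothOn q z I) :
    ContinuousOn (deriv fun σ : ℝ => z σ) I :=
  h.zero.continuousOn_deriv_of_isOpen h.isOpen le_rfl

theorem continuousOn_fs (h : S.IsSmoothOn q z I) :
    ContinuousOn (fun τ => S.fsNorm (S.renPath q z τ) (deriv (S.renPath q z) τ)) I :=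
  continuousOn_fsNorm h.contDiffOn_renPath.continuousOn h.continuousOn_deriv_renPath
    h.renPath_ne_zero

theorem continuousOn_zspeed (h : S.IsSmoothOn q z I) :
    ContinuousOn (fun τ => S.nuR * ‖S.J (deriv (fun σ : ℝ => z σ) τ)‖) I :=
  continuousOn_const.mul (S.J.continuous.comp_continuousOn h.continuousOn_deriv_zero).norm

theorem continuousOn_speed (h : S.IsSmoothOn q z I) : ContinuousOn (S.speed q z) I :=
  h.continuousOn_fs.add h.continuousOn_zspeed

theorem continuousOn_sig (hS : S.Centered) (h : S.IsSmoothOn q z I) :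
    ContinuousOn (fun τ : ℝ => S.sig (q τ) (z τ)) I := fun τ hτ =>
  (continuousAt_sigma hS (h.renPath_ne_zero τ hτ)).comp_continuousWithinAt
    (h.contDiffOn_renPath.continuousOn τ hτ)

theorem sig_sub_sig_le (hS : S.Centered) (h : S.IsSmoothOn q z I) {a b : ℝ} (hab : a ≤ b)
    (hI : Icc a b ⊆ I) : S.sig (q a) (z a) - S.sig (q b) (z b) ≤
      ∫ τ in a..b, S.fsNorm (S.renPath q z τ) (deriv (S.renPath q z) τ) := by
  have key := sigma_sub_le_integral hS hab (p := S.renPath q z) (p' := deriv (S.renPath q z))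
    (fun _ hτ => h.hasDerivAt_renPath (hI hτ))
    (h.continuousOn_deriv_renPath.mono hI) fun τ hτ => h.renPath_ne_zero τ (hI hτ)
  exact key

theorem norm_J_sub_le (h : S.IsSmoothOn q z I) {a b : ℝ} (hab : a ≤ b) (hI : Icc a b ⊆ I) :
    S.nuR * ‖S.J (z b - z a)‖ ≤
      ∫ τ in a..b, S.nuR * ‖S.J (deriv (fun σ : ℝ => z σ) τ)‖ := by
  have h1 : ∀ τ ∈ Icc a b, HasDerivAt (fun σ : ℝ => S.J (z σ))
      (S.J (deriv (fun σ : ℝ => z σ) τ)) τ := fun τ hτ =>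
    (S.J.restrictScalars ℝ).hasFDerivAt.comp_hasDerivAt τ (h.hasDerivAt_zero (hI hτ))
  have h2 := norm_sub_le_integral hab h1
    (S.J.continuous.comp_continuousOn (h.continuousOn_deriv_zero.mono hI)).norm
    fun τ _ => le_rfl
  rw [intervalIntegral.integral_const_mul, map_sub]
  exact mul_le_mul_of_nonneg_left h2 nuR_nonneg

theorem integral_fs_le (h : S.IsSmoothOn q z I) {a b : ℝ} (hab : a ≤ b) (hI : Icc a b ⊆ I) :
    ∫ τ in a..b, S.fsNorm (S.renPath q z τ) (deriv (S.renPath q z) τ) ≤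
      ∫ τ in a..b, S.speed q z τ := by
  refine intervalIntegral.integral_mono_on hab
    ((h.continuousOn_fs.mono hI).intervalIntegrable_of_Icc hab)
    ((h.continuousOn_speed.mono hI).intervalIntegrable_of_Icc hab) fun τ _ => ?_
  exact le_add_of_nonneg_right (mul_nonneg nuR_nonneg (norm_nonneg _))

/-- The inequality `log r ≤ r - 1` turns the bound on the decrease of `σ` into the hypothesis of
`sub_le_integral_div`. Finite condition length therefore keeps `σ` away from zero. -/
theorem log_sig_sub_le (hS : S.Centered) (h : S.IsSmoothOn q z I) {a b : ℝ} (hab : a ≤ b)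
    (hI : Icc a b ⊆ I) : Real.log (S.sig (q a) (z a)) - Real.log (S.sig (q b) (z b)) ≤
      ∫ τ in a..b, S.speed q z τ / S.sig (q τ) (z τ) := by
  have hσ := (h.continuousOn_sig hS).mono hI
  have key := sub_le_integral_div hab (f := fun τ : ℝ => -Real.log (S.sig (q τ) (z τ)))
    (s := fun τ : ℝ => S.sig (q τ) (z τ)) (g := S.speed q z)
    (hσ.log fun τ hτ => (h.sig_pos τ (hI hτ)).ne').neg hσ (fun τ hτ => h.sig_pos τ (hI hτ))
    (h.continuousOn_speed.mono hI) fun x hx y hy hxy => ?_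
  · linarith
  · have hsub : Icc x y ⊆ I := (Icc_subset_Icc hx.1 hy.2).trans hI
    have h1 := (h.sig_sub_sig_le hS hxy hsub).trans (h.integral_fs_le hxy hsub)
    have hx0 := h.sig_pos x (hI hx)
    have hy0 := h.sig_pos y (hI hy)
    have h2 := Real.log_le_sub_one_of_pos (div_pos hx0 hy0)
    rw [Real.log_div hx0.ne' hy0.ne'] at h2
    have h3 := mul_le_mul_of_nonneg_left h1 (inv_pos.mpr hy0).le
    have h4 : (S.sig (q y) (z y))⁻¹ * (S.sig (q x) (z x) - S.sig (q y) (z y)) =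
        S.sig (q x) (z x) / S.sig (q y) (z y) - 1 := by
      field_simp
    linarith

/-- The numerator grows at most at rate `ν‖ż‖₀`, and `σ` decreases at most at the Fubini-Study
speed. The assumption that the quotient is at most `1` keeps the second contribution from being
amplified, so both speeds enter with weight `1/σ`. -/
theorem tracking_sub_le (hS : S.Centered) (h : S.IsSmoothOn q z I) {a b : ℝ} (hab : a ≤ b)
    (hI : Icc a b ⊆ I) (x : Pt n)
    (hx : ∀ τ ∈ I, S.nuR * ‖S.J (z (τ : EReal) - x)‖ ≤ S.sig (q τ) (z τ)) :
    S.nuR * ‖S.J (z b - x)‖ / S.sig (q b) (z b) - S.nuR * ‖S.J (z a - x)‖ / S.sig (q a) (z a) ≤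
      ∫ τ in a..b, S.speed q z τ / S.sig (q τ) (z τ) := by
  have hσ := (h.continuousOn_sig hS).mono hI
  have hz : ContinuousOn (fun τ : ℝ => S.nuR * ‖S.J (z τ - x)‖) (Icc a b) :=
    continuousOn_const.mul (S.J.continuous.comp_continuousOn
      ((h.zero.continuousOn.mono hI).sub continuousOn_const)).norm
  refine sub_le_integral_div hab
    (f := fun τ : ℝ => S.nuR * ‖S.J (z τ - x)‖ / S.sig (q τ) (z τ))
    (s := fun τ : ℝ => S.sig (q τ) (z τ)) (g := S.speed q z)
    (hz.div hσ fun τ hτ => (h.sig_pos τ (hI hτ)).ne') hσ (fun τ hτ => h.sig_pos τ (hI hτ))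
    (h.continuousOn_speed.mono hI) fun c hc d hd hcd => ?_
  have hsub : Icc c d ⊆ I := (Icc_subset_Icc hc.1 hd.2).trans hI
  have h1 := h.sig_sub_sig_le hS hcd hsub
  have h2 := h.norm_J_sub_le hcd hsub
  have hc0 := h.sig_pos c (hI hc)
  have hd0 := h.sig_pos d (hI hd)
  have hint : ∫ τ in c..d, S.speed q z τ =
      (∫ τ in c..d, S.fsNorm (S.renPath q z τ) (deriv (S.renPath q z) τ)) +
        ∫ τ in c..d, S.nuR * ‖S.J (deriv (fun σ : ℝ => z σ) τ)‖ :=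
    intervalIntegral.integral_add ((h.continuousOn_fs.mono hsub).intervalIntegrable_of_Icc hcd)
      ((h.continuousOn_zspeed.mono hsub).intervalIntegrable_of_Icc hcd)
  have hfs : 0 ≤ ∫ τ in c..d, S.fsNorm (S.renPath q z τ) (deriv (S.renPath q z) τ) :=
    intervalIntegral.integral_nonneg hcd fun _ _ => fsNorm_nonneg _ _
  have h3 : ‖S.J (z d - x)‖ ≤ ‖S.J (z d - z c)‖ + ‖S.J (z c - x)‖ := by
    have : S.J (z d - x) = S.J (z d - z c) + S.J (z c - x) := by
      rw [← map_add, sub_add_sub_cancel]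
    rw [this]; exact norm_add_le _ _
  have h4 := mul_le_mul_of_nonneg_left h3 (nuR_nonneg (S := S))
  have h5 := hx c (hI hc)
  have hU0 : 0 ≤ S.nuR * ‖S.J (z c - x)‖ := mul_nonneg nuR_nonneg (norm_nonneg _)
  rw [hint, ← div_eq_inv_mul, div_sub_div _ _ hd0.ne' hc0.ne',
    div_le_div_iff₀ (mul_pos hd0 hc0) hd0]
  set A := S.nuR * ‖S.J (z c - x)‖
  set B := S.nuR * ‖S.J (z d - x)‖
  set sc := S.sig (q c) (z c)
  set sd := S.sig (q d) (z d)
  set X := ∫ τ in c..d, S.fsNorm (S.renPath q z τ) (deriv (S.renPath q z) τ)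
  set Y := ∫ τ in c..d, S.nuR * ‖S.J (deriv (fun σ : ℝ => z σ) τ)‖
  have h6 : B ≤ A + Y := by linarith
  have h7 : A * (sc - sd) ≤ sc * X := by
    calc A * (sc - sd) ≤ A * X := mul_le_mul_of_nonneg_left h1 hU0
      _ ≤ sc * X := mul_le_mul_of_nonneg_right h5 hfs
  have h8 : B * sc - sd * A ≤ (X + Y) * sc := by nlinarith
  calc (B * sc - sd * A) * sd ≤ (X + Y) * sc * sd := mul_le_mul_of_nonneg_right h8 hd0.le
    _ = (X + Y) * (sd * sc) := by ring

/-- Where the paths are smooth, `μ = 1/σ` and the extended integrand is an ordinary continuous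
function. Strict inequalities allow infinite end-points `s` and `s'`. -/
theorem ofReal_integral_le_condLength (hS : S.Centered) (h : S.IsSmoothOn q z I) {a b : ℝ}
    (hab : a ≤ b) (hI : Icc a b ⊆ I) {s s' : EReal} (hsa : s < a) (hbs : (b : EReal) < s') :
    ENNReal.ofReal (∫ τ in a..b, S.speed q z τ / S.sig (q τ) (z τ)) ≤ S.condLength q z s s' := by
  have hcont : ContinuousOn (fun τ : ℝ => S.speed q z τ / S.sig (q τ) (z τ)) (Icc a b) :=
    (h.continuousOn_speed.mono hI).div ((h.continuousOn_sig hS).mono hI)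
      fun τ hτ => (h.sig_pos τ (hI hτ)).ne'
  have hsp : ∀ τ, 0 ≤ S.speed q z τ := fun τ =>
    add_nonneg (fsNorm_nonneg _ _) (mul_nonneg nuR_nonneg (norm_nonneg _))
  have hint : IntegrableOn (fun τ : ℝ => S.speed q z τ / S.sig (q τ) (z τ)) (Ioc a b) :=
    (hcont.integrableOn_Icc).mono_set Ioc_subset_Icc_self
  rw [intervalIntegral.integral_of_le hab, ofReal_integral_eq_lintegral_ofReal hint
    (Eventually.of_forall fun τ => div_nonneg (hsp τ) (sig_nonneg _ _))]
  have hsubset : Ioc a b ⊆ {τ : ℝ | s < (τ : EReal) ∧ (τ : EReal) < s'} := fun τ hτ =>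
    ⟨hsa.trans (by exact_mod_cast hτ.1), lt_of_le_of_lt (by exact_mod_cast hτ.2) hbs⟩
  refine le_trans (le_of_eq ?_) (lintegral_mono_set hsubset)
  refine setLIntegral_congr_fun measurableSet_Ioc fun τ hτ => ?_
  have hτI : τ ∈ I := hI (Ioc_subset_Icc_self hτ)
  have hpos := h.sig_pos τ hτI
  simp only [renPath]
  rw [mu_renorm_eq hS (h.ne_zero τ hτI), toricNorm_eq, nu_eq hS.momentum_zero,
    ← ENNReal.ofReal_mul nuR_nonneg, ← ENNReal.ofReal_add (fsNorm_nonneg _ _)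
      (mul_nonneg nuR_nonneg (norm_nonneg _)), ← ENNReal.ofReal_inv_of_pos hpos]
  change _ = ENNReal.ofReal (S.speed q z τ) * _
  rw [← ENNReal.ofReal_mul (hsp τ), div_eq_mul_inv]

end IsSmoothOn

theorem condLength_mono (q : EReal → S.Sys) (z : EReal → Pt n) {s s' r r' : EReal} (h : r ≤ s)
    (h' : s' ≤ r') : S.condLength q z s s' ≤ S.condLength q z r r' :=
  lintegral_mono_set fun _ hτ => ⟨h.trans_lt hτ.1, hτ.2.trans_le h'⟩

theorem condLength_add_le (q : EReal → S.Sys) (z : EReal → Pt n) {a b c : EReal} (hab : a ≤ b)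
    (hbc : b ≤ c) : S.condLength q z a b + S.condLength q z b c ≤ S.condLength q z a c := by
  unfold condLength
  have hm : MeasurableSet {τ : ℝ | b < (τ : EReal) ∧ (τ : EReal) < c} :=
    (measurableSet_lt measurable_const measurable_coe_real_ereal).inter
      (measurableSet_lt measurable_coe_real_ereal measurable_const)
  rw [← lintegral_union hm]
  · refine lintegral_mono_set ?_
    rintro τ (hτ | hτ)
    · exact ⟨hτ.1, hτ.2.trans_le hbc⟩
    · exact ⟨hab.trans_lt hτ.1, hτ.2⟩
  · exact disjoint_left.mpr fun τ h1 h2 => absurd h1.2 (not_lt.mpr h2.1.le)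

end Supports

end Toric

end

/-! ### Continuity in the product of projective spaces, limits of certificates, smoothness of zeros.
-/

noncomputable section

namespace Toric

variable {n : ℕ}

namespace Supports

variable {S : Supports n}

/-- The projection onto `g^⊥` kills every `c g` and does not increase norms, so the orthogonal
projection onto the line attains the infimum. -/
theorem norm_sub_proj_le_projDist (i : Fin n) {f g : S.Coord i} (hf : f ≠ 0) :
    ‖f - (inner ℂ g f / ((‖g‖ : ℂ) ^ 2)) • g‖ ≤ S.projDist i f g * ‖f‖ := by
  have hfpos : 0 < ‖f‖ := norm_pos_iff.mpr hf
  rw [← div_le_iff₀ hfpos]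
  refine le_ciInf fun c => div_le_div_of_nonneg_right ?_ hfpos.le
  have hg : (Submodule.span ℂ {g})ᗮ.starProjection g = 0 := by
    rw [Submodule.starProjection_orthogonal_val, sub_eq_zero]
    exact (Submodule.starProjection_eq_self_iff.mpr (Submodule.mem_span_singleton_self g)).symm
  have h : (Submodule.span ℂ {g})ᗮ.starProjection (f - c • g) =
      f - (inner ℂ g f / ((‖g‖ : ℂ) ^ 2)) • g := by
    rw [map_sub, map_smul, hg, smul_zero, sub_zero, starProjection_orthogonal_singleton]
  rw [← h]
  exact Submodule.norm_starProjection_apply_le _ _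

/-- A path converging in the product of the projective spaces has rescalings that converge in the
linear space. -/
theorem exists_scale_tendsto {q : EReal → S.Sys} {t₀ T : EReal} (hq : S.IsC1Path q t₀ T)
    {t : EReal} (ht : t ∈ Icc t₀ T) : ∃ c : EReal → Fin n → ℂ, (∀ s i, c s i ≠ 0) ∧
      Tendsto (fun s => S.scale (c s) (q s)) (𝓝[Icc t₀ T] t) (𝓝 (q t)) := by
  let c0 : EReal → Fin n → ℂ := fun s i => inner ℂ (q s i) (q t i) / ((‖q s i‖ : ℂ) ^ 2)
  -- The coefficient is that of the projection onto the line of `q_s`. The default `1` keeps it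
  -- nonzero and is not used near `t`, where the projective distance is below `1`.
  refine ⟨fun s i => if c0 s i = 0 then 1 else c0 s i, fun s i => ?_, ?_⟩
  · dsimp only
    split_ifs with h
    · exact one_ne_zero
    · exact h
  · refine tendsto_pi_nhds.mpr fun i => ?_
    have hti := hq.ne_zero t ht i
    have hpos : 0 < ‖q t i‖ := norm_pos_iff.mpr hti
    have hlim := hq.tendsto t ht i
    have hlim2 : Tendsto (fun s => S.projDist i (q t i) (q s i) * ‖q t i‖) (𝓝[Icc t₀ T] t)
        (𝓝 0) := by simpa using hlim.mul_const ‖q t i‖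
    refine tendsto_iff_norm_sub_tendsto_zero.mpr
      (squeeze_zero' (Eventually.of_forall fun _ => norm_nonneg _) ?_ hlim2)
    filter_upwards [hlim.eventually (gt_mem_nhds one_pos)] with s hs
    have h1 := norm_sub_proj_le_projDist (S := S) i (g := q s i) hti
    have hc : c0 s i ≠ 0 := by
      intro h0
      simp only [c0] at h0
      rw [h0, zero_smul, sub_zero] at h1
      have := mul_lt_of_lt_one_left hpos hs
      linarith
    simp only [scale, if_neg hc]
    rw [norm_sub_rev]
    exact h1

theorem scale_ne_zero {c : Fin n → ℂ} (hc : ∀ i, c i ≠ 0) {f : S.Sys} (hf : ∀ i, f i ≠ 0) :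
    ∀ i, S.scale c f i ≠ 0 := fun i => smul_ne_zero (hc i) (hf i)

/-- Rescaling rows changes neither the Newton increment nor `σ`. Projective convergence of the path
is therefore enough, also at infinite times. -/
theorem certificate_scale (hS : S.Centered) {c : Fin n → ℂ} (hc : ∀ i, c i ≠ 0) {f : S.Sys}
    (hf : ∀ i, f i ≠ 0) (x : Pt n) : S.certificate (S.scale c f) x = S.certificate f x := by
  have hcf := scale_ne_zero hc hf
  have hsig := sig_scale hc f x
  rcases (sig_nonneg f x).eq_or_lt with h | h
  · rw [certificate_eq_top hS hf h.symm, certificate_eq_top hS hcf (hsig.trans h.symm)]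
  · have h' : 0 < S.sig (S.scale c f) x := by rw [hsig]; exact h
    have hstep : S.step (S.scale c f) x = S.step f x := by
      refine inverse_apply_eq ((sig_pos_iff hS hcf x).mp h') ?_
      ext i
      rw [renorm_scale, condMat_scale, condMat_step hS hf h, F_scale]
    rw [certificate_eq hS hf h, certificate_eq hS hcf h', hstep, hsig]

theorem F_scale_eq_zero {c : Fin n → ℂ} {f : S.Sys} {x : Pt n} (h : S.F f x = 0) :
    S.F (S.scale c f) x = 0 := by
  ext i
  rw [F_scale, h]
  simp

theorem continuous_condMat : Continuous fun f : S.Sys => S.condMat f 0 := by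
  let L : S.Sys →ₗ[ℂ] (Pt n →L[ℂ] Pt n) :=
    { toFun := fun f => S.condMat f 0
      map_add' := fun f g => by
        ext v i
        simp [condMat_apply, coupling_apply, add_mul, Finset.sum_add_distrib]
      map_smul' := fun c f => by
        ext v i
        simp [condMat_apply, coupling_apply, Finset.mul_sum, mul_assoc] }
  exact L.continuous_of_finiteDimensional

theorem continuous_renorm_left (x : Pt n) : Continuous fun f : S.Sys => S.renorm f x :=
  continuous_renorm.comp (continuous_id.prodMk continuous_const)

theorem continuous_F_left (x : Pt n) : Continuous fun f : S.Sys => S.F f x :=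
  (contDiff_F (m := 0)).continuous.comp (continuous_id.prodMk continuous_const)

theorem continuousAt_sig (hS : S.Centered) {f : S.Sys} (hf : ∀ i, f i ≠ 0) (x : Pt n) :
    ContinuousAt (fun P : S.Sys × Pt n => S.sig P.1 P.2) (f, x) :=
  ContinuousAt.comp (f := fun P : S.Sys × Pt n => S.renorm P.1 P.2)
    (continuousAt_sigma hS fun i => S.renorm_ne_zero x (hf i)) continuous_renorm.continuousAt

theorem continuousAt_sig_left (hS : S.Centered) {f : S.Sys} (hf : ∀ i, f i ≠ 0) (x : Pt n) :
    ContinuousAt (fun g : S.Sys => S.sig g x) f :=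
  ContinuousAt.comp (f := fun g : S.Sys => S.renorm g x)
    (continuousAt_sigma hS fun i => S.renorm_ne_zero x (hf i))
    (continuous_renorm_left x).continuousAt

theorem continuousAt_step (hS : S.Centered) {f : S.Sys} (hf : ∀ i, f i ≠ 0) {x : Pt n}
    (h : 0 < S.sig f x) : ContinuousAt (fun g : S.Sys => S.step g x) f := by
  obtain ⟨U, hU⟩ := (sig_pos_iff hS hf x).mp h
  have h1 : ContinuousAt (fun g : S.Sys => S.condMat (S.renorm g x) 0) f :=
    (continuous_condMat.comp (continuous_renorm_left x)).continuousAt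
  have h2 : ContinuousAt Ring.inverse (S.condMat (S.renorm f x) 0) := by
    rw [← hU]; exact NormedRing.inverse_continuousAt U
  have h3 : ContinuousAt (fun g : S.Sys => Ring.inverse (S.condMat (S.renorm g x) 0)) f :=
    ContinuousAt.comp (f := fun g : S.Sys => S.condMat (S.renorm g x) 0) h2 h1
  exact h3.clm_apply (continuous_F_left x).continuousAt

theorem eventually_ne_zero {f : S.Sys} (hf : ∀ i, f i ≠ 0) : ∀ᶠ g in 𝓝 f, ∀ i, g i ≠ 0 :=
  eventually_all.mpr fun i => (continuous_apply i).continuousAt.eventually_ne (hf i)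

theorem continuousAt_certificate (hS : S.Centered) {f : S.Sys} (hf : ∀ i, f i ≠ 0) {x : Pt n}
    (h : 0 < S.sig f x) : ContinuousAt (fun g : S.Sys => S.certificate g x) f := by
  have hsig := continuousAt_sig_left hS hf x
  have h1 : ContinuousAt (fun g : S.Sys =>
      ENNReal.ofReal (S.nuR * ‖S.J (S.step g x)‖ / (2 * S.sig g x))) f := by
    refine ENNReal.continuous_ofReal.continuousAt.comp (ContinuousAt.div ?_ ?_ (by positivity))
    · exact continuousAt_const.mul
        (S.J.continuous.continuousAt.comp (continuousAt_step hS hf h)).norm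
    · exact continuousAt_const.mul hsig
  refine h1.congr ?_
  filter_upwards [eventually_ne_zero hf, hsig.eventually (lt_mem_nhds h)] with g hg hg2
  exact (certificate_eq hS hg hg2).symm

theorem continuousAt_wnorm_F {f : S.Sys} (hf : ∀ i, f i ≠ 0) (x y : Pt n) :
    ContinuousAt (fun g : S.Sys => S.wnorm (S.renorm g x) (S.F g y)) f := by
  refine ContinuousAt.norm ((PiLp.continuous_toLp 2 _).continuousAt.comp
    (continuousAt_pi.mpr fun i => ContinuousAt.mul (ContinuousAt.inv₀ ?_ ?_) ?_))
  · exact Complex.continuous_ofReal.continuousAt.comp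
      ((continuous_apply i).comp (continuous_renorm_left x)).continuousAt.norm
  · exact_mod_cast norm_ne_zero_iff.mpr (S.renorm_ne_zero x (hf i))
  · exact ((EuclideanSpace.proj i : Pt n →L[ℂ] ℂ).continuous.comp
      (continuous_F_left y)).continuousAt

section Path

variable {q : EReal → S.Sys} {t₀ T : EReal}

theorem continuousWithinAt_certificate (hS : S.Centered) (hq : S.IsC1Path q t₀ T) {t : EReal}
    (ht : t ∈ Icc t₀ T) {x : Pt n} (h : 0 < S.sig (q t) x) :
    ContinuousWithinAt (fun s => S.certificate (q s) x) (Icc t₀ T) t := by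
  obtain ⟨c, hc, hlim⟩ := exists_scale_tendsto hq ht
  have h1 := (continuousAt_certificate hS (hq.ne_zero t ht) h).tendsto.comp hlim
  refine h1.congr' ?_
  filter_upwards [self_mem_nhdsWithin] with s hs
  exact certificate_scale hS (hc s) (hq.ne_zero s hs) x

theorem tendsto_sig (hS : S.Centered) (hq : S.IsC1Path q t₀ T) {t : EReal}
    (ht : t ∈ Icc t₀ T) {l : Filter EReal} (hl : l ≤ 𝓝[Icc t₀ T] t) {z : EReal → Pt n} {y : Pt n}
    (hz : Tendsto z l (𝓝 y)) : Tendsto (fun s => S.sig (q s) (z s)) l (𝓝 (S.sig (q t) y)) := by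
  obtain ⟨c, hc, hlim⟩ := exists_scale_tendsto hq ht
  have h1 := (continuousAt_sig hS (hq.ne_zero t ht) y).tendsto.comp
    ((hlim.mono_left hl).prodMk_nhds hz)
  exact h1.congr fun s => sig_scale (hc s) (q s) (z s)

/-- A limit of certified points is certified, or it is a zero. -/
theorem certificate_limit (hS : S.Centered) (hq : S.IsC1Path q t₀ T) {t : EReal}
    (ht : t ∈ Icc t₀ T) {l : Filter EReal} [l.NeBot] (hl : l ≤ 𝓝[Icc t₀ T] t) {x : Pt n} {α : ℝ}
    (hα : 0 ≤ α) (h : ∀ᶠ s in l, S.certificate (q s) x ≤ ENNReal.ofReal α) :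
    (0 < S.sig (q t) x ∧ S.certificate (q t) x ≤ ENNReal.ofReal α) ∨
      (S.sig (q t) x = 0 ∧ S.F (q t) x = 0) := by
  rcases (sig_nonneg (q t) x).eq_or_lt with h0 | h0
  · refine Or.inr ⟨h0.symm, ?_⟩
    obtain ⟨c, hc, hlim⟩ := exists_scale_tendsto hq ht
    have hν := nuR_pos hS
    have hIcc : ∀ᶠ s in l, s ∈ Icc t₀ T := hl self_mem_nhdsWithin
    have hsig := tendsto_sig hS hq ht hl (tendsto_const_nhds (x := x))
    rw [← h0] at hsig
    have h1 : Tendsto (fun s => 2 * α * S.sig (q s) x / S.nuR) l (𝓝 0) := by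
      simpa using (hsig.const_mul (2 * α)).div_const S.nuR
    have h2 := (continuousAt_wnorm_F (hq.ne_zero t ht) x x).tendsto.comp (hlim.mono_left hl)
    -- Since `M` has norm at most `1`, `F = M · step` is bounded by `‖step‖₀ ≤ 2ασ/ν`, which tends
    -- to `0` with `σ`.
    have h3 : S.wnorm (S.renorm (q t) x) (S.F (q t) x) ≤ 0 := by
      refine le_of_tendsto_of_tendsto h2 h1 ?_
      filter_upwards [h, hIcc] with s hs hsI
      have hsne := hq.ne_zero s hsI
      rw [← certificate_scale hS (hc s) hsne,
        certificate_le_iff hS (scale_ne_zero (hc s) hsne) hα] at hs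
      obtain ⟨hs1, hs2⟩ := hs
      have h4 := wnorm_condMat_le (S.renorm (S.scale (c s) (q s)) x)
        (S.step (S.scale (c s) (q s)) x)
      rw [condMat_step hS (scale_ne_zero (hc s) hsne) hs1] at h4
      refine h4.trans ?_
      rw [le_div_iff₀ hν, mul_comm, ← sig_scale (hc s) (q s) x]
      exact hs2
    exact (wnorm_eq_zero_iff fun i => S.renorm_ne_zero x (hq.ne_zero t ht i)).mp
      (le_antisymm h3 (wnorm_nonneg _ _))
  · refine Or.inl ⟨h0, ?_⟩
    exact le_of_tendsto ((continuousWithinAt_certificate hS hq ht h0).mono_left hl) h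

/-- Continuity of the zeros attached to a fixed point. -/
theorem tendsto_zero (hS : S.Centered) (hq : S.IsC1Path q t₀ T) {t : EReal}
    (ht : t ∈ Icc t₀ T) {l : Filter EReal} (hl : l ≤ 𝓝[Icc t₀ T] t) {x : Pt n}
    {z : EReal → Pt n} (hpos : 0 < S.sig (q t) x) (hFt : S.F (q t) (z t) = 0)
    (hzt : S.nuR * ‖S.J (z t - x)‖ ≤ 0.18 * S.sig (q t) x)
    (hF : ∀ᶠ s in l, S.F (q s) (z s) = 0)
    (hz : ∀ᶠ s in l, S.nuR * ‖S.J (z s - x)‖ ≤ 0.18 * S.sig (q s) x) :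
    Tendsto z l (𝓝 (z t)) := by
  obtain ⟨c, hc, hlim⟩ := exists_scale_tendsto hq ht
  obtain ⟨C, hC, hCJ⟩ := exists_norm_le_J hS
  have hsig := tendsto_sig hS hq ht hl (tendsto_const_nhds (x := x))
  have hw := (continuousAt_wnorm_F (hq.ne_zero t ht) x (z t)).tendsto.comp (hlim.mono_left hl)
  rw [hFt, wnorm_zero] at hw
  have hb : Tendsto (fun s => C * (S.wnorm (S.renorm (S.scale (c s) (q s)) x)
      (S.F (S.scale (c s) (q s)) (z t)) / (0.17 * S.sig (q s) x))) l (𝓝 0) := by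
    have := (hw.div (hsig.const_mul 0.17) (mul_pos (by norm_num) hpos).ne').const_mul C
    simpa using this
  refine tendsto_iff_norm_sub_tendsto_zero.mpr
    (squeeze_zero' (Eventually.of_forall fun _ => norm_nonneg _) ?_ hb)
  -- Losing at most half of `σ` turns the bound `0.18 σ` for `z t` into at most `0.36 σ` at time
  -- `s`, within the stability radius `0.6 σ`.
  have hev : ∀ᶠ s in l, 0.5 * S.sig (q t) x < S.sig (q s) x :=
    hsig.eventually (lt_mem_nhds (by linarith))
  filter_upwards [hF, hz, hev, hl self_mem_nhdsWithin] with s hFs hzs hs hsI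
  have hspos : 0 < S.sig (q s) x := by linarith
  rw [norm_sub_rev]
  refine (hCJ _).trans (mul_le_mul_of_nonneg_left ?_ hC.le)
  rw [le_div_iff₀ (mul_pos (by norm_num) hspos)]
  have key := sig_mul_dist_zero_le hS (f := S.scale (c s) (q s)) (x := x) (y := z t) (z := z s)
    (by rw [sig_scale (hc s)]; linarith) (by rw [sig_scale (hc s)]; linarith)
    (F_scale_eq_zero hFs)
  rw [sig_scale (hc s)] at key
  linarith

/-- Renormalization translates `x` to the origin, where the derivative is the operator `M`. -/
theorem hasFDerivAt_F (hS : S.Centered) (f : S.Sys) (x : Pt n) :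
    HasFDerivAt (S.F f) (S.condMat (S.renorm f x) 0) x := by
  have h1 : Differentiable ℂ (S.F f) :=
    ((contDiff_F (S := S) (m := 1)).comp (contDiff_prodMk_right f)).differentiable one_ne_zero
  have h2 : fderiv ℂ (fun w => S.F f (x + w)) 0 = S.condMat (S.renorm f x) 0 := by
    rw [← fderiv_localFun hS.momentum_zero]
    congr 1
    funext w
    exact (S.localFun_renorm f x w).symm
  rw [← h2, fderiv_comp_add_left, add_zero]
  exact (h1 x).hasFDerivAt

/-- A continuous path of nondegenerate zeros of a `C¹` path is `C¹`. -/
theorem contDiffOn_zero (hS : S.Centered) {p : ℝ → S.Sys} {y : ℝ → Pt n} {s : Set ℝ}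
    (hp : ContDiffOn ℝ 1 p s) (hy : ContinuousOn y s) (h0 : ∀ τ ∈ s, ∀ i, p τ i ≠ 0)
    (hF : ∀ τ ∈ s, S.F (p τ) (y τ) = 0) (hsig : ∀ τ ∈ s, 0 < S.sig (p τ) (y τ)) :
    ContDiffOn ℝ 1 y s := by
  intro τ hτ
  have cdf : ContDiffAt ℂ 1 (fun P : S.Sys × Pt n => S.F P.1 P.2) (p τ, y τ) :=
    contDiff_F.contDiffAt
  have hd := (cdf.differentiableAt one_ne_zero).hasFDerivAt
  have hinr : fderiv ℂ (fun P : S.Sys × Pt n => S.F P.1 P.2) (p τ, y τ) ∘L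
      ContinuousLinearMap.inr ℂ S.Sys (Pt n) = S.condMat (S.renorm (p τ) (y τ)) 0 :=
    HasFDerivAt.unique (hd.comp (y τ) (hasFDerivAt_prodMk_right (p τ) (y τ)))
      (hasFDerivAt_F hS (p τ) (y τ))
  have hinv : (fderiv ℂ (fun P : S.Sys × Pt n => S.F P.1 P.2) (p τ, y τ) ∘L
      ContinuousLinearMap.inr ℂ S.Sys (Pt n)).IsInvertible := by
    rw [hinr]
    obtain ⟨U, hU⟩ := (sig_pos_iff hS (h0 τ hτ) (y τ)).mp (hsig τ hτ)
    exact ⟨ContinuousLinearEquiv.unitsEquiv ℂ (Pt n) U, by rw [← hU]; rfl⟩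
  have hφ := cdf.contDiffAt_implicitFunction one_ne_zero hinv
  have hφ' : ContDiffWithinAt ℝ 1 (fun σ => cdf.implicitFunction one_ne_zero hinv (p σ)) s τ :=
    (hφ.restrict_scalars ℝ).comp_contDiffWithinAt τ (hp τ hτ)
  have hev := cdf.eventually_apply_eq_iff_implicitFunction one_ne_zero hinv
  have hcont : Tendsto (fun σ => (p σ, y σ)) (𝓝[s] τ) (𝓝 (p τ, y τ)) :=
    (hp.continuousOn τ hτ).prodMk_nhds (hy τ hτ)
  -- Continuity keeps `(p, y)` in the neighbourhood where the implicit function is the only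
  -- solution.
  have heq : ∀ᶠ σ in 𝓝[s] τ, y σ = cdf.implicitFunction one_ne_zero hinv (p σ) := by
    filter_upwards [hcont.eventually hev, self_mem_nhdsWithin] with σ hσ hσs
    exact (hσ.mp (by rw [hF σ hσs, hF τ hτ])).symm
  exact hφ'.congr_of_eventuallyEq heq (heq.self_of_nhdsWithin hτ)

end Path

end Supports

end Toric

end

/-! ### The homotopy recurrence: path of zeros, cost of a step, number of steps. -/

noncomputable section

namespace Toric

variable {n : ℕ}

namespace Supports

variable {S : Supports n}

theorem certificate_newtonStep_le (hS : S.Centered) {f : S.Sys} (hf : ∀ i, f i ≠ 0) {x : Pt n}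
    (h : S.certificate f x ≤ ENNReal.ofReal 0.0747) :
    S.certificate f (S.newtonStep f x) ≤ ENNReal.ofReal 0.0085 := by
  obtain ⟨h1, h2⟩ := (certificate_le_iff hS hf (by norm_num)).mp h
  rw [newtonStep_eq hS hf h1]
  exact (certificate_le_iff hS hf (by norm_num)).mpr (newton_certificate hS hf h1 h2)

variable (S) in
/-- The point `z` is a zero of `f` close to `x`. -/
def IsZeroNear (f : S.Sys) (x z : Pt n) : Prop :=
  S.F f z = 0 ∧ S.nuR * ‖S.J (z - x)‖ ≤ 0.18 * S.sig f x

theorem exists_isZeroNear (hS : S.Centered) {f : S.Sys} (hf : ∀ i, f i ≠ 0) {x : Pt n}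
    (h : S.certificate f x ≤ ENNReal.ofReal 0.0747) : ∃ z, S.IsZeroNear f x z := by
  obtain ⟨h1, h2⟩ := (certificate_le_iff hS hf (by norm_num)).mp h
  -- The value `u = 0.09` satisfies the invariance inequality for `a = 0.0747`, whence the radius
  -- `0.18 = 2u` of `IsZeroNear`.
  obtain ⟨z, hz, hd⟩ := exists_zero hS hf (u := 0.09) h1 h2 (by norm_num) (by norm_num)
    (by norm_num)
  exact ⟨z, hz, by linarith⟩

namespace IsZeroNear

variable {f : S.Sys} {x z w : Pt n}

theorem unique (hS : S.Centered) (hs : 0 < S.sig f x) (hz : S.IsZeroNear f x z)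
    (hw : S.IsZeroNear f x w) : z = w :=
  zero_unique hS hs (by linarith [hz.2]) (by linarith [hw.2]) hz.1 hw.1

theorem le_sig (hS : S.Centered) (hf : ∀ i, f i ≠ 0) (hz : S.IsZeroNear f x z) :
    0.82 * S.sig f x ≤ S.sig f z := by
  linarith [sig_sub_le' hS hf x z, hz.2]

theorem sig_le (hS : S.Centered) (hf : ∀ i, f i ≠ 0) (hz : S.IsZeroNear f x z) :
    S.sig f z ≤ 1.18 * S.sig f x := by
  linarith [sig_le_sig_add hS hf x z, hz.2]

/-- With a smaller certificate, the nearby zero is closer. -/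
theorem dist_le (hS : S.Centered) (hf : ∀ i, f i ≠ 0)
    (h : S.certificate f x ≤ ENNReal.ofReal 0.0085) (hz : S.IsZeroNear f x z) :
    S.nuR * ‖S.J (z - x)‖ ≤ 0.0172 * S.sig f x := by
  obtain ⟨h1, h2⟩ := (certificate_le_iff hS hf (by norm_num)).mp h
  obtain ⟨w, hw, hd⟩ := exists_zero hS hf (u := 0.0086) h1 h2 (by norm_num) (by norm_num)
    (by norm_num)
  have : z = w := hz.unique hS h1 ⟨hw, by linarith⟩
  rw [this]
  linarith

/-- The zero near a point is also the zero near its Newton iterate. -/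
theorem newtonStep (hS : S.Centered) (hf : ∀ i, f i ≠ 0)
    (h : S.certificate f x ≤ ENNReal.ofReal 0.0747) (hz : S.IsZeroNear f x z) :
    S.IsZeroNear f (S.newtonStep f x) z := by
  obtain ⟨h1, h2⟩ := (certificate_le_iff hS hf (by norm_num)).mp h
  have h3 := certificate_newtonStep_le hS hf h
  obtain ⟨w, hw⟩ := exists_isZeroNear hS hf (h3.trans (ENNReal.ofReal_le_ofReal (by norm_num)))
  have h4 := hw.dist_le hS hf h3
  have hstep := newtonStep_eq hS hf h1
  rw [hstep] at h4
  have h5 := sig_le_sig_add hS hf x (x - S.step f x)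
  have e : x - S.step f x - x = -S.step f x := by abel
  rw [e, map_neg, norm_neg] at h5
  have h6 : ‖S.J (w - x)‖ ≤ ‖S.J (w - (x - S.step f x))‖ + ‖S.J (S.step f x)‖ := by
    have : S.J (w - x) = S.J (w - (x - S.step f x)) - S.J (S.step f x) := by
      rw [← map_sub]; congr 1; abel
    rw [this]
    exact norm_sub_le _ _
  have h7 := mul_le_mul_of_nonneg_left h6 (nuR_nonneg (S := S))
  -- The distance from `w` to `x` is at most `0.0172 · 1.1494 + 0.1494 < 0.18`, in units of
  -- `σ(x)/ν`.
  have : z = w := hz.unique hS h1 ⟨hw.1, by linarith⟩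
  rw [this]
  exact hw

theorem tracking_le (hS : S.Centered) (hf : ∀ i, f i ≠ 0) (hs : 0 < S.sig f x)
    (hz : S.IsZeroNear f x z) {u : ℝ} (hu : 0.11 ≤ u) : S.tracking f z x ≤ ENNReal.ofReal u := by
  have h1 := hz.le_sig hS hf
  have hpos : 0 < S.sig f z := by linarith
  rw [tracking, mu_renorm_eq hS hf, toricNorm_eq, nu_eq hS.momentum_zero,
    ← ENNReal.ofReal_inv_of_pos hpos]
  have e : (1 / 2 : ℝ≥0∞) = ENNReal.ofReal (1 / 2) := by
    rw [ENNReal.ofReal_div_of_pos (by norm_num)]; simp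
  have hinv := (inv_pos.mpr hpos).le
  have hn := norm_nonneg (S.J (z - x))
  rw [e, ← ENNReal.ofReal_mul (by norm_num), ← ENNReal.ofReal_mul (by linarith),
    ← ENNReal.ofReal_mul (mul_nonneg (by linarith) hinv)]
  refine ENNReal.ofReal_le_ofReal ?_
  have h2 := hz.2
  calc 1 / 2 * ‖S.J (z - x)‖ * (S.sig f z)⁻¹ * S.nuR
      = (1 / 2 * (S.nuR * ‖S.J (z - x)‖)) / S.sig f z := by ring
    -- Indeed `½ · 0.18 / 0.82 < 0.11`.
    _ ≤ 0.11 := by rw [div_le_iff₀ hpos]; linarith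
    _ ≤ u := hu

end IsZeroNear

section Homotopy

variable {q : EReal → S.Sys} {t₀ T : EReal} {x₀ : Pt n} {α : ℝ}

theorem time_succ (j : ℕ) : S.time α q t₀ T x₀ (j + 1) = min T (sInf {t : EReal |
    S.time α q t₀ T x₀ j < t ∧ t ≤ T ∧
      ENNReal.ofReal α ≤ S.certificate (q t) (S.point α q t₀ T x₀ (j + 1))}) := rfl

theorem point_succ (j : ℕ) : S.point α q t₀ T x₀ (j + 1) =
    S.newtonStep (q (S.time α q t₀ T x₀ j)) (S.point α q t₀ T x₀ j) := rfl

theorem time_le (h : t₀ < T) (j : ℕ) : S.time α q t₀ T x₀ j ≤ T := by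
  cases j with
  | zero => exact h.le
  | succ j => exact min_le_left _ _

theorem time_le_succ (h : t₀ < T) (j : ℕ) :
    S.time α q t₀ T x₀ j ≤ S.time α q t₀ T x₀ (j + 1) := by
  rw [time_succ]
  exact le_min (time_le h j) (le_sInf fun t ht => ht.1.le)

theorem time_mono (h : t₀ < T) : Monotone (S.time α q t₀ T x₀) :=
  monotone_nat_of_le_succ (time_le_succ h)

theorem le_time (h : t₀ < T) (j : ℕ) : t₀ ≤ S.time α q t₀ T x₀ j := time_mono h (Nat.zero_le j)

theorem time_mem (h : t₀ < T) (j : ℕ) : S.time α q t₀ T x₀ j ∈ Icc t₀ T :=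
  ⟨le_time h j, time_le h j⟩

theorem certificate_lt_of_lt_time_succ (h : t₀ < T) {j : ℕ} {s : EReal}
    (h1 : S.time α q t₀ T x₀ j < s) (h2 : s < S.time α q t₀ T x₀ (j + 1)) :
    S.certificate (q s) (S.point α q t₀ T x₀ (j + 1)) < ENNReal.ofReal α := by
  by_contra hcon
  have hs : s ≤ T := h2.le.trans (time_le h _)
  rw [time_succ] at h2
  exact absurd (h2.trans_le (min_le_right _ _))
    (not_lt.mpr (sInf_le ⟨h1, hs, not_lt.mp hcon⟩))

/-- A certificate strictly below `α` stays so slightly to the right, so the infimum lies beyond `s`.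
Taken at `s = t_j` this gives strict progress; taken at `s = t_{j+1}` it forbids stopping early. -/
theorem lt_time_succ (hS : S.Centered) (hq : S.IsC1Path q t₀ T) (h : t₀ < T) {j : ℕ} {s : EReal}
    (h1 : S.time α q t₀ T x₀ j ≤ s) (h2 : s ≤ S.time α q t₀ T x₀ (j + 1)) (hsT : s < T)
    (hsig : 0 < S.sig (q s) (S.point α q t₀ T x₀ (j + 1)))
    (hcert : S.certificate (q s) (S.point α q t₀ T x₀ (j + 1)) < ENNReal.ofReal α) :
    s < S.time α q t₀ T x₀ (j + 1) := by
  have hs : s ∈ Icc t₀ T := ⟨(le_time h j).trans h1, hsT.le⟩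
  have hev := (continuousWithinAt_certificate hS hq hs hsig).eventually (gt_mem_nhds hcert)
  have hev2 : ∀ᶠ r in 𝓝[≥] s, S.certificate (q r) (S.point α q t₀ T x₀ (j + 1))
      < ENNReal.ofReal α := by
    refine Filter.Eventually.filter_mono (nhdsWithin_le_iff.mpr ?_) hev
    filter_upwards [self_mem_nhdsWithin, nhdsWithin_le_nhds (Iio_mem_nhds hsT)] with r hr1 hr2
    exact ⟨hs.1.trans hr1, le_of_lt hr2⟩
  obtain ⟨s', hs', hsub⟩ := (mem_nhdsGE_iff_exists_Ico_subset' hsT).mp hev2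
  rw [time_succ] at h2 ⊢
  refine lt_min hsT (lt_of_lt_of_le hs' (le_sInf fun r hr => ?_))
  have hsr : s ≤ r := h2.trans ((min_le_right _ _).trans (sInf_le hr))
  by_contra hcon
  exact absurd (hsub ⟨hsr, not_le.mp hcon⟩) (not_lt.mpr hr.2.2)

theorem Reached.mono {j k : ℕ} (hjk : j ≤ k) (h : S.Reached α q t₀ T x₀ k) :
    S.Reached α q t₀ T x₀ j := fun i hi => h i (hi.trans_le hjk)

theorem Reached.succ {j : ℕ} (h : S.Reached α q t₀ T x₀ j)
    (hd : S.NewtonDefined (q (S.time α q t₀ T x₀ j)) (S.point α q t₀ T x₀ j)) :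
    S.Reached α q t₀ T x₀ (j + 1) := fun i hi => by
  rcases Nat.lt_succ_iff_lt_or_eq.mp hi with h1 | rfl
  · exact h i h1
  · exact hd

variable (S) in
/-- Assumptions on a homotopy problem. -/
structure Problem (q : EReal → S.Sys) (t₀ T : EReal) (x₀ : Pt n) (α : ℝ) : Prop where
  centered : S.Centered
  path : S.IsC1Path q t₀ T
  lt : t₀ < T
  start : S.certificate (q t₀) x₀ ≤ ENNReal.ofReal α
  lt_alpha : 0.07 ≤ α
  alpha_le : α ≤ 0.0747

namespace Problem

theorem time_mem_Icc (P : S.Problem q t₀ T x₀ α) (j : ℕ) :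
    S.time α q t₀ T x₀ j ∈ Icc t₀ T :=
  time_mem P.lt j

theorem ne_zero (P : S.Problem q t₀ T x₀ α) {s : EReal} (hs : s ∈ Icc t₀ T) :
    ∀ i, q s i ≠ 0 := P.path.ne_zero s hs

theorem sig_pos (P : S.Problem q t₀ T x₀ α) {s : EReal} (hs : s ∈ Icc t₀ T) {x : Pt n}
    (h : S.certificate (q s) x ≤ ENNReal.ofReal α) : 0 < S.sig (q s) x :=
  ((certificate_le_iff P.centered (P.ne_zero hs) (by linarith [P.lt_alpha])).mp h).1

theorem le_bound (P : S.Problem q t₀ T x₀ α) {c : ℝ≥0∞} (h : c ≤ ENNReal.ofReal α) :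
    c ≤ ENNReal.ofReal 0.0747 := h.trans (ENNReal.ofReal_le_ofReal P.alpha_le)

theorem small_lt (P : S.Problem q t₀ T x₀ α) {a : ℝ} (ha : a < 0.07) {c : ℝ≥0∞}
    (h : c ≤ ENNReal.ofReal a) : c < ENNReal.ofReal α :=
  h.trans_lt ((ENNReal.ofReal_lt_ofReal_iff (by linarith [P.lt_alpha])).mpr
    (by linarith [P.lt_alpha]))

theorem certificate_succ_le (P : S.Problem q t₀ T x₀ α) {j : ℕ}
    (h : S.certificate (q (S.time α q t₀ T x₀ j)) (S.point α q t₀ T x₀ j) ≤ ENNReal.ofReal α) :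
    S.certificate (q (S.time α q t₀ T x₀ j)) (S.point α q t₀ T x₀ (j + 1)) ≤
      ENNReal.ofReal 0.0085 :=
  certificate_newtonStep_le P.centered (P.ne_zero (P.time_mem_Icc j)) (P.le_bound h)

theorem time_lt_succ (P : S.Problem q t₀ T x₀ α) {j : ℕ}
    (h : S.certificate (q (S.time α q t₀ T x₀ j)) (S.point α q t₀ T x₀ j) ≤ ENNReal.ofReal α)
    (hT : S.time α q t₀ T x₀ j < T) :
    S.time α q t₀ T x₀ j < S.time α q t₀ T x₀ (j + 1) := by
  have h1 := P.small_lt (by norm_num) (P.certificate_succ_le h)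
  exact lt_time_succ P.centered P.path P.lt le_rfl (time_le_succ P.lt j) hT
    (P.sig_pos (P.time_mem_Icc j) h1.le) h1

/-- At a reached step, the point is certified or it is a degenerate zero. -/
theorem step_cases (P : S.Problem q t₀ T x₀ α) (j : ℕ) (hj : S.Reached α q t₀ T x₀ j) :
    S.certificate (q (S.time α q t₀ T x₀ j)) (S.point α q t₀ T x₀ j) ≤ ENNReal.ofReal α ∨
      (S.sig (q (S.time α q t₀ T x₀ j)) (S.point α q t₀ T x₀ j) = 0 ∧
        S.F (q (S.time α q t₀ T x₀ j)) (S.point α q t₀ T x₀ j) = 0 ∧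
        ∃ k, j = k + 1 ∧ S.time α q t₀ T x₀ k < S.time α q t₀ T x₀ j) := by
  induction j with
  | zero => exact Or.inl P.start
  | succ k ih =>
    have hk := ih (hj.mono (Nat.le_succ k))
    have hdef := (newtonDefined_iff P.centered (P.ne_zero (P.time_mem_Icc k)) _).mp
      (hj k (Nat.lt_succ_self k))
    rcases hk with hk | ⟨hk, -⟩
    · have h1 := P.small_lt (by norm_num) (P.certificate_succ_le hk)
      -- A step of zero duration keeps the small certificate obtained after Newton. Otherwise
      -- `t_{k+1}` is a left limit of certified times.
      rcases (time_le_succ P.lt k : S.time α q t₀ T x₀ k ≤ _).eq_or_lt with heq | hlt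
      · left
        rw [← heq]
        exact h1.le
      · have hne : (𝓝[Ioo (S.time α q t₀ T x₀ k) (S.time α q t₀ T x₀ (k + 1))]
            (S.time α q t₀ T x₀ (k + 1))).NeBot := right_nhdsWithin_Ioo_neBot hlt
        have hsub : Ioo (S.time α q t₀ T x₀ k) (S.time α q t₀ T x₀ (k + 1)) ⊆ Icc t₀ T :=
          fun s hs => ⟨(le_time P.lt k).trans hs.1.le, hs.2.le.trans (time_le P.lt _)⟩
        rcases certificate_limit P.centered P.path (P.time_mem_Icc (k + 1))
          (nhdsWithin_mono _ hsub) (x := S.point α q t₀ T x₀ (k + 1)) (α := α)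
          (by linarith [P.lt_alpha])
          (by filter_upwards [self_mem_nhdsWithin] with s hs
              exact (certificate_lt_of_lt_time_succ P.lt hs.1 hs.2).le) with h | h
        · exact Or.inl h.2
        · exact Or.inr ⟨h.1, h.2, k, rfl, hlt⟩
    · exact absurd hk hdef.ne'

theorem certificate_le (P : S.Problem q t₀ T x₀ α) {j : ℕ} (hj : S.Reached α q t₀ T x₀ (j + 1)) :
    S.certificate (q (S.time α q t₀ T x₀ j)) (S.point α q t₀ T x₀ j) ≤ ENNReal.ofReal α := by
  have hdef := (newtonDefined_iff P.centered (P.ne_zero (P.time_mem_Icc j)) _).mp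
    (hj j (Nat.lt_succ_self j))
  rcases P.step_cases j (hj.mono (Nat.le_succ j)) with h | h
  · exact h
  · exact absurd h.1 hdef.ne'

end Problem

variable (S α q t₀ T x₀) in
/-- The times of the `j`-th step at which the point `x_{j+1}` is certified. -/
def Certified (j : ℕ) (s : EReal) : Prop :=
  S.Reached α q t₀ T x₀ (j + 1) ∧ S.time α q t₀ T x₀ j ≤ s ∧ s ≤ S.time α q t₀ T x₀ (j + 1) ∧
    S.certificate (q s) (S.point α q t₀ T x₀ (j + 1)) ≤ ENNReal.ofReal α

namespace Problem

theorem mem_Icc (P : S.Problem q t₀ T x₀ α) {j : ℕ} {s : EReal}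
    (h : S.Certified q t₀ T x₀ α j s) : s ∈ Icc t₀ T :=
  ⟨(le_time P.lt j).trans h.2.1, h.2.2.1.trans (time_le P.lt _)⟩

theorem certified_left (P : S.Problem q t₀ T x₀ α) {j : ℕ}
    (hj : S.Reached α q t₀ T x₀ (j + 1)) :
    S.Certified q t₀ T x₀ α j (S.time α q t₀ T x₀ j) :=
  ⟨hj, le_rfl, time_le_succ P.lt j,
    (P.small_lt (by norm_num) (P.certificate_succ_le (P.certificate_le hj))).le⟩

theorem certified_right (P : S.Problem q t₀ T x₀ α) {j : ℕ}
    (hj : S.Reached α q t₀ T x₀ (j + 2)) :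
    S.Certified q t₀ T x₀ α j (S.time α q t₀ T x₀ (j + 1)) :=
  ⟨hj.mono (Nat.le_succ _), time_le_succ P.lt j, le_rfl, P.certificate_le hj⟩

theorem certified_of_lt (P : S.Problem q t₀ T x₀ α) {j : ℕ} {s : EReal}
    (hj : S.Reached α q t₀ T x₀ (j + 1)) (h1 : S.time α q t₀ T x₀ j ≤ s)
    (h2 : s < S.time α q t₀ T x₀ (j + 1)) : S.Certified q t₀ T x₀ α j s := by
  rcases h1.eq_or_lt with rfl | h
  · exact P.certified_left hj
  · exact ⟨hj, h1, h2.le, (certificate_lt_of_lt_time_succ P.lt h h2).le⟩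

theorem reached_next (P : S.Problem q t₀ T x₀ α) {j : ℕ}
    (h : S.Certified q t₀ T x₀ α j (S.time α q t₀ T x₀ (j + 1))) :
    S.Reached α q t₀ T x₀ (j + 2) :=
  h.1.succ ((newtonDefined_iff P.centered (P.ne_zero (P.mem_Icc h)) _).mpr
    (P.sig_pos (P.mem_Icc h) h.2.2.2))

/-- A time certified for both `j` and `k > j` equals `t_{j+1} = ⋯ = t_k`. The system is then fixed,
and passing from each point to the next is a Newton step, which preserves the attached zero. -/
theorem isZeroNear_of_le (P : S.Problem q t₀ T x₀ α) {j k : ℕ} (hjk : j ≤ k) {s : EReal}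
    {w : Pt n} (hj : S.Certified q t₀ T x₀ α j s) (hk : S.Certified q t₀ T x₀ α k s)
    (hw : S.IsZeroNear (q s) (S.point α q t₀ T x₀ (j + 1)) w) :
    S.IsZeroNear (q s) (S.point α q t₀ T x₀ (k + 1)) w := by
  induction k, hjk using Nat.le_induction with
  | base => exact hw
  | succ k hjk ih =>
    have hs : s = S.time α q t₀ T x₀ (k + 1) :=
      le_antisymm (hj.2.2.1.trans (time_mono P.lt (Nat.succ_le_succ hjk))) hk.2.1
    have hkk := P.certified_right hk.1
    rw [← hs] at hkk
    have h1 := (ih hkk).newtonStep P.centered (P.ne_zero (P.mem_Icc hk)) (P.le_bound hkk.2.2.2)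
    rw [point_succ (k + 1), ← hs]
    exact h1

theorem exists_zero_near (P : S.Problem q t₀ T x₀ α) {j : ℕ} {s : EReal}
    (h : S.Certified q t₀ T x₀ α j s) :
    ∃ z, S.IsZeroNear (q s) (S.point α q t₀ T x₀ (j + 1)) z :=
  exists_isZeroNear P.centered (P.ne_zero (P.mem_Icc h)) (P.le_bound h.2.2.2)

/-- There is a path of zeros that stays near the points of the recurrence. -/
theorem exists_path (P : S.Problem q t₀ T x₀ α) : ∃ z : EReal → Pt n, ∀ j s,
    S.Certified q t₀ T x₀ α j s →
      S.IsZeroNear (q s) (S.point α q t₀ T x₀ (j + 1)) (z s) := by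
  have key : ∀ s, ∃ w : Pt n, ∀ j, S.Certified q t₀ T x₀ α j s →
      S.IsZeroNear (q s) (S.point α q t₀ T x₀ (j + 1)) w := by
    intro s
    by_cases hex : ∃ j, S.Certified q t₀ T x₀ α j s
    · classical
      have hmin := Nat.find_spec hex
      obtain ⟨w, hw⟩ := P.exists_zero_near hmin
      exact ⟨w, fun j hj => P.isZeroNear_of_le (Nat.find_min' hex hj) hmin hj hw⟩
    · exact ⟨0, fun j hj => absurd ⟨j, hj⟩ hex⟩
  choose z hz using key
  exact ⟨z, fun j s => hz s j⟩

theorem mem_domain_iff (P : S.Problem q t₀ T x₀ α) {s : EReal} :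
    s ∈ S.domain α q t₀ T x₀ ↔ ∃ j, S.Certified q t₀ T x₀ α j s := by
  constructor
  · rintro ⟨h0, j, hj, h⟩
    have key : ∀ j, S.Reached α q t₀ T x₀ (j + 1) → s < S.time α q t₀ T x₀ (j + 1) →
        ∃ k, S.Certified q t₀ T x₀ α k s := by
      intro j
      induction j with
      | zero => exact fun hj hs => ⟨0, P.certified_of_lt hj h0 hs⟩
      | succ k ih =>
        intro hj hs
        rcases lt_or_ge s (S.time α q t₀ T x₀ (k + 1)) with h1 | h1
        · exact ih (hj.mono (Nat.le_succ _)) h1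
        · exact ⟨k + 1, P.certified_of_lt hj h1 hs⟩
    rcases h with h | h
    · rcases h.eq_or_lt with rfl | h
      · exact ⟨j, P.certified_left hj⟩
      · exact key j hj (h.trans_le (time_le_succ P.lt j))
    · exact key j hj h
  · rintro ⟨j, hj⟩
    refine ⟨(P.mem_Icc hj).1, ?_⟩
    rcases hj.2.2.1.eq_or_lt with h | h
    · have h2 := hj
      rw [h] at h2
      exact ⟨j + 1, P.reached_next h2, Or.inl h.le⟩
    · exact ⟨j, hj.1, Or.inr h⟩

/-- Near a time of the domain, the domain is covered by two steps. -/
theorem exists_steps_near (P : S.Problem q t₀ T x₀ α) {s : EReal}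
    (hs : s ∈ S.domain α q t₀ T x₀) : ∃ j k, S.Certified q t₀ T x₀ α j s ∧
      S.Certified q t₀ T x₀ α k s ∧ ∀ᶠ r in 𝓝[S.domain α q t₀ T x₀] s,
        S.Certified q t₀ T x₀ α j r ∨ S.Certified q t₀ T x₀ α k r := by
  classical
  have hex := P.mem_domain_iff.mp hs
  -- Minimality of `k` forces `s = t₀` or `t_k < s`, so step `k` covers the left side. If `s =
  -- t_{k+1} < T`, step `k + 1` covers the right side.
  set k := Nat.find hex with hkdef
  have hk : S.Certified q t₀ T x₀ α k s := Nat.find_spec hex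
  have hleft : ∀ᶠ r in 𝓝[S.domain α q t₀ T x₀] s, r < s → S.Certified q t₀ T x₀ α k r := by
    rcases hk.2.1.eq_or_lt with heq | hlt
    · rcases Nat.eq_zero_or_pos k with h0 | hpos
      · filter_upwards [self_mem_nhdsWithin] with r hr hrs
        rw [h0] at heq
        have h0 : t₀ = s := heq
        exact absurd hrs (not_lt.mpr (h0 ▸ hr.1))
      · obtain ⟨m, hm⟩ := Nat.exists_eq_succ_of_ne_zero hpos.ne'
        have h1 := P.certified_right (j := m) (by rw [← Nat.succ_eq_add_one m.succ]; exact hm ▸ hk.1)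
        have h2 : S.Certified q t₀ T x₀ α m s := by
          rw [← heq, hm]; exact h1
        exact absurd h2 (Nat.find_min hex (by omega))
    · filter_upwards [nhdsWithin_le_nhds (Ioi_mem_nhds hlt)] with r hr hrs
      exact P.certified_of_lt hk.1 (le_of_lt hr) (hrs.trans_le hk.2.2.1)
  rcases hk.2.2.1.eq_or_lt with heq | hlt
  · have hk' := hk
    rw [heq] at hk'
    have hR := P.reached_next hk'
    rcases (P.mem_Icc hk).2.eq_or_lt with hT | hT
    · refine ⟨k, k, hk, hk, ?_⟩
      filter_upwards [hleft, self_mem_nhdsWithin] with r hr hrD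
      obtain ⟨i, hi⟩ := P.mem_domain_iff.mp hrD
      rcases ((P.mem_Icc hi).2.trans hT.ge).eq_or_lt with h | h
      · exact Or.inl (h ▸ hk)
      · exact Or.inl (hr h)
    · have hlt2 : s < S.time α q t₀ T x₀ (k + 2) := by
        have := P.time_lt_succ (P.certificate_le hR) (heq ▸ hT)
        rwa [← heq] at this
      have hk1 : S.Certified q t₀ T x₀ α (k + 1) s := by
        have := P.certified_left hR
        rwa [← heq] at this
      refine ⟨k, k + 1, hk, hk1, ?_⟩
      filter_upwards [hleft, nhdsWithin_le_nhds (Iio_mem_nhds hlt2)] with r hr hr2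
      rcases lt_or_ge r s with h | h
      · exact Or.inl (hr h)
      · exact Or.inr (P.certified_of_lt hR (heq ▸ h) hr2)
  · refine ⟨k, k, hk, hk, ?_⟩
    filter_upwards [hleft, nhdsWithin_le_nhds (Iio_mem_nhds hlt)] with r hr hr2
    rcases lt_or_ge r s with h | h
    · exact Or.inl (hr h)
    · exact Or.inl (P.certified_of_lt hk.1 (hk.2.1.trans h) hr2)

variable {z : EReal → Pt n}

/-- Within one step the reference point is fixed, so stability of zeros applies; the two pieces near
each time are then glued. -/
theorem continuousOn_path (P : S.Problem q t₀ T x₀ α)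
    (hz : ∀ j s, S.Certified q t₀ T x₀ α j s →
      S.IsZeroNear (q s) (S.point α q t₀ T x₀ (j + 1)) (z s)) :
    ContinuousOn z (S.domain α q t₀ T x₀) := by
  intro s hs
  have piece : ∀ j, S.Certified q t₀ T x₀ α j s →
      ContinuousWithinAt z {r | S.Certified q t₀ T x₀ α j r} s := by
    intro j hj
    have hsI := P.mem_Icc hj
    have hsub : {r | S.Certified q t₀ T x₀ α j r} ⊆ Icc t₀ T := fun r hr => P.mem_Icc hr
    refine tendsto_zero P.centered P.path hsI (nhdsWithin_mono s hsub)
      (x := S.point α q t₀ T x₀ (j + 1)) (P.sig_pos hsI hj.2.2.2) (hz j s hj).1 (hz j s hj).2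
      ?_ ?_
    · filter_upwards [self_mem_nhdsWithin] with r hr
      exact (hz j r hr).1
    · filter_upwards [self_mem_nhdsWithin] with r hr
      exact (hz j r hr).2
  obtain ⟨j, k, hj, hk, hev⟩ := P.exists_steps_near hs
  exact ((piece j hj).union (piece k hk)).mono_of_mem_nhdsWithin hev

theorem sig_path_pos (P : S.Problem q t₀ T x₀ α)
    (hz : ∀ j s, S.Certified q t₀ T x₀ α j s →
      S.IsZeroNear (q s) (S.point α q t₀ T x₀ (j + 1)) (z s)) {s : EReal}
    (hs : s ∈ S.domain α q t₀ T x₀) : 0 < S.sig (q s) (z s) := by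
  obtain ⟨j, hj⟩ := P.mem_domain_iff.mp hs
  have h1 := (hz j s hj).le_sig P.centered (P.ne_zero (P.mem_Icc hj))
  have h2 := P.sig_pos (P.mem_Icc hj) hj.2.2.2
  linarith

theorem domain_subset (P : S.Problem q t₀ T x₀ α) : S.domain α q t₀ T x₀ ⊆ Icc t₀ T := fun s hs => by
  obtain ⟨j, hj⟩ := P.mem_domain_iff.mp hs
  exact P.mem_Icc hj

theorem contDiffOn_path (P : S.Problem q t₀ T x₀ α)
    (hz : ∀ j s, S.Certified q t₀ T x₀ α j s →
      S.IsZeroNear (q s) (S.point α q t₀ T x₀ (j + 1)) (z s)) :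
    ContDiffOn ℝ 1 (fun τ : ℝ => z τ) {τ : ℝ | (τ : EReal) ∈ S.domain α q t₀ T x₀} := by
  refine contDiffOn_zero P.centered (p := fun τ : ℝ => q τ)
    (P.path.contDiffOn.mono fun τ hτ => P.domain_subset hτ) ?_
    (fun τ hτ => P.ne_zero (P.domain_subset hτ)) (fun τ hτ => ?_)
    (fun τ hτ => P.sig_path_pos hz hτ)
  · exact (P.continuousOn_path hz).comp continuous_coe_real_ereal.continuousOn fun τ hτ => hτ
  · obtain ⟨j, hj⟩ := P.mem_domain_iff.mp hτ
    exact (hz j _ hj).1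

theorem isSmoothOn_step (P : S.Problem q t₀ T x₀ α)
    (hz : ∀ j s, S.Certified q t₀ T x₀ α j s →
      S.IsZeroNear (q s) (S.point α q t₀ T x₀ (j + 1)) (z s)) {j : ℕ}
    (hj : S.Reached α q t₀ T x₀ (j + 1)) :
    S.IsSmoothOn q z {τ : ℝ | S.time α q t₀ T x₀ j < (τ : EReal) ∧
      (τ : EReal) < S.time α q t₀ T x₀ (j + 1)} := by
  have hsub : {τ : ℝ | S.time α q t₀ T x₀ j < (τ : EReal) ∧
      (τ : EReal) < S.time α q t₀ T x₀ (j + 1)} ⊆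
      {τ : ℝ | (τ : EReal) ∈ S.domain α q t₀ T x₀} := fun τ hτ =>
    P.mem_domain_iff.mpr ⟨j, P.certified_of_lt hj hτ.1.le hτ.2⟩
  refine ⟨?_, ?_, (P.contDiffOn_path hz).mono hsub, fun τ hτ => P.ne_zero
    (P.domain_subset (hsub hτ)), fun τ hτ => P.sig_path_pos hz (hsub hτ)⟩
  · exact (isOpen_Ioo (a := S.time α q t₀ T x₀ j)).preimage continuous_coe_real_ereal
  · exact P.path.contDiffOn.mono fun τ hτ => P.domain_subset (hsub hτ)

/-- The condition length of a step that ends at a degenerate point is infinite. -/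
theorem condLength_eq_top (P : S.Problem q t₀ T x₀ α)
    (hz : ∀ j s, S.Certified q t₀ T x₀ α j s →
      S.IsZeroNear (q s) (S.point α q t₀ T x₀ (j + 1)) (z s)) {j : ℕ}
    (hj : S.Reached α q t₀ T x₀ (j + 1))
    (hlt : S.time α q t₀ T x₀ j < S.time α q t₀ T x₀ (j + 1))
    (hsig : S.sig (q (S.time α q t₀ T x₀ (j + 1))) (S.point α q t₀ T x₀ (j + 1)) = 0) :
    S.condLength q z (S.time α q t₀ T x₀ j) (S.time α q t₀ T x₀ (j + 1)) = ⊤ := by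
  by_contra hL
  have hsm := P.isSmoothOn_step hz hj
  obtain ⟨a, ha1, ha2⟩ := EReal.lt_iff_exists_real_btwn.mp hlt
  set L := S.condLength q z (S.time α q t₀ T x₀ j) (S.time α q t₀ T x₀ (j + 1)) with hLdef
  have hapos := hsm.sig_pos a ⟨ha1, ha2⟩
  -- Finite length `L` would give `σ(z_t) ≥ σ(z_a) e^{-L}`, while nearness gives `σ(z_t) ≤ 1.18
  -- σ(x_{j+1})`, which tends to `0`.
  set m := S.sig (q a) (z a) * Real.exp (-L.toReal) with hm
  have hmpos : 0 < m := mul_pos hapos (Real.exp_pos _)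
  have hne : (𝓝[Ioo (a : EReal) (S.time α q t₀ T x₀ (j + 1))]
    (S.time α q t₀ T x₀ (j + 1))).NeBot := right_nhdsWithin_Ioo_neBot ha2
  have hsub : Ioo (a : EReal) (S.time α q t₀ T x₀ (j + 1)) ⊆ Icc t₀ T := fun s hs =>
    ⟨(le_time P.lt j).trans (ha1.trans hs.1).le, hs.2.le.trans (time_le P.lt _)⟩
  have hlim := tendsto_sig P.centered P.path (P.time_mem_Icc (j + 1)) (nhdsWithin_mono _ hsub)
    (tendsto_const_nhds (x := S.point α q t₀ T x₀ (j + 1)))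
  rw [hsig] at hlim
  have hlim2 := hlim.const_mul 1.18
  rw [mul_zero] at hlim2
  have : m ≤ 0 := by
    refine ge_of_tendsto hlim2 ?_
    filter_upwards [self_mem_nhdsWithin] with s hs
    have hcert := P.certified_of_lt hj (ha1.trans hs.1).le hs.2
    have h1 := (hz j s hcert).sig_le P.centered (P.ne_zero (hsub hs))
    refine le_trans ?_ h1
    lift s to ℝ using ⟨(hs.2.trans_le le_top).ne, ((EReal.bot_lt_coe a).trans hs.1).ne'⟩ with b
    have hab : a ≤ b := by exact_mod_cast hs.1.le
    have hI : Icc a b ⊆ {τ : ℝ | S.time α q t₀ T x₀ j < (τ : EReal) ∧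
        (τ : EReal) < S.time α q t₀ T x₀ (j + 1)} := fun τ hτ =>
      ⟨ha1.trans_le (by exact_mod_cast hτ.1), lt_of_le_of_lt (by exact_mod_cast hτ.2) hs.2⟩
    have h2 := hsm.log_sig_sub_le P.centered hab hI
    have h3 := hsm.ofReal_integral_le_condLength P.centered hab hI ha1 hs.2
    rw [← hLdef, ENNReal.ofReal_le_iff_le_toReal hL] at h3
    have hbpos := hsm.sig_pos b (hI (right_mem_Icc.mpr hab))
    rw [hm, ← Real.log_le_log_iff hmpos hbpos, Real.log_mul hapos.ne' (Real.exp_pos _).ne',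
      Real.log_exp]
    linarith
  linarith

/-- Lower bound for the condition length of a step. -/
theorem le_condLength (P : S.Problem q t₀ T x₀ α)
    (hz : ∀ j s, S.Certified q t₀ T x₀ α j s →
      S.IsZeroNear (q s) (S.point α q t₀ T x₀ (j + 1)) (z s)) {j : ℕ}
    (hj : S.Reached α q t₀ T x₀ (j + 1)) (hT : S.time α q t₀ T x₀ (j + 1) < T) {δ : ℝ}
    (hδ : δ ≤ 0.0852) : ENNReal.ofReal δ ≤
      S.condLength q z (S.time α q t₀ T x₀ j) (S.time α q t₀ T x₀ (j + 1)) := by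
  by_contra hcon
  have hL := not_le.mp hcon
  set L := S.condLength q z (S.time α q t₀ T x₀ j) (S.time α q t₀ T x₀ (j + 1)) with hLdef
  have hLtop : L ≠ ⊤ := hL.ne_top
  have hLδ : L.toReal ≤ 0.0852 := by
    refine le_trans ?_ hδ
    have hδ0 : 0 < δ := ENNReal.ofReal_pos.mp (lt_of_le_of_lt (zero_le) hL)
    exact ENNReal.toReal_le_of_le_ofReal hδ0.le hL.le
  have hjT : S.time α q t₀ T x₀ j < T := (time_le_succ P.lt j).trans_lt hT
  have hlt := P.time_lt_succ (P.certificate_le hj) hjT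
  have hsm := P.isSmoothOn_step hz hj
  set x := S.point α q t₀ T x₀ (j + 1) with hx
  -- A degenerate end would make the length infinite, contrary to the assumed bound.
  have hpos1 : 0 < S.sig (q (S.time α q t₀ T x₀ (j + 1))) x := by
    rcases (sig_nonneg (q (S.time α q t₀ T x₀ (j + 1))) x).eq_or_lt with h | h
    · exact absurd (P.condLength_eq_top hz hj hlt h.symm) hLtop
    · exact h
  have hleft := P.certified_left hj
  have hc0 := P.certificate_succ_le (P.certificate_le hj)
  have hmem0 := P.time_mem_Icc j
  have hz0 := (hz j _ hleft).dist_le P.centered (P.ne_zero hmem0) hc0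
  have hs0 := sig_sub_le' P.centered (P.ne_zero hmem0) x (z (S.time α q t₀ T x₀ j))
  have hx0pos := P.sig_pos hmem0 hleft.2.2.2
  rw [← hx] at hz0 hx0pos
  have hz0pos : 0 < S.sig (q (S.time α q t₀ T x₀ j)) (z (S.time α q t₀ T x₀ j)) := by linarith
  -- Newton has just been applied, so the distance is `0.0172 σ(x)`, and `0.0172 / (1 - 0.0172) <
  -- 0.01755`.
  have hU0 : S.nuR * ‖S.J (z (S.time α q t₀ T x₀ j) - x)‖ /
      S.sig (q (S.time α q t₀ T x₀ j)) (z (S.time α q t₀ T x₀ j)) ≤ 0.01755 := by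
    rw [div_le_iff₀ hz0pos]; linarith
  have htrack : ∀ τ ∈ {τ : ℝ | S.time α q t₀ T x₀ j < (τ : EReal) ∧
      (τ : EReal) < S.time α q t₀ T x₀ (j + 1)},
      S.nuR * ‖S.J (z (τ : EReal) - x)‖ ≤ S.sig (q τ) (z τ) := by
    intro τ hτ
    have hc := P.certified_of_lt hj hτ.1.le hτ.2
    have h1 := (hz j _ hc).le_sig P.centered (P.ne_zero (P.mem_Icc hc))
    have h2 := (hz j _ hc).2
    have h3 := P.sig_pos (P.mem_Icc hc) hc.2.2.2
    rw [← hx] at h1 h2 h3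
    linarith
  have hcert : ∀ s ∈ Ioo (S.time α q t₀ T x₀ j) (S.time α q t₀ T x₀ (j + 1)),
      S.certificate (q s) x ≤ ENNReal.ofReal 0.069 := by
    intro s hs
    lift s to ℝ using ⟨(hs.2.trans_le le_top).ne, (bot_le.trans_lt hs.1).ne'⟩ with b
    have hcb := P.certified_of_lt hj hs.1.le hs.2
    have hbI := P.mem_Icc hcb
    have hbpos := hsm.sig_pos b hs
    have hne : (𝓝[Ioo (S.time α q t₀ T x₀ j) (b : EReal)]
      (S.time α q t₀ T x₀ j)).NeBot := left_nhdsWithin_Ioo_neBot hs.1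
    have hsub : Ioo (S.time α q t₀ T x₀ j) (b : EReal) ⊆ S.domain α q t₀ T x₀ := fun r hr =>
      P.mem_domain_iff.mpr ⟨j, P.certified_of_lt hj hr.1.le (hr.2.trans hs.2)⟩
    have hzlim : Tendsto z (𝓝[Ioo (S.time α q t₀ T x₀ j) (b : EReal)] (S.time α q t₀ T x₀ j))
        (𝓝 (z (S.time α q t₀ T x₀ j))) :=
      (P.continuousOn_path hz _ (P.mem_domain_iff.mpr ⟨j, hleft⟩)).mono_left
        (nhdsWithin_mono _ hsub)
    have hslim := tendsto_sig P.centered P.path hmem0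
      (nhdsWithin_mono _ (hsub.trans P.domain_subset)) hzlim
    have hUlim : Tendsto (fun s => S.nuR * ‖S.J (z s - x)‖ / S.sig (q s) (z s))
        (𝓝[Ioo (S.time α q t₀ T x₀ j) (b : EReal)] (S.time α q t₀ T x₀ j))
        (𝓝 (S.nuR * ‖S.J (z (S.time α q t₀ T x₀ j) - x)‖ /
          S.sig (q (S.time α q t₀ T x₀ j)) (z (S.time α q t₀ T x₀ j)))) :=
      (((S.J.continuous.tendsto _).comp (hzlim.sub_const x)).norm.const_mul S.nuR).div hslim
        hz0pos.ne'
    have hUb : S.nuR * ‖S.J (z b - x)‖ / S.sig (q b) (z b) - 0.0852 ≤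
        S.nuR * ‖S.J (z (S.time α q t₀ T x₀ j) - x)‖ /
          S.sig (q (S.time α q t₀ T x₀ j)) (z (S.time α q t₀ T x₀ j)) := by
      -- The time `t_j` may be `-∞`, and smoothness is known only inside the step. The estimate
      -- therefore starts at `a > t_j`, and `a` tends to `t_j`.
      refine ge_of_tendsto hUlim ?_
      filter_upwards [self_mem_nhdsWithin] with r hr
      lift r to ℝ using ⟨(hr.2.trans_le le_top).ne, (bot_le.trans_lt hr.1).ne'⟩ with a
      have hab : a ≤ b := by exact_mod_cast hr.2.le
      have hI : Icc a b ⊆ {τ : ℝ | S.time α q t₀ T x₀ j < (τ : EReal) ∧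
          (τ : EReal) < S.time α q t₀ T x₀ (j + 1)} := fun τ hτ =>
        ⟨hr.1.trans_le (by exact_mod_cast hτ.1), lt_of_le_of_lt (by exact_mod_cast hτ.2) hs.2⟩
      have h2 := hsm.tracking_sub_le P.centered hab hI x htrack
      have h3 := hsm.ofReal_integral_le_condLength P.centered hab hI hr.1 hs.2
      rw [← hLdef, ENNReal.ofReal_le_iff_le_toReal hLtop] at h3
      linarith
    -- The budget is `0.01755 + 0.0852 < 0.1028 = 2 · 0.0514`.
    have hUb2 : S.nuR * ‖S.J (z b - x)‖ / S.sig (q b) (z b) ≤ 2 * 0.0514 := by linarith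
    rw [div_le_iff₀ hbpos, ← neg_sub x, map_neg, norm_neg] at hUb2
    exact (certificate_le_iff P.centered (P.ne_zero hbI) (by norm_num)).mpr
      (certificate_of_zero P.centered (P.ne_zero hbI) hbpos (hz j _ hcb).1 hUb2)
  have hne : (𝓝[Ioo (S.time α q t₀ T x₀ j) (S.time α q t₀ T x₀ (j + 1))]
    (S.time α q t₀ T x₀ (j + 1))).NeBot := right_nhdsWithin_Ioo_neBot hlt
  have hsub : Ioo (S.time α q t₀ T x₀ j) (S.time α q t₀ T x₀ (j + 1)) ⊆ Icc t₀ T :=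
    fun s hs => ⟨(le_time P.lt j).trans hs.1.le, hs.2.le.trans (time_le P.lt _)⟩
  rcases certificate_limit P.centered P.path (P.time_mem_Icc (j + 1)) (nhdsWithin_mono _ hsub)
    (x := x) (α := 0.069) (by norm_num) (by
      filter_upwards [self_mem_nhdsWithin] with s hs
      exact hcert s hs) with h | h
  -- The certificate at `t_{j+1} < T` would be at most `0.069 < α`, so the step could not end there.
  · exact absurd (lt_time_succ P.centered P.path P.lt hlt.le le_rfl hT hpos1
      (P.small_lt (by norm_num) h.2)) (lt_irrefl _)
  · exact absurd h.1 hpos1.ne'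

theorem mul_le_condLength (P : S.Problem q t₀ T x₀ α)
    (hz : ∀ j s, S.Certified q t₀ T x₀ α j s →
      S.IsZeroNear (q s) (S.point α q t₀ T x₀ (j + 1)) (z s)) {δ : ℝ} (hδ : δ ≤ 0.0852) (m : ℕ)
    (hm : S.Reached α q t₀ T x₀ m) (hT : S.time α q t₀ T x₀ m < T) :
    (m : ℝ≥0∞) * ENNReal.ofReal δ ≤ S.condLength q z t₀ (S.time α q t₀ T x₀ m) := by
  induction m with
  | zero => simp
  | succ k ih =>
    have h1 := ih (hm.mono (Nat.le_succ k)) ((time_le_succ P.lt k).trans_lt hT)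
    have h2 := P.le_condLength hz hm hT hδ
    push_cast
    rw [add_mul, one_mul]
    exact (add_le_add h1 h2).trans
      (condLength_add_le q z (le_time P.lt k) (time_le_succ P.lt k))

/-- At a degenerate step the condition length from the start is infinite. -/
theorem degenerate_of_reached (P : S.Problem q t₀ T x₀ α)
    (hz : ∀ j s, S.Certified q t₀ T x₀ α j s →
      S.IsZeroNear (q s) (S.point α q t₀ T x₀ (j + 1)) (z s)) {j : ℕ}
    (hj : S.Reached α q t₀ T x₀ j)
    (hsig : S.sig (q (S.time α q t₀ T x₀ j)) (S.point α q t₀ T x₀ j) = 0)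
    (hlt : ∃ k, j = k + 1 ∧ S.time α q t₀ T x₀ k < S.time α q t₀ T x₀ j) :
    S.condLength q z t₀ (S.time α q t₀ T x₀ j) = ⊤ := by
  obtain ⟨k, rfl, hlt⟩ := hlt
  have h := P.condLength_eq_top hz hj hlt hsig
  exact top_le_iff.mp (h ▸ condLength_mono q z (le_time P.lt k) le_rfl)

theorem exists_final_step (P : S.Problem q t₀ T x₀ α)
    (hz : ∀ j s, S.Certified q t₀ T x₀ α j s →
      S.IsZeroNear (q s) (S.point α q t₀ T x₀ (j + 1)) (z s)) {δ : ℝ} (hδ0 : 0 < δ)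
    (hδ : δ ≤ 0.0852) (hL : S.condLength q z t₀ T ≠ ⊤) :
    ∃ N : ℕ, S.Reached α q t₀ T x₀ (N + 1) ∧ S.time α q t₀ T x₀ N = T ∧
      (N : ENNReal) ≤ 1 + S.condLength q z t₀ T / ENNReal.ofReal δ := by
  classical
  have hR : ∀ j, S.Reached α q t₀ T x₀ j := by
    intro j
    induction j with
    | zero => exact fun k hk => absurd hk (Nat.not_lt_zero k)
    | succ j ih =>
      rcases P.step_cases j ih with h | ⟨h1, -, h2⟩
      · exact ih.succ ((newtonDefined_iff P.centered (P.ne_zero (P.time_mem_Icc j)) _).mpr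
          (P.sig_pos (P.time_mem_Icc j) h))
      · exact absurd (top_le_iff.mp (P.degenerate_of_reached hz ih h1 h2 ▸
          condLength_mono q z le_rfl (time_le P.lt j))) hL
  have hδE : ENNReal.ofReal δ ≠ 0 := by simpa using hδ0
  have hbound : ∀ m, S.time α q t₀ T x₀ m < T →
      (m : ℝ≥0∞) ≤ S.condLength q z t₀ T / ENNReal.ofReal δ := fun m hm => by
    rw [ENNReal.le_div_iff_mul_le (Or.inl hδE) (Or.inl ENNReal.ofReal_ne_top)]
    exact (P.mul_le_condLength hz hδ m (hR m) hm).trans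
      (condLength_mono q z le_rfl (time_le P.lt m))
  have hex : ∃ N, S.time α q t₀ T x₀ N = T := by
    by_contra hcon
    push Not at hcon
    have hfin : S.condLength q z t₀ T / ENNReal.ofReal δ ≠ ⊤ := ENNReal.div_ne_top hL hδE
    obtain ⟨m, hm⟩ := ENNReal.exists_nat_gt hfin
    exact absurd (hbound m (lt_of_le_of_ne (time_le P.lt m) (hcon m))) (not_le.mpr hm)
  refine ⟨Nat.find hex, hR _, Nat.find_spec hex, ?_⟩
  rcases Nat.eq_zero_or_pos (Nat.find hex) with h0 | hpos
  · rw [h0]; simp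
  · obtain ⟨m, hm⟩ := Nat.exists_eq_succ_of_ne_zero hpos.ne'
    -- Only steps ending before `T` have a guaranteed length; the step that reaches `T` accounts for
    -- the extra `1`.
    have h1 := hbound m (lt_of_le_of_ne (time_le P.lt m) (Nat.find_min hex (by omega)))
    rw [hm, Nat.succ_eq_add_one, add_comm]
    push_cast
    exact add_le_add le_rfl h1

end Problem

/-- If `ν = 0`, all exponents of a support vanish, although it has two distinct points. Injectivity
of `J` is not used, so the lemma serves to establish `Centered`. -/
theorem nuR_ne_zero (hm : ∀ i, S.momentum i 0 = 0) (hn : 0 < n) : S.nuR ≠ 0 := by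
  intro h
  let i : Fin n := ⟨0, hn⟩
  obtain ⟨a, ha, b, hb, hab⟩ := Finset.one_lt_card.mp (S.two_le_card i)
  refine hab (funext fun k => ?_)
  have key : ∀ c : S.A i, (c : Fin n → ℝ) k = 0 := by
    intro c
    have h1 := norm_pairing_le hm i c (EuclideanSpace.single k 1)
    rw [h, zero_mul, norm_le_zero_iff] at h1
    simpa [pairing] using h1
  exact (key ⟨a, ha⟩).trans (key ⟨b, hb⟩).symm

/-- The existence of a certified point implies that `‖·‖₀` is a norm. -/
theorem centered_of_certificate (hm : ∀ i, S.momentum i 0 = 0) (hn : 0 < n) {f : S.Sys}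
    {x : Pt n} (h : S.certificate f x ≠ ⊤) : S.Centered := by
  refine ⟨hm, ?_, hn⟩
  have hU : IsUnit (S.condMat (S.renorm f x) 0) := by
    by_contra hU
    apply h
    have hν : ENNReal.ofReal S.nuR ≠ 0 := by
      simpa using lt_of_le_of_ne nuR_nonneg (nuR_ne_zero hm hn).symm
    rw [certificate, beta, fderiv_localFun hm, if_neg hU, mu, if_neg hU, nu_eq hm]
    simp [hν]
  -- The rows of `M` factor through `D[V](0)`, so the kernel of `J` lies in the trivial kernel of
  -- `M`.
  refine (injective_iff_map_eq_zero S.J).mpr fun v hv => ?_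
  refine (isUnit_iff_injective _).mp hU v ?_
  ext i
  have h1 : S.dProjV i 0 v = 0 := congrArg (fun w : PiLp 2 (fun i => S.Coord i) => w i) hv
  rw [condMat_apply, h1, map_zero]
  rfl

end Homotopy

end Supports

end Toric

end

/-! ### Choice of the constants and assembly. -/

theorem mainTheorem3 :
    ∃ α u δ : ℝ,
      (0.074609958 ≤ α ∧ α < 0.074609959) ∧ α < (13 - 3 * √17) / 4 ∧
      (0.129283177 ≤ u ∧ u < 0.129283178) ∧
      (0.085180825 ≤ δ ∧ δ < 0.085180826) ∧
      ∀ (n : ℕ), 2 ≤ n → ∀ (S : Toric.Supports n), (∀ i, S.momentum i 0 = 0) →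
      ∀ (t₀ T : EReal), t₀ < T →
      ∀ (q : EReal → S.Sys), S.IsC1Path q t₀ T →
      ∀ (x₀ : Toric.Pt n), S.certificate (q t₀) x₀ ≤ ENNReal.ofReal α →
      ∃ z : EReal → Toric.Pt n,
        -- the recurrence is well defined, unless it lands on a degenerate zero
        (∀ j, S.Reached α q t₀ T x₀ j →
          (S.NewtonDefined (q (S.time α q t₀ T x₀ j)) (S.point α q t₀ T x₀ j) ∧
            S.certificate (q (S.time α q t₀ T x₀ j)) (S.point α q t₀ T x₀ j)
              ≤ ENNReal.ofReal α ∧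
            (S.time α q t₀ T x₀ j < T →
              S.time α q t₀ T x₀ j < S.time α q t₀ T x₀ (j + 1))) ∨
          (S.eval (q (S.time α q t₀ T x₀ j)) (S.point α q t₀ T x₀ j) = 0 ∧
            ¬ S.NewtonDefined (q (S.time α q t₀ T x₀ j)) (S.point α q t₀ T x₀ j) ∧
            S.condLength q z t₀ (S.time α q t₀ T x₀ j) = ⊤)) ∧
        -- the path of nondegenerate zeros
        ContinuousOn z (S.domain α q t₀ T x₀) ∧
        ContDiffOn ℝ 1 (fun τ : ℝ => z τ) {τ : ℝ | (τ : EReal) ∈ S.domain α q t₀ T x₀} ∧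
        (∀ t ∈ S.domain α q t₀ T x₀,
          S.eval (q t) (z t) = 0 ∧ S.mu (S.renorm (q t) (z t)) 0 ≠ ⊤) ∧
        -- tracking of the path
        (∀ j, S.Reached α q t₀ T x₀ (j + 1) →
          ∀ t, S.time α q t₀ T x₀ j ≤ t → t < S.time α q t₀ T x₀ (j + 1) →
            S.tracking (q t) (z t) (S.point α q t₀ T x₀ (j + 1)) ≤ ENNReal.ofReal u) ∧
        -- condition length of a step
        (∀ j, S.Reached α q t₀ T x₀ (j + 1) → S.time α q t₀ T x₀ (j + 1) < T →
          ENNReal.ofReal δ ≤ S.condLength q z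
            (S.time α q t₀ T x₀ j) (S.time α q t₀ T x₀ (j + 1))) ∧
        -- number of steps
        (S.condLength q z t₀ T ≠ ⊤ →
          ∃ N : ℕ, S.Reached α q t₀ T x₀ (N + 1) ∧ S.time α q t₀ T x₀ N = T ∧
            (N : ENNReal) ≤ 1 + S.condLength q z t₀ T / ENNReal.ofReal δ) ∧
        -- the extra Newton step
        (∀ N : ℕ, S.Reached α q t₀ T x₀ (N + 1) → S.time α q t₀ T x₀ N = T →
          S.certificate (q T) (S.point α q t₀ T x₀ (N + 1)) ≤ ENNReal.ofReal α) := by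
  -- Only nine decimals are prescribed and the estimates have slack, so the truncated decimals
  -- themselves are taken.
  refine ⟨0.074609958, 0.129283177, 0.085180825, by norm_num, ?_, by norm_num, by norm_num, ?_⟩
  -- This gives `(13 - 3√17)/4 > 0.1`.
  · have h : √17 < 4.2 := by
      rw [Real.sqrt_lt' (by norm_num)]; norm_num
    linarith
  intro n hn S hm t₀ T hT q hq x₀ hx₀
  have hS := Toric.Supports.centered_of_certificate hm (by omega)
    (ne_top_of_le_ne_top ENNReal.ofReal_ne_top hx₀)
  have P : S.Problem q t₀ T x₀ 0.074609958 :=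
    ⟨hS, hq, hT, hx₀, by norm_num, by norm_num⟩
  obtain ⟨z, hz⟩ := P.exists_path
  have hmem : ∀ j, S.time 0.074609958 q t₀ T x₀ j ∈ Icc t₀ T :=
    Toric.Supports.time_mem hT
  refine ⟨z, fun j hj => ?_, P.continuousOn_path hz, P.contDiffOn_path hz, fun t ht => ?_,
    fun j hj t h1 h2 => ?_, fun j hj h => P.le_condLength hz hj h (by norm_num),
    P.exists_final_step hz (by norm_num) (by norm_num), fun N hN hNT => ?_⟩
  · have hdef := Toric.Supports.newtonDefined_iff hS (P.ne_zero (hmem j))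
      (S.point 0.074609958 q t₀ T x₀ j)
    rcases P.step_cases j hj with h | ⟨h1, h2, h3⟩
    · exact Or.inl ⟨hdef.mpr (P.sig_pos (hmem j) h), h, P.time_lt_succ h⟩
    · exact Or.inr ⟨(S.eval_eq_zero_iff _ _).mpr h2, fun hd => (hdef.mp hd).ne' h1,
        P.degenerate_of_reached hz hj h1 h3⟩
  · obtain ⟨j, hj⟩ := P.mem_domain_iff.mp ht
    refine ⟨(S.eval_eq_zero_iff _ _).mpr (hz j t hj).1, ?_⟩
    rw [Toric.Supports.mu_renorm_eq hS (P.ne_zero (P.mem_Icc hj))]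
    have hpos := P.sig_path_pos hz ht
    simpa using hpos
  · have hc := P.certified_of_lt hj h1 h2
    exact (hz j t hc).tracking_le hS (P.ne_zero (P.mem_Icc hc))
      (P.sig_pos (P.mem_Icc hc) hc.2.2.2) (by norm_num)
  · have hc := P.certified_left hN
    rw [hNT] at hc
    exact hc.2.2.2
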